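/- **Setting.** Let $G$ be a connected complex Lie group with simple Lie algebra $\mathfrak g$, realized as a linear group (every connected complex simple Lie group can be so realized): $\mathfrak g$ is a simple Lie subalgebra of a finite-dimensional unital associative algebra, e.g. of $M_N(\mathbb C)$, and $G$ is generated by $\exp\mathfrak g$. Let $\operatorname{tr}(\cdot\,\cdot)$ be a non-degenerate symmetric invariant bilinear form on $\mathfrak g$, and let $r:\mathfrak g\to\mathfrak g$ be a triangular $r$-matrix: $r$ is linear, antisymmetric for $\operatorname{tr}$, and $$r[rX,Y]+r[X,rY]-[rX,rY]=0\qquad(X,Y\in\mathfrak g).$$ The double is $D=\mathfrak g\rtimes G$ with product $(X,g)(X',g')=(X+\mathrm{Ad}_gX',gg')$. The dual group $G_r\subset D$ is the connected Lie subgroup with Lie algebra $\{(X,rX)\}$ (vector part $X$, group part $rX$), i.e. the subgroup generated by the elements $\left(\int_0^1\mathrm{Ad}_{e^{s\,rX}}X\,ds,\ e^{rX}\right)$, $X\in\mathfrak g$. At $\bar X=(X,h)\in G_r$ write $R_{\bar X}=\mathrm{Ad}_h\,r\,\mathrm{Ad}_h^{-1}$. The dual Poisson–Lie structure of $G_r$,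 contracted with the right-invariant form $\theta=\mathrm{Ad}_h\,d(\mathrm{Ad}_h^{-1}X)$, is $$\pi_{\bar X}(Y,Z)=\operatorname{tr}\big(Y[X,Z]-[X,Y]\,R_{\bar X}[X,Z]\big).$$ Let $\Sigma$ be an oriented surface, possibly with boundary and possibly non-compact, $\bar X=(X,h):\Sigma\to G_r$ a smooth map and $A$ a smooth $\mathfrak g$-valued one-form on $\Sigma$. Actions are integrals over a compact subset $K\subset\Sigma$ ($K=\Sigma$ if $\Sigma$ is compact). The action $S^*_{PL}(\bar X,A)$ of the Poisson sigma model with target $G_r$ is $\int_K\operatorname{tr}(\theta\wedge A)-\frac12\operatorname{tr}(A\wedge\pi^\sharp_{\bar X}A)$, where $\operatorname{tr}((\pi^\sharp Y)Z)=\pi(Y,Z)$, and $$S_{BF}(X,A)=\int_K\operatorname{tr}\Big(dX\wedge A-\tfrac12[X,A]\wedge A\Big).$$ A pair of fields is a *classical solution* of a model if, for every compact $K$ in the interior of $\Sigma$ and every smooth one-parameter family of fields through it which is constant outside $K$, the derivative of the action over $K$ at the given fields is zero. **Statement.** 1. For all smooth $(\bar X,A)$ and every compact $K\subset\Sigma$,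 $$S^*_{PL}(\bar X,A)=\int_K\operatorname{tr}\Big(dX\wedge A+dX\wedge R_{\bar X}[X,A]+\tfrac12A\wedge[X,A]-\tfrac12[X,A]\wedge R_{\bar X}[X,A]\Big),$$ $$S^*_{PL}(\bar X,A)=S_{BF}(X,A)-\frac12\int_K\operatorname{tr}\Big((dX+[A,X])\wedge R_{\bar X}(dX+[A,X])\Big)+T_K(\bar X),$$ where $T_K(\bar X)=\frac12\int_K\operatorname{tr}(dX\wedge R_{\bar X}\,dX)$ does not involve $A$. 2. The term $T_K$ is topological: if $K$ is a compact subset of the interior of $\Sigma$ and $\bar X_t:\Sigma\to G_r$, $t\in\mathbb R$, is a smooth family which does not depend on $t$ outside $K$, then $T_K(\bar X_t)=T_K(\bar X_0)$ for all $t$. 3. Hence the models are classically equivalent: a smooth pair $(\bar X,A)$ is a classical solution of the Poisson sigma model with target $G_r$ if and only if $(X,A)$ is a classical solution of BF-theory, and if and only if on $\Sigma$ $$dX+[A,X]=0,\qquad dA+[A,A]=0,$$ where $[A,A](v,w)=[A(v),A(w)]$. 4. BF-theory is the case $r=0$: $G_{r=0}=\{(X,e)\mid X\in\mathfrak g\}$,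 for every smooth $X:\Sigma\to\mathfrak g$ the map $(X,e):\Sigma\to G_{r=0}$ is smooth, and the Poisson sigma model action with target $G_{r=0}$ at $((X,e),A)$ equals $S_{BF}(X,A)$. -/

import Mathlib

open Set MeasureTheory
open scoped Manifold ContDiff

attribute [local instance] LieRing.ofAssociativeRing LieAlgebra.ofAssociativeAlgebra

noncomputable section

namespace DualTriangular

/-! ### Linear Lie groups and their tangent groups -/

/- The groups live in the unit group of a finite-dimensional unital associative complex algebra
`𝓐`, for instance the algebra of complex `N × N` matrices, whose unit group is `GL_N(ℂ)`. The
norm of `𝓐` matters only through the topology and the smooth structure, which do not depend on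
the choice of the norm. The Lie bracket of `𝓐` is the commutator. -/
variable {𝓐 : Type*} [NormedRing 𝓐] [NormedAlgebra ℂ 𝓐] [FiniteDimensional ℂ 𝓐]

instance instNormedAddCommGroup (𝔤 : LieSubalgebra ℂ 𝓐) : NormedAddCommGroup 𝔤 :=
  Submodule.normedAddCommGroup 𝔤.toSubmodule

instance instNormedSpaceComplex (𝔤 : LieSubalgebra ℂ 𝓐) : NormedSpace ℂ 𝔤 :=
  Submodule.normedSpace 𝔤.toSubmodule

instance instNormedSpaceReal (𝔤 : LieSubalgebra ℂ 𝓐) : NormedSpace ℝ 𝔤 :=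
  Submodule.normedSpace 𝔤.toSubmodule


theorem exp_mul_exp_neg (x : 𝓐) : NormedSpace.exp x * NormedSpace.exp (-x) = 1 := by
  have := FiniteDimensional.complete ℂ 𝓐
  let _ : NormedAlgebra ℚ 𝓐 := NormedAlgebra.restrictScalars ℚ ℂ 𝓐
  rw [← NormedSpace.exp_add_of_commute (Commute.neg_right (Commute.refl x))]
  simp [NormedSpace.exp_zero]

/-- The exponential of an element of `𝓐` as an invertible element. -/
def expUnit (x : 𝓐) : 𝓐ˣ where
  val := NormedSpace.exp x
  inv := NormedSpace.exp (-x)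
  val_inv := exp_mul_exp_neg x
  inv_val := by simpa using exp_mul_exp_neg (-x)

/-- The connected Lie subgroup `G` of `𝓐ˣ` with Lie algebra `𝔤`: the subgroup generated by
the exponentials of the elements of `𝔤`. -/
def linearGroup (𝔤 : LieSubalgebra ℂ 𝓐) : Subgroup 𝓐ˣ :=
  Subgroup.closure (Set.range fun x : 𝔤 => expUnit (x : 𝓐))

theorem isClosed_coe (𝔤 : LieSubalgebra ℂ 𝓐) : IsClosed (𝔤 : Set 𝓐) :=
  Submodule.closed_of_finiteDimensional 𝔤.toSubmodule

theorem exp_conj_mem (𝔤 : LieSubalgebra ℂ 𝓐) (y x : 𝓐) (hy : y ∈ 𝔤) (hx : x ∈ 𝔤) :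
    NormedSpace.exp y * x * NormedSpace.exp (-y) ∈ 𝔤 := by
  have := FiniteDimensional.complete ℂ 𝓐
  let _ : NormedAlgebra ℚ (𝓐 →L[ℂ] 𝓐) := NormedAlgebra.restrictScalars ℚ ℂ _
  obtain ⟨L, hLz⟩ : ∃ L : 𝓐 →L[ℂ] 𝓐, ∀ z, L z = y * z :=
    ⟨ContinuousLinearMap.mul ℂ 𝓐 y, fun z => rfl⟩
  obtain ⟨R, hRz⟩ : ∃ R : 𝓐 →L[ℂ] 𝓐, ∀ z, R z = z * (-y) :=
    ⟨(ContinuousLinearMap.mul ℂ 𝓐).flip (-y), fun z => rfl⟩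
  have hc : Commute L R := by
    ext z
    simp only [mul_apply_eq_comp, hLz, hRz, mul_assoc]
  have hexp (T : 𝓐 →L[ℂ] 𝓐) (z : 𝓐) :
      HasSum (fun n : ℕ => ((Nat.factorial n : ℂ)⁻¹) • (T ^ n) z) (NormedSpace.exp T z) := by
    have h := (NormedSpace.exp_series_hasSum_exp' (𝕂 := ℂ) T)
    have h' := (ContinuousLinearMap.apply ℂ 𝓐 z).hasSum h
    simpa only [Function.comp_def, ContinuousLinearMap.apply_apply,
      smul_apply] using h'
  have hm (w : 𝓐) : HasSum (fun n : ℕ => ((Nat.factorial n : ℂ)⁻¹) • w ^ n)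
      (NormedSpace.exp w) := NormedSpace.exp_series_hasSum_exp' (𝕂 := ℂ) w
  have hLn (n : ℕ) : ∀ z, (L ^ n) z = y ^ n * z := by
    induction n with
    | zero => intro z; simp
    | succ k ih =>
      intro z
      rw [pow_succ, mul_apply_eq_comp, ih, hLz, pow_succ, mul_assoc]
  have hRn (n : ℕ) : ∀ z, (R ^ n) z = z * (-y) ^ n := by
    induction n with
    | zero => intro z; simp
    | succ k ih =>
      intro z
      rw [pow_succ, mul_apply_eq_comp, ih, hRz, pow_succ', mul_assoc]
  have hL (z : 𝓐) : NormedSpace.exp L z = NormedSpace.exp y * z := by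
    refine (hexp L z).unique ?_
    have h := (hm y).mul_right z
    simpa only [hLn, smul_mul_assoc] using h
  have hR (z : 𝓐) : NormedSpace.exp R z = z * NormedSpace.exp (-y) := by
    refine (hexp R z).unique ?_
    have h := (hm (-y)).mul_left z
    simpa only [hRn, mul_smul_comm] using h
  have key : NormedSpace.exp y * x * NormedSpace.exp (-y) = NormedSpace.exp (L + R) x := by
    rw [NormedSpace.exp_add_of_commute hc, mul_apply_eq_comp, hR, hL, ← mul_assoc]
  rw [key]
  have hpow : ∀ n : ℕ, ((L + R) ^ n) x ∈ 𝔤 := by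
    intro n
    induction n with
    | zero => simpa using hx
    | succ k ih =>
      rw [pow_succ', mul_apply_eq_comp]
      have : (L + R) (((L + R) ^ k) x) = ⁅y, ((L + R) ^ k) x⁆ := by
        rw [add_apply, hLz, hRz, LieRing.of_associative_ring_bracket, mul_neg,
          sub_eq_add_neg]
      rw [this]
      exact 𝔤.lie_mem hy ih
  refine (isClosed_coe 𝔤).mem_of_tendsto (hexp (L + R) x) (Filter.Eventually.of_forall ?_)
  intro s
  exact 𝔤.toSubmodule.sum_mem fun n _ => 𝔤.toSubmodule.smul_mem _ (hpow n)

theorem conj_mem (𝔤 : LieSubalgebra ℂ 𝓐) (g : 𝓐ˣ) (hg : g ∈ linearGroup 𝔤) :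
    ∀ x ∈ 𝔤, (g : 𝓐) * x * ((g⁻¹ : 𝓐ˣ) : 𝓐) ∈ 𝔤 := by
  refine Subgroup.closure_induction'' (p := fun (g : 𝓐ˣ) _ => ∀ x ∈ 𝔤,
    (g : 𝓐) * x * ((g⁻¹ : 𝓐ˣ) : 𝓐) ∈ 𝔤) ?_ ?_ ?_ ?_ hg
  · rintro _ ⟨y, rfl⟩ x hx
    exact exp_conj_mem 𝔤 y x y.2 hx
  · rintro _ ⟨y, rfl⟩ x hx
    have := exp_conj_mem 𝔤 (-y) x (𝔤.neg_mem y.2) hx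
    rw [neg_neg] at this
    exact this
  · intro x hx
    simpa using hx
  · intro a b _ _ ha hb x hx
    have := ha _ (hb x hx)
    simpa [mul_assoc] using this

variable {𝔤 : LieSubalgebra ℂ 𝓐}

/-- The adjoint action `Ad_g x = g x g⁻¹` of `G` on `𝔤`. -/
def Ad (g : linearGroup 𝔤) : 𝔤 →ₗ[ℂ] 𝔤 where
  toFun x := ⟨((g : 𝓐ˣ) : 𝓐) * x * ((g : 𝓐ˣ)⁻¹ : 𝓐ˣ),
    conj_mem 𝔤 g g.2 x x.2⟩
  map_add' x y := by ext1; simp [mul_add, add_mul]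
  map_smul' c x := by ext1; simp

theorem Ad_one (x : 𝔤) : Ad (1 : linearGroup 𝔤) x = x := by
  ext1; simp [Ad]

theorem Ad_mul (g g' : linearGroup 𝔤) (x : 𝔤) : Ad (g * g') x = Ad g (Ad g' x) := by
  ext1; simp [Ad, mul_assoc]

/-- The exponential map `𝔤 → G`. -/
def expG (x : 𝔤) : linearGroup 𝔤 := ⟨expUnit x, Subgroup.subset_closure ⟨x, rfl⟩⟩

variable (𝔤) in
/-- The tangent group `D = TG ≅ 𝔤 ⋊ G`, the double of a triangular Lie bialgebra. The pair
`(X, g)` is the formal matrix `[[e, 0], [X, e]] g`. -/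
@[ext] structure Double where
  vec : 𝔤
  grp : linearGroup 𝔤

namespace Double

instance : Mul (Double 𝔤) := ⟨fun a b => ⟨a.vec + Ad a.grp b.vec, a.grp * b.grp⟩⟩
instance : One (Double 𝔤) := ⟨⟨0, 1⟩⟩
instance : Inv (Double 𝔤) := ⟨fun a => ⟨-(Ad a.grp⁻¹ a.vec), a.grp⁻¹⟩⟩

theorem mul_def (a b : Double 𝔤) : a * b = ⟨a.vec + Ad a.grp b.vec, a.grp * b.grp⟩ := rfl
theorem inv_def (a : Double 𝔤) : a⁻¹ = ⟨-(Ad a.grp⁻¹ a.vec), a.grp⁻¹⟩ := rfl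

instance : Group (Double 𝔤) :=
  Group.ofLeftAxioms
    (fun a b c => by
      simp only [mul_def, map_add, Ad_mul, mul_assoc, add_assoc])
    (fun a => by simp [mul_def, Ad_one, show (1 : Double 𝔤) = ⟨0, 1⟩ from rfl])
    (fun a => by simp [mul_def, inv_def, show (1 : Double 𝔤) = ⟨0, 1⟩ from rfl])

end Double

/-! ### Triangular `r`-matrices, the dual group and its Poisson structure -/

/-- `r` is a triangular `r`-matrix: antisymmetric for the invariant form `tr`, and a solution of
`r[rX, Y] + r[X, rY] - [rX, rY] = α [X, Y]` with `α = 0`. -/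
structure IsTriangularRMatrix (tr : LinearMap.BilinForm ℂ 𝔤) (r : 𝔤 →ₗ[ℂ] 𝔤) : Prop where
  antisymm : ∀ x y, tr (r x) y = -tr x (r y)
  yangBaxter : ∀ x y, r ⁅r x, y⁆ + r ⁅x, r y⁆ - ⁅r x, r y⁆ = 0

/-- The dual group `G_r ⊆ D`, the connected Lie subgroup with Lie algebra
`𝔤_r = {rX + Xε | X ∈ 𝔤}`: it is generated by the exponentials of the elements `rX + Xε`, which
are `(Y, e^{rX})` with `Y = ∫₀¹ Ad_{exp(s rX)} X ds`. -/
def dualGroup (r : 𝔤 →ₗ[ℂ] 𝔤) : Subgroup (Double 𝔤) :=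
  Subgroup.closure (Set.range fun x : 𝔤 =>
    (⟨∫ s in (0 : ℝ)..1, Ad (expG (s • r x)) x, expG (r x)⟩ : Double 𝔤))

/-- The operator `Ad_g r Ad_g⁻¹`. -/
def twist (r : 𝔤 →ₗ[ℂ] 𝔤) (g : linearGroup 𝔤) : 𝔤 →ₗ[ℂ] 𝔤 := Ad g ∘ₗ r ∘ₗ Ad g⁻¹

/-- The dual Poisson-Lie structure of `G_r` at `X̄ = (X, h)`, contracted with right-invariant
forms: `π(Y, Z) = tr (Y [X, Z] - [X, Y] Ad_h r Ad_h⁻¹ [X, Z])`. -/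
def dualPoisson (tr : LinearMap.BilinForm ℂ 𝔤) (r : 𝔤 →ₗ[ℂ] 𝔤) (a : Double 𝔤) (y z : 𝔤) : ℂ :=
  tr y ⁅a.vec, z⁆ - tr ⁅a.vec, y⁆ (twist r a.grp ⁅a.vec, z⁆)

/-! ### Smooth maps, forms and integration -/

section Manifold

variable {E' : Type*} [NormedAddCommGroup E'] [NormedSpace ℝ E'] {H' : Type*} [TopologicalSpace H']
  {P : Type*} [TopologicalSpace P] [ChartedSpace H' P]

/-- The differential `df` of a vector-valued function. -/
def diff (J : ModelWithCorners ℝ E' H') {V : Type*} [NormedAddCommGroup V] [NormedSpace ℝ V]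
    (f : P → V) (p : P) (v : TangentSpace J p) : V := mfderiv J 𝓘(ℝ, V) f p v

/-- Smooth maps `(X, h) : P → G_r` into the (immersed, not necessarily closed) Lie subgroup `G_r`
of `D`: smooth maps to `D` with values in `G_r` and derivative tangent to `G_r`. The tangent
space of `G_r` is the left translate of `𝔤_r`; as
`X̄⁻¹ dX̄ = h⁻¹ dh + (Ad_h⁻¹ dX) ε`, this means `h⁻¹ dh = r (Ad_h⁻¹ dX)`. -/
structure IsSmoothDualMap (J : ModelWithCorners ℝ E' H') (r : 𝔤 →ₗ[ℂ] 𝔤) (f : P → Double 𝔤) :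
    Prop where
  smooth_vec : ContMDiff J 𝓘(ℝ, 𝔤) ∞ fun p => (f p).vec
  smooth_grp : ContMDiff J 𝓘(ℝ, 𝓐) ∞ fun p => (((f p).grp : 𝓐ˣ) : 𝓐)
  mem : ∀ p, f p ∈ dualGroup r
  tangent : ∀ p (v : TangentSpace J p),
    ((((f p).grp : 𝓐ˣ)⁻¹ : 𝓐ˣ) : 𝓐) *
        diff J (fun q => (((f q).grp : 𝓐ˣ) : 𝓐)) p v
      = (r (Ad (f p).grp⁻¹ (diff J (fun q => (f q).vec) p v)) : 𝔤)

end Manifold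

/-- The coordinate plane on which surfaces are modelled. -/
abbrev Plane := EuclideanSpace ℝ (Fin 2)

variable {H : Type*} [TopologicalSpace H] {I : ModelWithCorners ℝ Plane H}
  {M : Type*} [TopologicalSpace M] [ChartedSpace H M]

variable (I M) in
/-- An oriented (countable) atlas of the surface `M`: smooth charts which cover `M` and whose
coordinate changes preserve the orientation of the plane, together with a subordinate smooth
partition of unity, used to integrate. -/
structure OrientedAtlas where
  chart : ℕ → OpenPartialHomeomorph M H
  mem_maximalAtlas : ∀ n, chart n ∈ IsManifold.maximalAtlas I ∞ M
  cover : ∀ p, ∃ n, p ∈ (chart n).source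
  oriented : ∀ i j, ∀ p ∈ (chart i).source ∩ (chart j).source,
    0 < (fderivWithin ℝ ((chart j).extend I ∘ ((chart i).extend I).symm) (range I)
      ((chart i).extend I p)).det
  weight : SmoothPartitionOfUnity ℕ I M univ
  subordinate : weight.IsSubordinate fun n => (chart n).source

variable (I M) in
/-- Two-forms on `M`, complex valued, written as functions of two tangent vectors. -/
abbrev TwoForm := ∀ p : M, TangentSpace I p → TangentSpace I p → ℂ

variable (I M 𝔤) in
/-- One-forms on `M` with values in `𝔤` (smoothness is imposed separately). -/
abbrev OneForm := ∀ p : M, TangentSpace I p →L[ℝ] 𝔤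

namespace OrientedAtlas

variable (𝒜 : OrientedAtlas I M)

/-- The inverse of the derivative of the `n`-th chart, at the point with coordinates `y`. -/
def frame (n : ℕ) (y : Plane) :
    Plane →L[ℝ] TangentSpace I (((𝒜.chart n).extend I).symm y) :=
  mfderivWithin 𝓘(ℝ, Plane) I ((𝒜.chart n).extend I).symm (range I) y

/-- The function `f` with `η = f dx¹ ∧ dx²` in the `n`-th chart. -/
def density (n : ℕ) (η : TwoForm I M) (y : Plane) : ℂ :=
  η (((𝒜.chart n).extend I).symm y)
    (𝒜.frame n y (EuclideanSpace.single 0 1)) (𝒜.frame n y (EuclideanSpace.single 1 1))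

/-- The integral `∫_K η = ∑ₙ ∫_K ρₙ η` of a two-form over a subset `K` of the oriented surface
`M`, where `ρₙ` is the partition of unity and the `n`-th term is computed in the `n`-th chart. -/
def integral (K : Set M) (η : TwoForm I M) : ℂ :=
  ∑' n, ∫ y in ((𝒜.chart n).extend I).target ∩ ((𝒜.chart n).extend I).symm ⁻¹' K,
    (𝒜.weight n (((𝒜.chart n).extend I).symm y) : ℂ) * 𝒜.density n η y

/-- The coordinate expression of a one-form in the `n`-th chart. -/
def local1 (n : ℕ) (A : OneForm 𝔤 I M) (y : Plane) : Plane →L[ℝ] 𝔤 :=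
  (A (((𝒜.chart n).extend I).symm y)).comp (𝒜.frame n y)

/-- Smooth one-forms: those with smooth coefficients in the charts. -/
def IsSmooth (A : OneForm 𝔤 I M) : Prop :=
  ∀ n, ContDiffOn ℝ ∞ (𝒜.local1 n A) ((𝒜.chart n).extend I).target

/-- Smooth one-parameter families of one-forms. -/
def IsSmoothFamily (A : ℝ → OneForm 𝔤 I M) : Prop :=
  ∀ n, ContDiffOn ℝ ∞ (fun q : ℝ × Plane => 𝒜.local1 n (A q.1) q.2)
    (univ ×ˢ ((𝒜.chart n).extend I).target)

/-- The zero curvature equation `dA + [A, A] = 0`, where `[A, A](v, w) = [A(v), A(w)]`, written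
in the charts. -/
def IsFlat (A : OneForm 𝔤 I M) : Prop :=
  ∀ n, ∀ y ∈ ((𝒜.chart n).extend I).target, ∀ v w : Plane,
    fderivWithin ℝ (𝒜.local1 n A) ((𝒜.chart n).extend I).target y v w
      - fderivWithin ℝ (𝒜.local1 n A) ((𝒜.chart n).extend I).target y w v
      + ⁅𝒜.local1 n A y v, 𝒜.local1 n A y w⁆ = 0

end OrientedAtlas

/-- The two-form `tr (α ∧ β)` for `𝔤`-valued one-forms. -/
def wedge (tr : LinearMap.BilinForm ℂ 𝔤) (α β : ∀ p : M, TangentSpace I p → 𝔤) : TwoForm I M :=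
  fun p v w => tr (α p v) (β p w) - tr (α p w) (β p v)

/-! ### The actions -/

variable (tr : LinearMap.BilinForm ℂ 𝔤) (r : 𝔤 →ₗ[ℂ] 𝔤) (𝒜 : OrientedAtlas I M) (K : Set M)

/-- The right-invariant form of `G_r` pulled back by `(X, h)`: `Ad_h d(Ad_h⁻¹ X)`. -/
def rightForm (f : M → Double 𝔤) (p : M) (v : TangentSpace I p) : 𝔤 :=
  Ad (f p).grp (diff I (fun q => Ad (f q).grp⁻¹ (f q).vec) p v)

/-- The Lagrangian `tr (θ ∧ A) - ½ tr (A ∧ π^♯ A)` of the Poisson sigma model of a group, where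
`θ` is the pull-back of the right-invariant form by the field, `π` is the Poisson tensor at the
field contracted with right-invariant forms, and `π^♯` is defined by `tr ((π^♯ Y) Z) = π(Y, Z)`;
so `- ½ tr (A ∧ π^♯ A)(v, w) = ½ (π(A v, A w) - π(A w, A v))`. -/
def psmLagrangian (θ : ∀ p : M, TangentSpace I p → 𝔤) (π : M → 𝔤 → 𝔤 → ℂ) (A : OneForm 𝔤 I M) :
    TwoForm I M :=
  fun p v w => wedge tr θ (fun q u => A q u) p v w
    + (1 / 2) * (π p (A p v) (A p w) - π p (A p w) (A p v))

/-- The action `S*_PL(X̄, A)` over `K` of the Poisson sigma model with target `G_r`. -/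
def dualAction (f : M → Double 𝔤) (A : OneForm 𝔤 I M) : ℂ :=
  𝒜.integral K (psmLagrangian tr (rightForm f) (fun p => dualPoisson tr r (f p)) A)

/-- The expression `∫ tr (dX ∧ A + dX ∧ R [X, A] + ½ A ∧ [X, A] - ½ [X, A] ∧ R [X, A])` with
`R = Ad_h r Ad_h⁻¹`. -/
def explicitAction (f : M → Double 𝔤) (A : OneForm 𝔤 I M) : ℂ :=
  let dX : ∀ p : M, TangentSpace I p → 𝔤 := diff I fun q => (f q).vec
  let XA : ∀ p : M, TangentSpace I p → 𝔤 := fun p v => ⁅(f p).vec, A p v⁆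
  let RXA : ∀ p : M, TangentSpace I p → 𝔤 := fun p v => twist r (f p).grp (XA p v)
  let A' : ∀ p : M, TangentSpace I p → 𝔤 := fun p v => A p v
  𝒜.integral K fun p v w => wedge tr dX A' p v w + wedge tr dX RXA p v w
    + (1 / 2) * wedge tr A' XA p v w - (1 / 2) * wedge tr XA RXA p v w

/-- The action `S_BF(X, A) = ∫ tr (dX ∧ A - ½ [X, A] ∧ A)` of BF-theory over `K`. -/
def bfAction (X : M → 𝔤) (A : OneForm 𝔤 I M) : ℂ :=
  𝒜.integral K fun p v w => wedge tr (diff I X) (fun q u => A q u) p v w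
    - (1 / 2) * wedge tr (fun q u => ⁅X q, A q u⁆) (fun q u => A q u) p v w

/-- The left-hand side `dX + [A, X]` of the equation of motion of `X`. -/
def covariantDiff (X : M → 𝔤) (A : OneForm 𝔤 I M) (p : M) (v : TangentSpace I p) : 𝔤 :=
  diff I X p v + ⁅A p v, X p⁆

/-- The term `∫ tr ((dX + [A, X]) ∧ Ad_h r Ad_h⁻¹ (dX + [A, X]))`. -/
def quadraticTerm (f : M → Double 𝔤) (A : OneForm 𝔤 I M) : ℂ :=
  𝒜.integral K (wedge tr (covariantDiff (fun q => (f q).vec) A)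
    fun p v => twist r (f p).grp (covariantDiff (fun q => (f q).vec) A p v))

/-- The term `∫ tr (dX ∧ Ad_h r Ad_h⁻¹ dX)`, which depends on `X̄` alone. -/
def topologicalTerm (f : M → Double 𝔤) : ℂ :=
  𝒜.integral K (wedge tr (diff I fun q => (f q).vec)
    fun p v => twist r (f p).grp (diff I (fun q => (f q).vec) p v))

/-! ### Classical solutions -/

/-- The fields `(X̄, A)` are a classical solution of the Poisson sigma model with target `G_r`: the
action is stationary under all smooth variations of the fields that are supported in a compact
set in the interior of the surface. -/
def IsStationaryDual (f : M → Double 𝔤) (A : OneForm 𝔤 I M) : Prop :=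
  ∀ K : Set M, IsCompact K → K ⊆ I.interior M →
    ∀ (F : ℝ → M → Double 𝔤) (B : ℝ → OneForm 𝔤 I M),
      F 0 = f → B 0 = A →
      IsSmoothDualMap (𝓘(ℝ, ℝ).prod I) r (fun q : ℝ × M => F q.1 q.2) →
      𝒜.IsSmoothFamily B →
      (∀ t, ∀ p ∉ K, F t p = f p ∧ B t p = A p) →
      HasDerivAt (fun t => dualAction tr r 𝒜 K (F t) (B t)) 0 0

/-- The fields `(X, A)` are a classical solution of BF-theory, in the same sense. -/
def IsStationaryBF (X : M → 𝔤) (A : OneForm 𝔤 I M) : Prop :=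
  ∀ K : Set M, IsCompact K → K ⊆ I.interior M →
    ∀ (Y : ℝ → M → 𝔤) (B : ℝ → OneForm 𝔤 I M),
      Y 0 = X → B 0 = A →
      ContMDiff (𝓘(ℝ, ℝ).prod I) 𝓘(ℝ, 𝔤) ∞ (fun q : ℝ × M => Y q.1 q.2) →
      𝒜.IsSmoothFamily B →
      (∀ t, ∀ p ∉ K, Y t p = X p ∧ B t p = A p) →
      HasDerivAt (fun t => bfAction tr 𝒜 K (Y t) (B t)) 0 0

/-- The equations of motion `dX + [A, X] = 0` and `dA + [A, A] = 0`. -/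
def EquationsOfMotion (X : M → 𝔤) (A : OneForm 𝔤 I M) : Prop :=
  (∀ p (v : TangentSpace I p), covariantDiff X A p v = 0) ∧ 𝒜.IsFlat A

end DualTriangular

end

set_option linter.unusedSectionVars false

noncomputable section

namespace DualTriangular

variable {𝓐 : Type*} [NormedRing 𝓐] [NormedAlgebra ℂ 𝓐] [FiniteDimensional ℂ 𝓐]
  {𝔤 : LieSubalgebra ℂ 𝓐}

/-! ### Linear differential equations and the real-linear structure maps -/

/-! Write `R = Ad_h r Ad_h⁻¹`, `C = dX + [A, X]` and `F = dA + [A, A]`. Tangency to `G_r` says `dh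
h⁻¹ = R dX`, hence `θ = dX + [X, R dX]`. Since `R` is antisymmetric for the invariant form, `tr (α ∧
R β)` is symmetric in the one-forms `α`, `β`. Completing the square in `[X, A]` therefore writes the
Lagrangian as that of BF-theory, minus `½ tr (C ∧ R C)`, plus `½ tr (dX ∧ R dX)`
(`psmLagrangian_eq_bf`).

The last two-form is the pull-back of the left-invariant two-form that `r` defines on `G_r`; the
Yang–Baxter equation is its closedness (`IsDualOn.closed`). For a family of fields which is constant
outside a compact set, its `t`-derivative is the differential of its contraction with `∂ₜ`, and that
one-form vanishes outside the set. The theorem of Stokes (`integral_eq_zero_of_curl`) then makes the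
integral independent of `t`.

Where `C = 0`, the quadratic term does not contribute to first order, so the first variation is that
of BF-theory, with density `d tr (∂ₜX A) - tr (∂ₜX F) + tr (C ∧ ∂ₜA)` (`density_derivForm_bfForm`).
Hence the equations of motion imply stationarity.

Conversely, varying `A` alone gives `C + [X, R C] = 0`. The adjoint action of `G_r` preserves its
Lie algebra, the graph of `r`, and this amounts to `R C = r (C + [X, R C])` (`twist_eq_of_mem`); so
`R C = 0` and then `C = 0`. Next, `X̄` is varied by right translation with `exp (t b (r z + z ε))`,
which keeps it in `G_r` and gives `∂ₜX = b Ad_h z`, an arbitrary direction; hence `F = 0`. Both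
equations are obtained over the interior and extend to the boundary by continuity. BF-theory is the
case `r = 0`, so its equations of motion come from the same argument, and the equivalence follows.
-/

theorem linear_ode_eq_zero {V : Type*} [NormedAddCommGroup V] [NormedSpace ℝ V] (L : V →L[ℝ] V)
    (u : ℝ → V) (hu : ∀ t, HasDerivAt u (L (u t)) t) (h0 : u 0 = 0) (t : ℝ) : u t = 0 := by
  have := ODE_solution_unique_univ (v := fun _ => L) (s := fun _ => univ) (K := ‖L‖₊) (f := u)
    (g := fun _ => 0) (t₀ := 0) (fun _ => L.lipschitz.lipschitzOnWith)
    (fun t => ⟨hu t, trivial⟩) (fun t => ⟨by simpa using hasDerivAt_const t (0 : V), trivial⟩) h0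
  exact congrFun this t

variable (𝔤) in
/-- The inclusion of the Lie algebra in the ambient algebra. -/
def incl : 𝔤 →L[ℝ] 𝓐 :=
  LinearMap.toContinuousLinearMap (𝔤.toSubmodule.subtype.restrictScalars ℝ)

@[simp] theorem incl_apply (x : 𝔤) : incl 𝔤 x = (x : 𝓐) := rfl

/-- Inside `𝓐` the adjoint action is a plain product. A linear retraction onto `𝔤` carries
derivatives, continuity and smoothness computed there back to `𝔤`. -/
theorem exists_proj (𝔤 : LieSubalgebra ℂ 𝓐) : ∃ p : 𝓐 →L[ℝ] 𝔤, ∀ x : 𝔤, p x = x := by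
  obtain ⟨g, hg⟩ := LinearMap.exists_leftInverse_of_injective
    (𝔤.toSubmodule.subtype.restrictScalars ℝ)
    (LinearMap.ker_eq_bot.2 Subtype.val_injective)
  exact ⟨LinearMap.toContinuousLinearMap g, fun x => LinearMap.congr_fun hg x⟩

variable (𝔤) in
/-- A projection of the ambient algebra onto the Lie algebra. -/
def proj : 𝓐 →L[ℝ] 𝔤 := (exists_proj 𝔤).choose

@[simp] theorem proj_coe (x : 𝔤) : proj 𝔤 (x : 𝓐) = x := (exists_proj 𝔤).choose_spec x

variable (𝔤) in
/-- The bracket as a continuous bilinear map. -/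
def lieL : 𝔤 →L[ℝ] 𝔤 →L[ℝ] 𝔤 :=
  LinearMap.toContinuousBilinearMap (LinearMap.mk₂ ℝ (fun x y : 𝔤 => ⁅x, y⁆) add_lie
    (fun c x y => by
      rw [← algebraMap_smul ℂ c x, smul_lie, algebraMap_smul]) lie_add
    (fun c x y => by
      rw [← algebraMap_smul ℂ c y, lie_smul, algebraMap_smul]))

@[simp] theorem lieL_apply (x y : 𝔤) : lieL 𝔤 x y = ⁅x, y⁆ := rfl

/-- A complex bilinear form as a continuous real bilinear map. -/
def formL (tr : LinearMap.BilinForm ℂ 𝔤) : 𝔤 →L[ℝ] 𝔤 →L[ℝ] ℂ :=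
  LinearMap.toContinuousBilinearMap (LinearMap.mk₂ ℝ (fun x y : 𝔤 => tr x y)
    (fun x y z => by simp)
    (fun c x y => by rw [← algebraMap_smul ℂ c x, map_smul, LinearMap.smul_apply, algebraMap_smul])
    (fun x y z => by simp)
    (fun c x y => by rw [← algebraMap_smul ℂ c y, map_smul, algebraMap_smul]))

@[simp] theorem formL_apply (tr : LinearMap.BilinForm ℂ 𝔤) (x y : 𝔤) : formL tr x y = tr x y := rfl

/-- A complex linear endomorphism as a continuous real linear map. -/
def endL (r : 𝔤 →ₗ[ℂ] 𝔤) : 𝔤 →L[ℝ] 𝔤 := LinearMap.toContinuousLinearMap (r.restrictScalars ℝ)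

@[simp] theorem endL_apply (r : 𝔤 →ₗ[ℂ] 𝔤) (x : 𝔤) : endL r x = r x := rfl

theorem real_smul_lie (c : ℝ) (x y : 𝔤) : ⁅c • x, y⁆ = c • ⁅x, y⁆ :=
  congrArg (fun L : 𝔤 →L[ℝ] 𝔤 => L y) ((lieL 𝔤).map_smul c x)

theorem real_lie_smul (c : ℝ) (x y : 𝔤) : ⁅x, c • y⁆ = c • ⁅x, y⁆ :=
  (lieL 𝔤 x).map_smul c y

theorem map_real_smul (r : 𝔤 →ₗ[ℂ] 𝔤) (c : ℝ) (x : 𝔤) : r (c • x) = c • r x :=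
  (endL r).map_smul c x

/-! ### The adjoint action -/

theorem coe_Ad (g : linearGroup 𝔤) (x : 𝔤) :
    (Ad g x : 𝓐) = ((g : 𝓐ˣ) : 𝓐) * x * ((g : 𝓐ˣ)⁻¹ : 𝓐ˣ) := rfl

@[simp] theorem Ad_inv_Ad (g : linearGroup 𝔤) (x : 𝔤) : Ad g⁻¹ (Ad g x) = x := by
  rw [← Ad_mul, inv_mul_cancel, Ad_one]

@[simp] theorem Ad_Ad_inv (g : linearGroup 𝔤) (x : 𝔤) : Ad g (Ad g⁻¹ x) = x := by
  rw [← Ad_mul, mul_inv_cancel, Ad_one]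

theorem coe_lie (x y : 𝔤) : ((⁅x, y⁆ : 𝔤) : 𝓐) = x * y - y * x := by
  rw [LieSubalgebra.coe_bracket, LieRing.of_associative_ring_bracket]

theorem Ad_lie (g : linearGroup 𝔤) (x y : 𝔤) : Ad g ⁅x, y⁆ = ⁅Ad g x, Ad g y⁆ := by
  ext1
  have h (a b : 𝓐) : ((g : 𝓐ˣ) : 𝓐) * a * ((g : 𝓐ˣ)⁻¹ : 𝓐ˣ)
      * (((g : 𝓐ˣ) : 𝓐) * b * ((g : 𝓐ˣ)⁻¹ : 𝓐ˣ))
      = ((g : 𝓐ˣ) : 𝓐) * (a * b) * ((g : 𝓐ˣ)⁻¹ : 𝓐ˣ) := by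
    simp only [mul_assoc, Units.inv_mul_cancel_left]
  rw [coe_lie, coe_Ad, coe_Ad, coe_Ad, coe_lie, h, h, mul_sub, sub_mul]

theorem coe_expG (x : 𝔤) : (((expG x : linearGroup 𝔤) : 𝓐ˣ) : 𝓐) = NormedSpace.exp (x : 𝓐) := rfl

theorem coe_expG_inv (x : 𝔤) :
    ((((expG x : linearGroup 𝔤) : 𝓐ˣ)⁻¹ : 𝓐ˣ) : 𝓐) = NormedSpace.exp (-(x : 𝓐)) := rfl

theorem coe_real_smul (t : ℝ) (x : 𝔤) : ((t • x : 𝔤) : 𝓐) = t • (x : 𝓐) := rfl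

theorem hasDerivAt_Ad_expG (y x : 𝔤) (t : ℝ) :
    HasDerivAt (fun s : ℝ => Ad (expG (s • y)) x) ⁅y, Ad (expG (t • y)) x⁆ t := by
  have := FiniteDimensional.complete ℂ 𝓐
  -- The factor `y` stands on the left in this derivative and on the right in the next one, so the
  -- product rule yields the commutator without moving `y` past the exponentials.
  have h1 := hasDerivAt_exp_smul_const' (𝕂 := ℝ) (y : 𝓐) t
  have h2 := hasDerivAt_exp_smul_const (𝕂 := ℝ) (-(y : 𝓐)) t
  have h3 := (proj 𝔤).hasFDerivAt.comp_hasDerivAt t ((h1.mul_const (x : 𝓐)).mul h2)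
  have e : ∀ s : ℝ, Ad (expG (s • y)) x = proj 𝔤 (NormedSpace.exp (s • (y : 𝓐)) * (x : 𝓐)
      * NormedSpace.exp (s • (-(y : 𝓐)))) := fun s => by
    rw [← proj_coe (Ad (expG (s • y)) x), coe_Ad, coe_expG, coe_expG_inv, coe_real_smul, smul_neg]
  refine (h3.congr_deriv ?_).congr_of_eventuallyEq (Filter.Eventually.of_forall e)
  rw [← proj_coe ⁅y, Ad (expG (t • y)) x⁆, coe_lie, coe_Ad, coe_expG, coe_expG_inv, coe_real_smul,
    smul_neg]
  congr 1
  simp only [mul_neg, mul_assoc, sub_eq_add_neg]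

theorem expG_zero : expG (0 : 𝔤) = 1 := by
  ext1; ext1
  simp [coe_expG]

/-- Infinitesimal invariance integrates: along `exp (s z)` the two bracket terms of the derivative
cancel. Exponentials generate the group, and the property passes to products and inverses. -/
theorem form_Ad {tr : LinearMap.BilinForm ℂ 𝔤} (htr_inv : ∀ x y z : 𝔤, tr ⁅x, y⁆ z = tr x ⁅y, z⁆)
    (g : linearGroup 𝔤) : ∀ x y, tr (Ad g x) (Ad g y) = tr x y := by
  obtain ⟨g, hg⟩ := g
  refine Subgroup.closure_induction (p := fun (g : 𝓐ˣ) hg => ∀ x y : 𝔤,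
    tr (Ad (⟨g, hg⟩ : linearGroup 𝔤) x) (Ad (⟨g, hg⟩ : linearGroup 𝔤) y) = tr x y) ?_ ?_ ?_ ?_ hg
  · rintro _ ⟨z, rfl⟩ x y
    have hd (t : ℝ) : HasDerivAt
        (fun s : ℝ => formL tr (Ad (expG (s • z)) x) (Ad (expG (s • z)) y)) 0 t := by
      have := (formL tr).hasDerivAt_of_bilinear (fun _ => hasDerivAt_Ad_expG z x t)
        (fun _ => hasDerivAt_Ad_expG z y t)
      refine this.congr_deriv ?_
      simp only [formL_apply]
      rw [← lie_skew z (Ad _ x), map_neg, LinearMap.neg_apply, htr_inv]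
      simp
    have := is_const_of_deriv_eq_zero (fun t => (hd t).differentiableAt) (fun t => (hd t).deriv) 1 0
    simp only [formL_apply, one_smul, zero_smul, expG_zero, Ad_one] at this
    exact this
  · intro x y
    have e : (⟨1, Subgroup.one_mem _⟩ : linearGroup 𝔤) = 1 := rfl
    rw [e, Ad_one, Ad_one]
  · intro a b ha hb h1 h2 x y
    have e : (⟨a * b, Subgroup.mul_mem _ ha hb⟩ : linearGroup 𝔤) = ⟨a, ha⟩ * ⟨b, hb⟩ := rfl
    rw [e, Ad_mul, Ad_mul, h1, h2]
  · intro a ha h x y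
    have e : (⟨a⁻¹, Subgroup.inv_mem _ ha⟩ : linearGroup 𝔤) = ⟨a, ha⟩⁻¹ := rfl
    rw [e, ← h, Ad_Ad_inv, Ad_Ad_inv]

/-! ### The conjugated operator `Ad_h r Ad_h⁻¹`. -/

section Twist

variable {tr : LinearMap.BilinForm ℂ 𝔤} {r : 𝔤 →ₗ[ℂ] 𝔤}

theorem twist_apply (g : linearGroup 𝔤) (x : 𝔤) : twist r g x = Ad g (r (Ad g⁻¹ x)) := rfl

theorem form_twist (htr_inv : ∀ x y z : 𝔤, tr ⁅x, y⁆ z = tr x ⁅y, z⁆)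
    (hr : IsTriangularRMatrix tr r) (g : linearGroup 𝔤) (x y : 𝔤) :
    tr (twist r g x) y = -tr x (twist r g y) := by
  rw [twist_apply, twist_apply, ← form_Ad htr_inv g⁻¹, Ad_inv_Ad, hr.antisymm,
    ← form_Ad htr_inv g⁻¹ x, Ad_inv_Ad]

end Twist

/-! ### The dual group -/

/-- The one-parameter subgroup of `G_r` generated by `r x + x ε`. -/
def dualExp (r : 𝔤 →ₗ[ℂ] 𝔤) (x : 𝔤) (t : ℝ) : Double 𝔤 :=
  ⟨∫ s in (0 : ℝ)..t, Ad (expG (s • r x)) x, expG (t • r x)⟩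

section DualGroup

variable {r : 𝔤 →ₗ[ℂ] 𝔤}

theorem dualExp_zero (x : 𝔤) : dualExp r x 0 = 1 := by
  ext1
  · simp [dualExp]; rfl
  · simp [dualExp, expG_zero]; rfl

/-- The substitution `s ↦ t s` identifies the point at time `t` with the generator of `G_r` attached
to `t • x`. -/
theorem dualExp_mem (x : 𝔤) (t : ℝ) : dualExp r x t ∈ dualGroup r := by
  refine Subgroup.subset_closure ⟨t • x, ?_⟩
  simp only [dualExp]
  ext1
  · have h := intervalIntegral.smul_integral_comp_mul_left (a := (0 : ℝ)) (b := 1)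
      (fun s => Ad (expG (s • r x)) x) t
    simp only [mul_zero, mul_one] at h
    rw [← h, ← intervalIntegral.integral_smul]
    refine intervalIntegral.integral_congr fun s _ => ?_
    simp only [map_real_smul, smul_smul, mul_comm]
  · simp only [map_real_smul]

theorem continuous_Ad_expG (y x : 𝔤) : Continuous fun s : ℝ => Ad (expG (s • y)) x :=
  continuous_iff_continuousAt.2 fun t => (hasDerivAt_Ad_expG y x t).continuousAt

theorem hasDerivAt_dualExp_vec (x : 𝔤) (t : ℝ) :
    HasDerivAt (fun s => (dualExp r x s).vec) (Ad (expG (t • r x)) x) t :=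
  intervalIntegral.integral_hasDerivAt_right
    ((continuous_Ad_expG (r x) x).intervalIntegrable _ _)
    ((continuous_Ad_expG (r x) x).stronglyMeasurableAtFilter _ _)
    (continuous_Ad_expG (r x) x).continuousAt

/-- Both sides have the derivative `[r x, Ad x]` and agree at `t = 0`. This eliminates `Ad x` from
the differential equation in `Ad_map_of_mem`. -/
theorem Ad_expG_eq (x : 𝔤) (t : ℝ) :
    Ad (expG (t • r x)) x = x + ⁅r x, (dualExp r x t).vec⁆ := by
  have hd (t : ℝ) : HasDerivAt (fun s => Ad (expG (s • r x)) x - (x + lieL 𝔤 (r x)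
      (dualExp r x s).vec)) 0 t := by
    have h1 := (lieL 𝔤 (r x)).hasFDerivAt.comp_hasDerivAt t (hasDerivAt_dualExp_vec (r := r) x t)
    have h2 := (hasDerivAt_Ad_expG (r x) x t).sub (h1.const_add x)
    refine h2.congr_deriv ?_
    simp
  have := is_const_of_deriv_eq_zero (fun t => (hd t).differentiableAt) (fun t => (hd t).deriv) t 0
  rw [← sub_eq_zero, ← lieL_apply, this]
  have h0 : (dualExp r x 0).vec = 0 := by rw [dualExp_zero]; rfl
  simp [h0, expG_zero, Ad_one]

/-- The Lie algebra of `G_r`, the graph of `r`, is preserved by the adjoint action of `G_r`. -/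
theorem Ad_map_of_mem {tr : LinearMap.BilinForm ℂ 𝔤} (hr : IsTriangularRMatrix tr r) {a : Double 𝔤}
    (ha : a ∈ dualGroup r) (y : 𝔤) :
    Ad a.grp (r y) = r (Ad a.grp y + ⁅a.vec, Ad a.grp (r y)⁆) := by
  refine Subgroup.closure_induction (p := fun (a : Double 𝔤) _ => ∀ y,
    Ad a.grp (r y) = r (Ad a.grp y + ⁅a.vec, Ad a.grp (r y)⁆)) ?_ ?_ ?_ ?_ ha y
  · rintro _ ⟨x, rfl⟩ y
    -- `u` is the defect of the identity along the one-parameter subgroup. It vanishes at `0` and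
    -- solves a linear equation `u' = (ad (r x) - r ∘ ad x) u`, so it vanishes at time `1`, where
    -- the generator sits.
    let u : ℝ → 𝔤 := fun t => Ad (expG (t • r x)) (r y) - endL r (Ad (expG (t • r x)) y
      + lieL 𝔤 (dualExp r x t).vec (Ad (expG (t • r x)) (r y)))
    have hu (t : ℝ) : HasDerivAt u
        ((lieL 𝔤 (r x) - (endL r).comp (lieL 𝔤 x)) (u t)) t := by
      have h1 := hasDerivAt_Ad_expG (r x) (r y) t
      have h2 := hasDerivAt_Ad_expG (r x) y t
      have h3 := (lieL 𝔤).hasDerivAt_of_bilinear (fun _ => hasDerivAt_dualExp_vec (r := r) x t)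
        fun _ => h1
      have h4 := h1.sub ((endL r).hasFDerivAt.comp_hasDerivAt t (h2.add h3))
      refine h4.congr_deriv ?_
      simp only [lieL_apply, endL_apply, sub_apply,
        ContinuousLinearMap.comp_apply, u, Ad_expG_eq]
      generalize (dualExp r x t).vec = X
      generalize Ad (expG (t • r x)) (r y) = W
      generalize Ad (expG (t • r x)) y = V
      -- With `u = W - r Q` and `Q = V + [X, W]`, the Yang–Baxter equation for `x` and `Q` is
      -- exactly what makes the derivative of `u` a linear function of `u`.
      have yb := hr.yangBaxter x (V + ⁅X, W⁆)
      rw [sub_eq_zero] at yb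
      have e : ⁅r x, V⁆ + (⁅X, ⁅r x, W⁆⁆ + ⁅x + ⁅r x, X⁆, W⁆) = ⁅r x, V + ⁅X, W⁆⁆ + ⁅x, W⁆ := by
        rw [add_lie, lie_add, leibniz_lie (r x) X W]; abel
      rw [e, map_add, lie_sub, lie_sub, map_sub, ← yb]
      abel
    have h0 : u 0 = 0 := by
      have h0 : (dualExp r x 0).vec = 0 := by rw [dualExp_zero]; rfl
      simp [u, expG_zero, Ad_one, h0]
    have := linear_ode_eq_zero _ u hu h0 1
    simp only [u, sub_eq_zero, one_smul] at this
    exact this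
  · intro y
    have e1 : (1 : Double 𝔤).grp = 1 := rfl
    have e2 : (1 : Double 𝔤).vec = 0 := rfl
    simp [e1, e2, Ad_one]
  · intro a b _ _ h1 h2 y
    simp only [Double.mul_def]
    have e := h1 (Ad b.grp y + ⁅b.vec, Ad b.grp (r y)⁆)
    rw [← h2] at e
    rw [Ad_mul, Ad_mul]
    refine e.trans (congrArg r ?_)
    rw [map_add, Ad_lie, add_lie]
    abel
  · intro a _ h y
    -- The hypothesis on `a` reads `Ad ∘ r = r ∘ T`. For the inverse one must solve `T z = y`: `T y
    -- = 0` gives `Ad (r y) = 0`, hence `Ad y = 0`, so `T` is injective and, in finite dimension,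
    -- surjective.
    let T : 𝔤 →ₗ[ℂ] 𝔤 := Ad a.grp + (LieAlgebra.ad ℂ 𝔤 a.vec) ∘ₗ (Ad a.grp) ∘ₗ r
    have hT (y : 𝔤) : T y = Ad a.grp y + ⁅a.vec, Ad a.grp (r y)⁆ := rfl
    have hinj : Function.Injective T := by
      refine (injective_iff_map_eq_zero T).2 fun y hy => ?_
      have h1 := h y
      rw [← hT, hy, map_zero] at h1
      rw [hT, h1, lie_zero, add_zero] at hy
      simpa using congrArg (Ad a.grp⁻¹) hy
    obtain ⟨z, rfl⟩ := (LinearMap.injective_iff_surjective.1 hinj) y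
    have h1 := h z
    rw [← hT] at h1
    simp only [Double.inv_def]
    rw [← h1, Ad_inv_Ad]
    refine congrArg r ?_
    rw [hT, map_add, Ad_inv_Ad, Ad_lie, Ad_inv_Ad, neg_lie]
    abel

theorem twist_eq_of_mem {tr : LinearMap.BilinForm ℂ 𝔤} (hr : IsTriangularRMatrix tr r)
    {a : Double 𝔤} (ha : a ∈ dualGroup r) (z : 𝔤) :
    twist r a.grp z = r (z + ⁅a.vec, twist r a.grp z⁆) := by
  have := Ad_map_of_mem hr ha (Ad a.grp⁻¹ z)
  rwa [Ad_Ad_inv] at this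

/-- The twisted operator at `z` is `r` applied to the vanishing vector, so it is zero and the
hypothesis collapses to `z = 0`. This recovers `dX + [A, X] = 0` from the equation obtained by
varying `A`. -/
theorem eq_zero_of_add_lie_twist {tr : LinearMap.BilinForm ℂ 𝔤} (hr : IsTriangularRMatrix tr r)
    {a : Double 𝔤} (ha : a ∈ dualGroup r) {z : 𝔤} (hz : z + ⁅a.vec, twist r a.grp z⁆ = 0) :
    z = 0 := by
  have h := twist_eq_of_mem hr ha z
  rw [hz, map_zero] at h
  simpa [h] using hz

theorem dualGroup_zero : (dualGroup (0 : 𝔤 →ₗ[ℂ] 𝔤) : Set (Double 𝔤)) = {a | a.grp = 1} := by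
  ext a
  constructor
  · intro ha
    refine Subgroup.closure_induction (p := fun (a : Double 𝔤) _ => a.grp = 1) ?_ rfl ?_ ?_ ha
    · rintro _ ⟨x, rfl⟩
      exact expG_zero
    · intro a b _ _ h1 h2
      simp [Double.mul_def, h1, h2]
    · intro a _ h
      simp [Double.inv_def, h]
  · intro ha
    refine Subgroup.subset_closure ⟨a.vec, ?_⟩
    ext1
    · simp [expG_zero, Ad_one]
    · simpa [expG_zero] using ha.symm

end DualGroup

variable {H : Type*} [TopologicalSpace H] {I : ModelWithCorners ℝ Plane H}
  {M : Type*} [TopologicalSpace M] [ChartedSpace H M]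

/-! ### Charts -/

/-- Whether a point is mapped to the interior of the target does not depend on the chart. -/
theorem extend_mem_interior_target_trans {e₀ e : OpenPartialHomeomorph M H}
    (he₀ : e₀ ∈ IsManifold.maximalAtlas I ∞ M) (he : e ∈ IsManifold.maximalAtlas I ∞ M) {p : M}
    (hp₀ : p ∈ e₀.source) (hp : p ∈ e.source)
    (hx : e₀.extend I p ∈ interior (e₀.extend I).target) :
    e.extend I p ∈ interior (e.extend I).target := by
  let φ := I.extendCoordChange e₀ e
  have hφ : ContDiffOn ℝ ∞ φ φ.source := I.contDiffOn_extendCoordChange he₀ he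
  have hmem : e₀.extend I p ∈ φ.source := by simp [φ, hp, hp₀]
  have hs : φ.source ∈ nhds (e₀.extend I p) := by
    simp_rw [φ, ModelWithCorners.extendCoordChange, PartialEquiv.trans_source,
      PartialEquiv.symm_source, Filter.inter_mem_iff, mem_interior_iff_mem_nhds.1 hx, true_and,
      e.extend_source]
    exact e₀.extend_preimage_mem_nhds hp₀ <| e.open_source.mem_nhds hp
  have hsurj : Function.Surjective (fderiv ℝ φ (e₀.extend I p)) := by
    rw [← fderivWithin_of_mem_nhds hs]
    exact (I.isInvertible_fderivWithin_extendCoordChange (by simp) he₀ he hmem).surjective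
  have hd := (hφ.differentiableOn (by simp)).differentiableAt hs
  refine e.mem_interior_extend_target (by simp [hp]) ?_
  -- `range I` is convex: if the image point lay on its boundary, a supporting half-space would be
  -- respected by the coordinate change near an interior point, contradicting surjectivity of the
  -- derivative.
  have := hd.mem_interior_convex_of_surjective_fderiv hs I.convex_range I.isClosed_range
    I.nonempty_interior (φ.mapsTo.mono_right <| by simp [φ, inter_assoc]) hsurj
  simpa [φ, hp₀] using this

theorem extend_mem_interior_target [IsManifold I ∞ M] {e : OpenPartialHomeomorph M H}
    (he : e ∈ IsManifold.maximalAtlas I ∞ M) {p : M} (hp : p ∈ e.source) :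
    e.extend I p ∈ interior (e.extend I).target ↔ p ∈ I.interior M := by
  have h₀ : chartAt H p ∈ IsManifold.maximalAtlas I ∞ M := IsManifold.chart_mem_maximalAtlas p
  rw [show p ∈ I.interior M ↔ _ from ModelWithCorners.isInteriorPoint_iff]
  exact ⟨extend_mem_interior_target_trans he h₀ hp (mem_chart_source H p),
    extend_mem_interior_target_trans h₀ he (mem_chart_source H p) hp⟩

namespace OrientedAtlas

variable (𝒜 : OrientedAtlas I M)

/-- The `n`-th chart, with values in the plane. -/
abbrev coord (n : ℕ) : PartialEquiv M Plane := (𝒜.chart n).extend I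

/-- The part of a set in the domain of a chart, in coordinates. -/
def region (n : ℕ) (K : Set M) : Set Plane := (𝒜.coord n).target ∩ (𝒜.coord n).symm ⁻¹' K

theorem coord_symm_mem {n : ℕ} {y : Plane} (hy : y ∈ (𝒜.coord n).target) :
    (𝒜.coord n).symm y ∈ (𝒜.chart n).source := by
  have := (𝒜.coord n).map_target hy
  rwa [OpenPartialHomeomorph.extend_source] at this

theorem coord_mem {n : ℕ} {p : M} (hp : p ∈ (𝒜.chart n).source) :
    𝒜.coord n p ∈ (𝒜.coord n).target :=
  (𝒜.coord n).map_source (by rwa [OpenPartialHomeomorph.extend_source])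

theorem coord_left_inv {n : ℕ} {p : M} (hp : p ∈ (𝒜.chart n).source) :
    (𝒜.coord n).symm (𝒜.coord n p) = p := (𝒜.chart n).extend_left_inv hp

theorem exists_coord (p : M) : ∃ n, ∃ y ∈ (𝒜.coord n).target, (𝒜.coord n).symm y = p := by
  obtain ⟨n, hn⟩ := 𝒜.cover p
  exact ⟨n, _, 𝒜.coord_mem hn, 𝒜.coord_left_inv hn⟩

theorem target_eq (n : ℕ) :
    (𝒜.coord n).target = I.symm ⁻¹' (𝒜.chart n).target ∩ range I :=
  (𝒜.chart n).extend_target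

theorem measurableSet_target (n : ℕ) : MeasurableSet (𝒜.coord n).target := by
  rw [target_eq]
  exact ((𝒜.chart n).open_target.preimage I.continuous_symm).measurableSet.inter
    I.isClosed_range.measurableSet

theorem continuousOn_coord_symm (n : ℕ) :
    ContinuousOn (𝒜.coord n).symm (𝒜.coord n).target := (𝒜.chart n).continuousOn_extend_symm

theorem continuousOn_coord (n : ℕ) : ContinuousOn (𝒜.coord n) (𝒜.chart n).source := by
  simpa using (𝒜.chart n).continuousOn_extend (I := I)

theorem measurableSet_region (n : ℕ) {K : Set M} (hK : IsClosed K) :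
    MeasurableSet (𝒜.region n K) := by
  obtain ⟨C, hC, h⟩ := continuousOn_iff_isClosed.1 (𝒜.continuousOn_coord_symm n) K hK
  rw [region, inter_comm, h]
  exact hC.measurableSet.inter (𝒜.measurableSet_target n)

theorem uniqueDiffOn_target (n : ℕ) : UniqueDiffOn ℝ (𝒜.coord n).target := by
  rw [target_eq]
  exact I.uniqueDiffOn_preimage (𝒜.chart n).open_target

theorem target_mem_nhdsWithin (n : ℕ) {y : Plane} (hy : y ∈ (𝒜.coord n).target) :
    (𝒜.coord n).target ∈ nhdsWithin y (range I) := by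
  rw [target_eq] at hy ⊢
  rw [inter_comm]
  exact inter_mem_nhdsWithin _
    (((𝒜.chart n).open_target.preimage I.continuous_symm).mem_nhds hy.1)

/-- Lets equations proved at interior points of a chart extend by continuity to points of the
boundary. -/
theorem target_subset_closure_interior (n : ℕ) :
    (𝒜.coord n).target ⊆ closure (interior (𝒜.coord n).target) := by
  intro y hy
  rw [target_eq] at hy ⊢
  have ho := (𝒜.chart n).open_target.preimage I.continuous_symm
  rw [interior_inter, ho.interior_eq]
  exact ho.inter_closure ⟨hy.1, I.range_subset_closure_interior hy.2⟩

theorem contMDiffOn_coord_symm (n : ℕ) :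
    ContMDiffOn 𝓘(ℝ, Plane) I ∞ (𝒜.coord n).symm (𝒜.coord n).target := by
  have := contMDiffOn_extend_symm (𝒜.mem_maximalAtlas n)
  rwa [← OpenPartialHomeomorph.extend_target'] at this

theorem contMDiffAt_coord [IsManifold I ∞ M] (n : ℕ) {p : M} (hp : p ∈ (𝒜.chart n).source) :
    ContMDiffAt I 𝓘(ℝ, Plane) ∞ (𝒜.coord n) p :=
  (𝒜.chart n).contMDiffAt_extend (𝒜.mem_maximalAtlas n) hp

theorem hasMFDerivWithinAt_coord_symm (n : ℕ) {y : Plane} (hy : y ∈ (𝒜.coord n).target) :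
    HasMFDerivWithinAt 𝓘(ℝ, Plane) I (𝒜.coord n).symm (range I) y (𝒜.frame n y) := by
  refine MDifferentiableWithinAt.hasMFDerivWithinAt ?_
  exact ((𝒜.contMDiffOn_coord_symm n y hy).mdifferentiableWithinAt (by simp)).mono_of_mem_nhdsWithin
    (𝒜.target_mem_nhdsWithin n hy)

theorem target_subset_range (n : ℕ) : (𝒜.coord n).target ⊆ range I := by
  rw [target_eq]; exact inter_subset_right

/-- Chain rule: the derivative of a function read in a chart. -/
theorem hasFDerivWithinAt_comp_coord_symm {V : Type*} [NormedAddCommGroup V] [NormedSpace ℝ V]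
    {f : M → V} (n : ℕ) {y : Plane} (hy : y ∈ (𝒜.coord n).target)
    (hf : MDifferentiableAt I 𝓘(ℝ, V) f ((𝒜.coord n).symm y)) :
    HasFDerivWithinAt (f ∘ (𝒜.coord n).symm)
      ((mfderiv I 𝓘(ℝ, V) f ((𝒜.coord n).symm y)).comp (𝒜.frame n y)) (𝒜.coord n).target y := by
  have := hf.hasMFDerivAt.comp_hasMFDerivWithinAt y
    ((𝒜.hasMFDerivWithinAt_coord_symm n hy).mono (𝒜.target_subset_range n))
  exact this.hasFDerivWithinAt

theorem diff_frame {V : Type*} [NormedAddCommGroup V] [NormedSpace ℝ V]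
    {f : M → V} (n : ℕ) {y : Plane} (hy : y ∈ (𝒜.coord n).target)
    (hf : MDifferentiableAt I 𝓘(ℝ, V) f ((𝒜.coord n).symm y)) (v : Plane) :
    diff I f ((𝒜.coord n).symm y) (𝒜.frame n y v)
      = fderivWithin ℝ (f ∘ (𝒜.coord n).symm) (𝒜.coord n).target y v := by
  have key : ∀ L : Plane →L[ℝ] V, HasFDerivWithinAt (f ∘ (𝒜.coord n).symm) L (𝒜.coord n).target y →
      L v = fderivWithin ℝ (f ∘ (𝒜.coord n).symm) (𝒜.coord n).target y v := fun L hL => by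
    rw [hL.fderivWithin (𝒜.uniqueDiffOn_target n y hy)]
  exact key _ (𝒜.hasFDerivWithinAt_comp_coord_symm n hy hf)

/-- The derivative of the chart is a right inverse of the frame, by the chain rule for the chart
followed by its inverse. -/
theorem frame_surjective [IsManifold I ∞ M] (n : ℕ) {y : Plane} (hy : y ∈ (𝒜.coord n).target) :
    Function.Surjective (𝒜.frame n y) := by
  have hp := 𝒜.coord_symm_mem hy
  have h1 := ((𝒜.contMDiffAt_coord n hp).mdifferentiableAt (by simp)).hasMFDerivAt
  have h2 := 𝒜.hasMFDerivWithinAt_coord_symm n hy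
  have hy' : 𝒜.coord n ((𝒜.coord n).symm y) = y := (𝒜.coord n).right_inv hy
  rw [← hy'] at h2
  have h3 := hasMFDerivWithinAt_univ.1 (h2.comp _ (hasMFDerivWithinAt_univ.2 h1) fun p _ => by simp)
  have h4 : HasMFDerivAt I I id ((𝒜.coord n).symm y)
      (ContinuousLinearMap.id ℝ (TangentSpace I ((𝒜.coord n).symm y))) := hasMFDerivAt_id _
  have h5 := h4.congr_of_eventuallyEq (f₁ := (𝒜.coord n).symm ∘ 𝒜.coord n) (by
    filter_upwards [(𝒜.chart n).open_source.mem_nhds hp] with q hq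
    exact 𝒜.coord_left_inv hq)
  have h6 := hasMFDerivAt_unique h3 h5
  intro v
  refine ⟨mfderiv I 𝓘(ℝ, Plane) (𝒜.coord n) ((𝒜.coord n).symm y) v, ?_⟩
  have h7 := DFunLike.congr_fun h6 v
  have h8 : ∀ z : Plane, z = y → ∀ w : Plane, (𝒜.frame n z w : Plane) = 𝒜.frame n y w := by
    rintro z rfl w; rfl
  exact (h8 _ hy' _).symm.trans h7

/-- The coordinate change between two charts. -/
def trans (i j : ℕ) : Plane → Plane := 𝒜.coord j ∘ (𝒜.coord i).symm

theorem hasFDerivWithinAt_trans [IsManifold I ∞ M] (i j : ℕ) {y : Plane}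
    (hy : y ∈ (𝒜.coord i).target) (hj : (𝒜.coord i).symm y ∈ (𝒜.chart j).source) :
    HasFDerivWithinAt (𝒜.trans i j) (fderivWithin ℝ (𝒜.trans i j) (range I) y) (range I) y := by
  have h1 := ((𝒜.contMDiffAt_coord j hj).mdifferentiableAt (by simp)).hasMFDerivAt
  have := (h1.comp_hasMFDerivWithinAt y (𝒜.hasMFDerivWithinAt_coord_symm i hy)).hasFDerivWithinAt
  exact this.differentiableWithinAt.hasFDerivWithinAt

theorem trans_mem (i j : ℕ) {y : Plane} (hj : (𝒜.coord i).symm y ∈ (𝒜.chart j).source) :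
    𝒜.trans i j y ∈ (𝒜.coord j).target := 𝒜.coord_mem hj

theorem coord_symm_trans (i j : ℕ) {y : Plane} (hj : (𝒜.coord i).symm y ∈ (𝒜.chart j).source) :
    (𝒜.coord j).symm (𝒜.trans i j y) = (𝒜.coord i).symm y := 𝒜.coord_left_inv hj

theorem trans_det_pos (i j : ℕ) {y : Plane}
    (hy : y ∈ (𝒜.coord i).target) (hj : (𝒜.coord i).symm y ∈ (𝒜.chart j).source) :
    0 < (fderivWithin ℝ (𝒜.trans i j) (range I) y).det := by
  have := 𝒜.oriented i j ((𝒜.coord i).symm y) ⟨𝒜.coord_symm_mem hy, hj⟩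
  rwa [(𝒜.coord i).right_inv hy] at this

theorem frame_trans [IsManifold I ∞ M] (i j : ℕ) {y : Plane}
    (hy : y ∈ (𝒜.coord i).target) (hj : (𝒜.coord i).symm y ∈ (𝒜.chart j).source) (v : Plane) :
    (𝒜.frame i y v : Plane)
      = 𝒜.frame j (𝒜.trans i j y) (fderivWithin ℝ (𝒜.trans i j) (range I) y v) := by
  have h1 := (𝒜.hasFDerivWithinAt_trans i j hy hj).hasMFDerivWithinAt
  have h2 := 𝒜.hasMFDerivWithinAt_coord_symm j (𝒜.trans_mem i j hj)
  have h3 := h2.comp y h1 fun z _ => by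
    simp [trans]
  have hev : (𝒜.coord i).symm =ᶠ[nhdsWithin y (range I)] (𝒜.coord j).symm ∘ 𝒜.trans i j := by
    have hc : ContinuousWithinAt (𝒜.coord i).symm (range I) y :=
      (𝒜.hasMFDerivWithinAt_coord_symm i hy).continuousWithinAt
    filter_upwards [hc ((𝒜.chart j).open_source.mem_nhds hj)] with z hz
    exact (𝒜.coord_symm_trans i j hz).symm
  have h4 := 𝒜.hasMFDerivWithinAt_coord_symm i hy
  have hu : UniqueMDiffWithinAt 𝓘(ℝ, Plane) (range I) y :=
    (I.uniqueDiffOn y (𝒜.target_subset_range i hy)).uniqueMDiffWithinAt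
  have h5 := h3.congr_of_eventuallyEq hev (𝒜.coord_symm_trans i j hj).symm
  exact DFunLike.congr_fun (hu.eq h4 h5) v

end OrientedAtlas

/-! ### Two-forms and their integrals -/

/-- The alternating two-forms, characterised by their behaviour under linear substitutions. -/
def IsAlternating (η : TwoForm I M) : Prop :=
  ∀ (p : M) (v w : TangentSpace I p) (a b c d : ℝ),
    η p (a • v + b • w) (c • v + d • w) = ((a * d - b * c : ℝ) : ℂ) * η p v w

/-- The first coordinate vector. -/
abbrev e₁ : Plane := EuclideanSpace.single 0 1
/-- The second coordinate vector. -/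
abbrev e₂ : Plane := EuclideanSpace.single 1 1

theorem plane_eq (v : Plane) : v = v 0 • e₁ + v 1 • e₂ := by
  ext i; fin_cases i <;> simp

theorem plane_det (L : Plane →L[ℝ] Plane) : L.det = L e₁ 0 * L e₂ 1 - L e₁ 1 * L e₂ 0 := by
  have h := LinearMap.det_toMatrix (EuclideanSpace.basisFun (Fin 2) ℝ).toBasis (L : Plane →ₗ[ℝ] Plane)
  rw [ContinuousLinearMap.det, ← h, Matrix.det_fin_two]
  simp [LinearMap.toMatrix_apply]
  ring

namespace OrientedAtlas

variable (𝒜 : OrientedAtlas I M)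

/-- The frames of the two charts differ by the Jacobian of the coordinate change; on an alternating
form this substitution contributes its determinant. -/
theorem density_trans [IsManifold I ∞ M] {η : TwoForm I M} (hη : IsAlternating η) (i j : ℕ)
    {y : Plane} (hy : y ∈ (𝒜.coord i).target)
    (hj : (𝒜.coord i).symm y ∈ (𝒜.chart j).source) :
    𝒜.density i η y = ((fderivWithin ℝ (𝒜.trans i j) (range I) y).det : ℂ)
      * 𝒜.density j η (𝒜.trans i j y) := by
  have h1 := 𝒜.frame_trans i j hy hj e₁
  have h2 := 𝒜.frame_trans i j hy hj e₂
  set L := fderivWithin ℝ (𝒜.trans i j) (range I) y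
  have key : ∀ (p q : M), p = q → ∀ (v w v' w' : Plane), v = v' → w = w' →
      η p v w = η q v' w' := by
    rintro p _ rfl v w _ _ rfl rfl; rfl
  refine (key _ _ (𝒜.coord_symm_trans i j hj).symm _ _ _ _ h1 h2).trans ?_
  rw [plane_det, plane_eq (L e₁), plane_eq (L e₂), map_add, map_add, map_smul, map_smul, map_smul,
    map_smul]
  refine (hη _ _ _ _ _ _ _).trans ?_
  simp only [density]
  congr 2
  simp

theorem weight_eq_zero (n : ℕ) {p : M} (hp : p ∉ (𝒜.chart n).source) : 𝒜.weight n p = 0 := by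
  by_contra h
  exact hp (𝒜.subordinate n (subset_tsupport _ h))

variable {K : Set M}

theorem finite_weights (hK : IsCompact K) : {n | ∃ p ∈ K, 𝒜.weight n p ≠ 0}.Finite := by
  refine (𝒜.weight.locallyFinite.finite_nonempty_inter_compact hK).subset ?_
  rintro n ⟨p, hp, h⟩
  exact ⟨p, h, hp⟩

/-- The finitely many indices that contribute to integrals over a compact set. -/
def indices (hK : IsCompact K) : Finset ℕ := (𝒜.finite_weights hK).toFinset

theorem weight_eq_zero_of_notMem (hK : IsCompact K) {n : ℕ} (hn : n ∉ 𝒜.indices hK) {p : M}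
    (hp : p ∈ K) : 𝒜.weight n p = 0 := by
  by_contra h
  exact hn ((𝒜.finite_weights hK).mem_toFinset.2 ⟨p, hp, h⟩)

theorem sum_weight (hK : IsCompact K) {p : M} (hp : p ∈ K) :
    ∑ n ∈ 𝒜.indices hK, 𝒜.weight n p = 1 := by
  rw [← 𝒜.weight.sum_eq_one (mem_univ p)]
  refine (finsum_eq_sum_of_support_subset _ ?_).symm
  intro n hn
  by_contra h
  exact hn (𝒜.weight_eq_zero_of_notMem hK h hp)

variable [T2Space M]

theorem integral_eq_sum (hK : IsCompact K) (η : TwoForm I M) :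
    𝒜.integral K η = ∑ n ∈ 𝒜.indices hK, ∫ y in 𝒜.region n K,
      (𝒜.weight n ((𝒜.coord n).symm y) : ℂ) * 𝒜.density n η y := by
  refine tsum_eq_sum fun n hn => ?_
  refine (setIntegral_congr_fun (g := fun _ => 0) (𝒜.measurableSet_region n hK.isClosed)
    fun y hy => ?_).trans (by simp)
  simp only [𝒜.weight_eq_zero_of_notMem hK hn hy.2, Complex.ofReal_zero, zero_mul]

theorem isCompact_image_coord {C : Set M} (hC : IsCompact C) (n : ℕ)
    (h : C ⊆ (𝒜.chart n).source) : IsCompact (𝒜.coord n '' C) :=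
  hC.image_of_continuousOn ((𝒜.continuousOn_coord n).mono h)

theorem image_coord_subset_region {C : Set M} (n : ℕ)
    (h : C ⊆ (𝒜.chart n).source) (hCK : C ⊆ K) : 𝒜.coord n '' C ⊆ 𝒜.region n K := by
  rintro _ ⟨p, hp, rfl⟩
  exact ⟨𝒜.coord_mem (h hp), by rw [mem_preimage, 𝒜.coord_left_inv (h hp)]; exact hCK hp⟩

/-- The region need not be compact in coordinates even when `K` is, because it is cut off by the
chart. Vanishing off the compact image of `C` replaces this missing compactness. -/
theorem integrableOn_region (hK : IsClosed K) (n : ℕ) {C : Set M} (hC : IsCompact C)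
    (hCs : C ⊆ (𝒜.chart n).source) (hCK : C ⊆ K) {g : Plane → ℂ}
    (hg : ContinuousOn g (𝒜.region n K))
    (h0 : ∀ y ∈ 𝒜.region n K, (𝒜.coord n).symm y ∉ C → g y = 0) :
    IntegrableOn g (𝒜.region n K) := by
  have h1 : IntegrableOn g (𝒜.coord n '' C) :=
    (hg.mono (𝒜.image_coord_subset_region n hCs hCK)).integrableOn_compact
      (𝒜.isCompact_image_coord hC n hCs)
  refine h1.of_forall_sdiff_eq_zero (𝒜.measurableSet_region n hK) fun y hy => ?_
  refine h0 y hy.1 fun h => hy.2 ⟨_, h, (𝒜.coord n).right_inv hy.1.1⟩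

theorem continuousOn_weight (n m : ℕ) :
    ContinuousOn (fun y => (𝒜.weight m ((𝒜.coord n).symm y) : ℂ)) (𝒜.coord n).target :=
  (Complex.continuous_ofReal.comp (𝒜.weight m).contMDiff.continuous).comp_continuousOn
    (𝒜.continuousOn_coord_symm n)

/-- Two-forms which are continuous over `K`. -/
def IsContinuous (K : Set M) (η : TwoForm I M) : Prop :=
  ∀ n, ContinuousOn (𝒜.density n η) (𝒜.region n K)

variable {𝒜} {η η' : TwoForm I M}

theorem IsContinuous.integrableOn (hK : IsCompact K) (h : 𝒜.IsContinuous K η) (n : ℕ) :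
    IntegrableOn (fun y => (𝒜.weight n ((𝒜.coord n).symm y) : ℂ) * 𝒜.density n η y)
      (𝒜.region n K) := by
  refine 𝒜.integrableOn_region hK.isClosed n
    (hK.inter_left (isClosed_tsupport (𝒜.weight n : M → ℝ)))
    (inter_subset_left.trans (𝒜.subordinate n)) inter_subset_right
    (((𝒜.continuousOn_weight n n).mono inter_subset_left).mul (h n)) fun y hy hyC => ?_
  have : 𝒜.weight n ((𝒜.coord n).symm y) = 0 := by
    by_contra h0
    exact hyC ⟨subset_tsupport _ h0, hy.2⟩
  simp only [this, Complex.ofReal_zero, zero_mul]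

theorem integral_congr (hK : IsCompact K) (h : ∀ n, ∀ y ∈ 𝒜.region n K,
    𝒜.density n η y = 𝒜.density n η' y) : 𝒜.integral K η = 𝒜.integral K η' := by
  rw [integral_eq_sum 𝒜 hK, integral_eq_sum 𝒜 hK]
  refine Finset.sum_congr rfl fun n _ => ?_
  refine setIntegral_congr_fun (𝒜.measurableSet_region n hK.isClosed) fun y hy => ?_
  simp only [h n y hy]

theorem integral_add (hK : IsCompact K) (h : 𝒜.IsContinuous K η) (h' : 𝒜.IsContinuous K η') :
    𝒜.integral K (fun p v w => η p v w + η' p v w) = 𝒜.integral K η + 𝒜.integral K η' := by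
  rw [integral_eq_sum 𝒜 hK, integral_eq_sum 𝒜 hK, integral_eq_sum 𝒜 hK, ← Finset.sum_add_distrib]
  refine Finset.sum_congr rfl fun n _ => ?_
  rw [← MeasureTheory.integral_add (h.integrableOn hK n) (h'.integrableOn hK n)]
  simp only [density, mul_add]

theorem integral_const_mul (hK : IsCompact K) (c : ℂ) (η : TwoForm I M) :
    𝒜.integral K (fun p v w => c * η p v w) = c * 𝒜.integral K η := by
  rw [integral_eq_sum 𝒜 hK, integral_eq_sum 𝒜 hK, Finset.mul_sum]
  refine Finset.sum_congr rfl fun n _ => ?_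
  rw [← MeasureTheory.integral_const_mul]
  simp only [density, mul_left_comm]

theorem integral_finset_sum (hK : IsCompact K) {ι : Type*} (s : Finset ι)
    (η : ι → TwoForm I M) (h : ∀ i ∈ s, 𝒜.IsContinuous K (η i)) :
    𝒜.integral K (fun p v w => ∑ i ∈ s, η i p v w) = ∑ i ∈ s, 𝒜.integral K (η i) := by
  simp only [integral_eq_sum 𝒜 hK]
  rw [Finset.sum_comm]
  refine Finset.sum_congr rfl fun n _ => ?_
  rw [← MeasureTheory.integral_finsetSum s fun i hi => (h i hi).integrableOn hK n]
  simp only [density, Finset.mul_sum]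

theorem IsContinuous.add (h : 𝒜.IsContinuous K η) (h' : 𝒜.IsContinuous K η') :
    𝒜.IsContinuous K (fun p v w => η p v w + η' p v w) := fun n => (h n).add (h' n)

theorem IsContinuous.const_mul (c : ℂ) (h : 𝒜.IsContinuous K η) :
    𝒜.IsContinuous K (fun p v w => c * η p v w) := fun n => continuousOn_const.mul (h n)

/-- Change of variables between two charts. -/
theorem setIntegral_trans [IsManifold I ∞ M] (hK : IsClosed K) (hη : IsAlternating η) (n m : ℕ)
    (f : M → ℂ) :
    ∫ y in 𝒜.region n (K ∩ (𝒜.chart m).source), f ((𝒜.coord n).symm y) * 𝒜.density n η y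
      = ∫ y in 𝒜.region m (K ∩ (𝒜.chart n).source),
          f ((𝒜.coord m).symm y) * 𝒜.density m η y := by
  have himg : 𝒜.trans n m '' 𝒜.region n (K ∩ (𝒜.chart m).source)
      = 𝒜.region m (K ∩ (𝒜.chart n).source) := by
    ext z
    constructor
    · rintro ⟨y, hy, rfl⟩
      refine ⟨𝒜.trans_mem n m hy.2.2, ?_⟩
      rw [mem_preimage, 𝒜.coord_symm_trans n m hy.2.2]
      exact ⟨hy.2.1, 𝒜.coord_symm_mem hy.1⟩
    · intro hz
      refine ⟨𝒜.trans m n z, ⟨𝒜.trans_mem m n hz.2.2, ?_⟩, ?_⟩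
      · rw [mem_preimage, 𝒜.coord_symm_trans m n hz.2.2]
        exact ⟨hz.2.1, 𝒜.coord_symm_mem hz.1⟩
      · rw [trans, Function.comp_apply, 𝒜.coord_symm_trans m n hz.2.2]
        exact (𝒜.coord m).right_inv hz.1
  have hmeas : MeasurableSet (𝒜.region n (K ∩ (𝒜.chart m).source)) := by
    have : 𝒜.region n (K ∩ (𝒜.chart m).source)
        = 𝒜.region n K \ 𝒜.region n ((𝒜.chart m).source)ᶜ := by
      ext y; simp only [region, mem_inter_iff, mem_preimage, mem_sdiff, mem_compl_iff]; tauto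
    rw [this]
    exact (𝒜.measurableSet_region n hK).diff
      (𝒜.measurableSet_region n (𝒜.chart m).open_source.isClosed_compl)
  rw [← himg, integral_image_eq_integral_abs_det_fderiv_smul volume hmeas
    (fun y hy => (𝒜.hasFDerivWithinAt_trans n m hy.1 hy.2.2).mono
      (inter_subset_left.trans (𝒜.target_subset_range n)))]
  · refine setIntegral_congr_fun hmeas fun y hy => ?_
    -- Here orientation enters: the Jacobian is positive, so its absolute value in the change of
    -- variables is the determinant in the transformation law of the density.
    rw [𝒜.density_trans hη n m hy.1 hy.2.2, 𝒜.coord_symm_trans n m hy.2.2,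
      abs_of_pos (𝒜.trans_det_pos n m hy.1 hy.2.2), Complex.real_smul]
    ring
  · intro y hy z hz hyz
    have h1 := congrArg (𝒜.coord m).symm hyz
    rw [𝒜.coord_symm_trans n m hy.2.2, 𝒜.coord_symm_trans n m hz.2.2] at h1
    exact (𝒜.coord n).symm.injOn hy.1 hz.1 h1

/-- The integral of a two-form supported in the domain of a chart is computed in this chart. -/
theorem integral_eq_chart [IsManifold I ∞ M] (hK : IsCompact K) (hη : IsAlternating η) (m : ℕ)
    {C : Set M} (hC : IsCompact C) (hCs : C ⊆ (𝒜.chart m).source) (hCK : C ⊆ K)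
    (h0 : ∀ p ∈ K, p ∉ C → ∀ v w, η p v w = 0)
    (hc : ContinuousOn (𝒜.density m η) (𝒜.region m K)) :
    𝒜.integral K η = ∫ y in 𝒜.region m K, 𝒜.density m η y := by
  have hsub (i j : ℕ) : 𝒜.region i (K ∩ (𝒜.chart j).source) ⊆ 𝒜.region i K := by
    rintro y ⟨h1, h2, -⟩; exact ⟨h1, h2⟩
  -- The term of weight `n` moves from chart `n` to chart `m`. Off the overlap it vanishes on one
  -- side because `η` is supported in chart `m`, on the other because the weight is supported in
  -- chart `n`. Once all terms are in chart `m`, the weights sum to one.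
  have step (n : ℕ) : ∫ y in 𝒜.region n K, (𝒜.weight n ((𝒜.coord n).symm y) : ℂ) * 𝒜.density n η y
      = ∫ y in 𝒜.region m K, (𝒜.weight n ((𝒜.coord m).symm y) : ℂ) * 𝒜.density m η y := by
    rw [setIntegral_eq_of_subset_of_forall_sdiff_eq_zero (𝒜.measurableSet_region n hK.isClosed)
      (hsub n m), setIntegral_trans hK.isClosed hη n m (fun p => (𝒜.weight n p : ℂ)),
      ← setIntegral_eq_of_subset_of_forall_sdiff_eq_zero (𝒜.measurableSet_region m hK.isClosed)
      (hsub m n)]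
    · intro y hy
      have : (𝒜.coord m).symm y ∉ (𝒜.chart n).source := fun h => hy.2 ⟨hy.1.1, hy.1.2, h⟩
      rw [𝒜.weight_eq_zero n this, Complex.ofReal_zero, zero_mul]
    · intro y hy
      have : (𝒜.coord n).symm y ∉ C := fun h => hy.2 ⟨hy.1.1, hy.1.2, hCs h⟩
      rw [density, h0 _ hy.1.2 this, mul_zero]
  rw [integral_eq_sum 𝒜 hK, Finset.sum_congr rfl fun n _ => step n,
    ← MeasureTheory.integral_finsetSum]
  · refine setIntegral_congr_fun (𝒜.measurableSet_region m hK.isClosed) fun y hy => ?_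
    rw [← Finset.sum_mul, ← Complex.ofReal_sum, 𝒜.sum_weight hK hy.2, Complex.ofReal_one, one_mul]
  · intro n _
    refine 𝒜.integrableOn_region hK.isClosed m hC hCs hCK
      (((𝒜.continuousOn_weight m n).mono inter_subset_left).mul hc) fun y hy hyC => ?_
    rw [density, h0 _ hy.2 hyC, mul_zero]

end OrientedAtlas

/-! ### The theorem of Stokes for compactly supported one-forms -/

/-- The coefficient of the exterior derivative of a one-form on the plane. -/
def curl (a : Plane → Plane →L[ℝ] ℂ) (y : Plane) : ℂ := fderiv ℝ a y e₁ e₂ - fderiv ℝ a y e₂ e₁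

/-- Integration by parts against the constant function `1`. -/
theorem integral_fderiv_apply_eq_zero {f : Plane → ℂ} (hf : ContDiff ℝ 1 f)
    (hc : HasCompactSupport f) (v : Plane) : ∫ y, fderiv ℝ f y v = 0 := by
  have hi : Integrable fun y => fderiv ℝ f y v :=
    ((hf.continuous_fderiv (by simp)).clm_apply continuous_const).integrable_of_hasCompactSupport
      (hc.fderiv_apply (𝕜 := ℝ) v)
  have h := integral_mul_fderiv_eq_neg_fderiv_mul_of_integrable (μ := volume)
    (f := fun _ : Plane => (1 : ℂ)) (g := f) (v := v) (by simp) (by simpa using hi)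
    (by simpa using hf.continuous.integrable_of_hasCompactSupport hc)
    (fun x _ => differentiableAt_const _) (fun x _ => (hf.differentiable (by simp)) x)
  simpa using h

/-- Since `a` vanishes on `U` outside a compact subset of `U`, its extension by zero is continuously
differentiable on the whole plane, where each partial derivative integrates to zero. -/
theorem integral_curl_eq_zero {U D S : Set Plane} (hU : IsOpen U) {a : Plane → Plane →L[ℝ] ℂ}
    (ha : ContDiffOn ℝ 1 a U) (hD : IsCompact D) (hDS : D ⊆ S) (hSU : S ⊆ U)
    (hS : MeasurableSet S) (h0 : ∀ y ∈ U, y ∉ D → a y = 0) : ∫ y in S, curl a y = 0 := by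
  classical
  set b : Plane → Plane →L[ℝ] ℂ := U.indicator a
  have hbU {y : Plane} (hy : y ∈ U) : b =ᶠ[nhds y] a := by
    filter_upwards [hU.mem_nhds hy] with z hz using indicator_of_mem hz a
  have hb0 {y : Plane} (hy : y ∉ D) : b y = 0 := by
    by_cases hyU : y ∈ U
    · exact (indicator_of_mem hyU a).trans (h0 y hyU hy)
    · exact indicator_of_notMem hyU a
  have hbD {y : Plane} (hy : y ∉ D) : b =ᶠ[nhds y] fun _ => 0 := by
    filter_upwards [hD.isClosed.isOpen_compl.mem_nhds hy] with z hz using hb0 hz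
  have hb : ContDiff ℝ 1 b := by
    refine contDiff_iff_contDiffAt.2 fun y => ?_
    by_cases hy : y ∈ D
    · have hyU := hSU (hDS hy)
      exact (ha.contDiffAt (hU.mem_nhds hyU)).congr_of_eventuallyEq (hbU hyU)
    · exact contDiffAt_const.congr_of_eventuallyEq (hbD hy)
  have hbc : HasCompactSupport b := HasCompactSupport.intro hD fun y hy => hb0 hy
  have e1 : ∫ y in S, curl a y = ∫ y in S, curl b y :=
    setIntegral_congr_fun hS fun y hy => by
      simp only [curl, (hbU (hSU hy)).fderiv_eq]
  have e2 : ∫ y in S, curl b y = ∫ y, curl b y := by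
    refine setIntegral_eq_integral_of_forall_compl_eq_zero fun y hy => ?_
    simp [curl, (hbD fun h => hy (hDS h)).fderiv_eq]
  have hcomp (w : Plane) : ContDiff ℝ 1 (fun y => b y w) := hb.clm_apply contDiff_const
  have hcc (w : Plane) : HasCompactSupport (fun y => b y w) :=
    hbc.mono fun y hy h => hy (by simp only [h, zero_apply])
  have hder (v w y : Plane) : fderiv ℝ b y v w = fderiv ℝ (fun y => b y w) y v := by
    rw [fderiv_clm_apply (hb.differentiable (by simp) y) (differentiableAt_const _)]
    simp
  have hint (v w : Plane) : Integrable fun y => fderiv ℝ (fun y => b y w) y v :=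
    (((hcomp w).continuous_fderiv (by simp)).clm_apply
      continuous_const).integrable_of_hasCompactSupport ((hcc w).fderiv_apply (𝕜 := ℝ) v)
  rw [e1, e2]
  simp only [curl, hder]
  rw [integral_sub (hint _ _) (hint _ _), integral_fderiv_apply_eq_zero (hcomp _) (hcc _),
    integral_fderiv_apply_eq_zero (hcomp _) (hcc _), sub_zero]

theorem curl_smul {f : Plane → ℝ} {a : Plane → Plane →L[ℝ] ℂ} {y : Plane}
    (hf : DifferentiableAt ℝ f y) (ha : DifferentiableAt ℝ a y) :
    curl (fun z => f z • a z) y = (f y : ℂ) * curl a y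
      + ((fderiv ℝ f y e₁ : ℂ) * a y e₂ - (fderiv ℝ f y e₂ : ℂ) * a y e₁) := by
  rw [curl, fderiv_fun_smul hf ha, curl]
  simp
  ring

theorem continuousOn_curl {U : Set Plane} (hU : IsOpen U) {a : Plane → Plane →L[ℝ] ℂ}
    (ha : ContDiffOn ℝ 1 a U) : ContinuousOn (curl a) U := by
  have h := ha.continuousOn_fderiv_of_isOpen hU le_rfl
  exact ((h.clm_apply continuousOn_const).clm_apply continuousOn_const).sub
    ((h.clm_apply continuousOn_const).clm_apply continuousOn_const)

/-! ### Algebra of alternating two-forms and linear one-forms. -/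

theorem IsAlternating.add {η η' : TwoForm I M} (h : IsAlternating η) (h' : IsAlternating η') :
    IsAlternating fun p v w => η p v w + η' p v w := fun p v w a b c d => by
  simp only [h p, h' p, mul_add]

theorem IsAlternating.mul_left {η : TwoForm I M} (h : IsAlternating η) (f : M → ℂ) :
    IsAlternating fun p v w => f p * η p v w := fun p v w a b c d => by
  simp only [h p, mul_left_comm]

theorem isAlternating_of_bilinear {η : TwoForm I M}
    (B : ∀ p : M, TangentSpace I p → TangentSpace I p → ℂ)
    (h₁ : ∀ p u v w (a b : ℝ), B p (a • v + b • w) u = a * B p v u + b * B p w u)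
    (h₂ : ∀ p u v w (a b : ℝ), B p u (a • v + b • w) = a * B p u v + b * B p u w)
    (h : ∀ p v w, η p v w = B p v w - B p w v) : IsAlternating η := fun p v w a b c d => by
  simp only [h, h₁, h₂]
  push_cast
  ring

/-- A function on the tangent spaces which is linear, up to bundling. -/
def IsLinearForm {V : Type*} [AddCommGroup V] [Module ℝ V] (α : ∀ p : M, TangentSpace I p → V) :
    Prop :=
  ∀ p v w (a b : ℝ), α p (a • v + b • w) = a • α p v + b • α p w

theorem isLinearForm_diff {V : Type*} [NormedAddCommGroup V] [NormedSpace ℝ V] (f : M → V) :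
    IsLinearForm (diff I f) := fun p v w a b => by
  have h : ∀ L : TangentSpace I p →L[ℝ] V, L (a • v + b • w) = a • L v + b • L w := fun L => by
    rw [map_add, map_smul, map_smul]
  exact h _

namespace OrientedAtlas

variable (𝒜 : OrientedAtlas I M)

/-- The coordinate expression of a scalar one-form. -/
def pull (n : ℕ) (α : ∀ p : M, TangentSpace I p →L[ℝ] ℂ) (y : Plane) : Plane →L[ℝ] ℂ :=
  (α ((𝒜.coord n).symm y)).comp (𝒜.frame n y)

theorem pull_apply (n : ℕ) (α : ∀ p : M, TangentSpace I p →L[ℝ] ℂ) (y v : Plane) :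
    𝒜.pull n α y v = α ((𝒜.coord n).symm y) (𝒜.frame n y v) := rfl

variable {K : Set M}

theorem region_subset_interior [IsManifold I ∞ M] (hK : K ⊆ I.interior M) (n : ℕ) :
    𝒜.region n K ⊆ interior (𝒜.coord n).target := by
  intro y hy
  have := (extend_mem_interior_target (𝒜.mem_maximalAtlas n) (𝒜.coord_symm_mem hy.1)).2 (hK hy.2)
  rwa [(𝒜.coord n).right_inv hy.1] at this

theorem contDiffOn_comp_coord_symm {V : Type*} [NormedAddCommGroup V] [NormedSpace ℝ V] {f : M → V}
    (hf : ContMDiff I 𝓘(ℝ, V) ∞ f) (n : ℕ) :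
    ContDiffOn ℝ ∞ (f ∘ (𝒜.coord n).symm) (𝒜.coord n).target :=
  (hf.comp_contMDiffOn (𝒜.contMDiffOn_coord_symm n)).contDiffOn

theorem diff_frame_of_mem_interior {V : Type*} [NormedAddCommGroup V] [NormedSpace ℝ V]
    {f : M → V} (n : ℕ) {y : Plane} (hy : y ∈ interior (𝒜.coord n).target)
    (hf : MDifferentiableAt I 𝓘(ℝ, V) f ((𝒜.coord n).symm y)) (v : Plane) :
    diff I f ((𝒜.coord n).symm y) (𝒜.frame n y v)
      = fderiv ℝ (f ∘ (𝒜.coord n).symm) y v := by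
  rw [𝒜.diff_frame n (interior_subset hy) hf,
    fderivWithin_of_mem_nhds (mem_interior_iff_mem_nhds.1 hy)]

/-- The theorem of Stokes for a one-form which vanishes outside a compact subset of the interior. -/
theorem integral_eq_zero_of_curl [T2Space M] [IsManifold I ∞ M] (hK : IsCompact K)
    (hKi : K ⊆ I.interior M) {α : ∀ p : M, TangentSpace I p →L[ℝ] ℂ}
    (hα : ∀ n, ContDiffOn ℝ 1 (𝒜.pull n α) (interior (𝒜.coord n).target))
    (hα0 : ∀ p ∉ K, α p = 0) {η : TwoForm I M} (hη : IsAlternating η)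
    (h : ∀ n, ∀ y ∈ 𝒜.region n K, 𝒜.density n η y = curl (𝒜.pull n α) y) :
    𝒜.integral K η = 0 := by
  let ρ : ℕ → M → ℝ := fun m => 𝒜.weight m
  have hρ (m : ℕ) : ContMDiff I 𝓘(ℝ, ℝ) ∞ (ρ m) := (𝒜.weight m).contMDiff
  have hρd (m : ℕ) : MDifferentiable I 𝓘(ℝ, ℝ) (ρ m) := (hρ m).mdifferentiable (by simp)
  have hρn (n m : ℕ) {y : Plane} (hy : y ∈ interior (𝒜.coord n).target) :
      ContDiffAt ℝ ∞ (ρ m ∘ (𝒜.coord n).symm) y :=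
    (𝒜.contDiffOn_comp_coord_symm (hρ m) n).contDiffAt (mem_interior_iff_mem_nhds.1 hy)
  have hreg := fun n => 𝒜.region_subset_interior hKi n
  have had {n : ℕ} {y : Plane} (hy : y ∈ interior (𝒜.coord n).target) :
      DifferentiableAt ℝ (𝒜.pull n α) y :=
    ((hα n).differentiableOn (by simp)).differentiableAt (isOpen_interior.mem_nhds hy)
  -- This is `d (ρ_m α) = ρ_m dα + dρ_m ∧ α`, with `η` in place of `dα`.
  let ηρ : ℕ → TwoForm I M := fun m p v w => (ρ m p : ℂ) * η p v w
    + (((diff I (ρ m) p v : ℝ) : ℂ) * α p w - ((diff I (ρ m) p w : ℝ) : ℂ) * α p v)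
  have hdens (m n : ℕ) (y : Plane) (hy : y ∈ 𝒜.region n K) :
      𝒜.density n (ηρ m) y = curl (fun z => (ρ m ∘ (𝒜.coord n).symm) z • 𝒜.pull n α z) y := by
    have hyi := hreg n hy
    rw [curl_smul ((hρn n m hyi).differentiableAt (by simp)) (had hyi), ← h n y hy,
      ← 𝒜.diff_frame_of_mem_interior n hyi (hρd m _),
      ← 𝒜.diff_frame_of_mem_interior n hyi (hρd m _)]
    rfl
  have hsm (m n : ℕ) : ContDiffOn ℝ 1 (fun z => (ρ m ∘ (𝒜.coord n).symm) z • 𝒜.pull n α z)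
      (interior (𝒜.coord n).target) :=
    (((𝒜.contDiffOn_comp_coord_symm (hρ m) n).mono interior_subset).of_le (by simp)).smul (hα n)
  have hcont (m : ℕ) : 𝒜.IsContinuous K (ηρ m) := fun n =>
    ((continuousOn_curl isOpen_interior (hsm m n)).mono (hreg n)).congr (hdens m n)
  have halt (m : ℕ) : IsAlternating (ηρ m) := by
    refine (hη.mul_left fun p => (ρ m p : ℂ)).add (isAlternating_of_bilinear
      (fun p v w => ((diff I (ρ m) p v : ℝ) : ℂ) * α p w) (fun p u v w a b => ?_)
      (fun p u v w a b => ?_) fun p v w => rfl)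
    · rw [isLinearForm_diff (ρ m) p]
      push_cast [smul_eq_mul]
      ring
    · rw [map_add, map_smul, map_smul, Complex.real_smul, Complex.real_smul]
      ring
  have hsum : 𝒜.integral K η
      = 𝒜.integral K (fun p v w => ∑ m ∈ 𝒜.indices hK, ηρ m p v w) := by
    refine integral_congr hK fun n y hy => ?_
    have hyi := hreg n hy
    -- The terms `dρ_m ∧ α` must sum to zero even at boundary points of `K`, around which the chosen
    -- finite sum of weights need not be one. If `α ≠ 0` at the point, then `α ≠ 0` nearby; those
    -- points lie in `K`, and the sum is locally constant. If `α = 0` there, nothing is needed.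
    have e : ∀ v w : Plane, ∑ m ∈ 𝒜.indices hK, ((fderiv ℝ (ρ m ∘ (𝒜.coord n).symm) y v : ℝ) : ℂ)
        * 𝒜.pull n α y w = 0 := by
      intro v w
      by_cases h0 : 𝒜.pull n α y = 0
      · simp [h0]
      · rw [← Finset.sum_mul, ← Complex.ofReal_sum]
        have hS : fderiv ℝ (fun z => ∑ m ∈ 𝒜.indices hK, (ρ m ∘ (𝒜.coord n).symm) z) y = 0 := by
          have hev : (fun z => ∑ m ∈ 𝒜.indices hK, (ρ m ∘ (𝒜.coord n).symm) z)
              =ᶠ[nhds y] fun _ => (1 : ℝ) := by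
            filter_upwards [(had hyi).continuousAt.eventually_ne h0] with z hz
            refine 𝒜.sum_weight hK (p := (𝒜.coord n).symm z) ?_
            by_contra hzK
            exact hz (by rw [pull, hα0 _ hzK]; rfl)
          rw [hev.fderiv_eq]; simp
        rw [fderiv_fun_sum fun m _ => (hρn n m hyi).differentiableAt (by simp)] at hS
        have := DFunLike.congr_fun hS v
        simp only [sum_apply, zero_apply] at this
        rw [this, Complex.ofReal_zero, zero_mul]
    have e2 : 𝒜.density n (fun p v w => ∑ m ∈ 𝒜.indices hK, ηρ m p v w) y
        = ∑ m ∈ 𝒜.indices hK, 𝒜.density n (ηρ m) y := rfl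
    rw [e2, Finset.sum_congr rfl fun m _ => (hdens m n y hy).trans
      (curl_smul ((hρn n m hyi).differentiableAt (by simp)) (had hyi)),
      Finset.sum_add_distrib, Finset.sum_sub_distrib, e, e, sub_zero, add_zero, ← Finset.sum_mul,
      ← Complex.ofReal_sum]
    have := 𝒜.sum_weight hK hy.2
    simp only [Function.comp_apply, ρ]
    rw [this, Complex.ofReal_one, one_mul, h n y hy]
  rw [hsum, integral_finset_sum hK _ _ fun m _ => hcont m]
  refine Finset.sum_eq_zero fun m _ => ?_
  -- Each piece `ρ_m α` is supported compactly in a single chart, which reduces the claim to the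
  -- planar statement.
  have hC : IsCompact (tsupport (ρ m) ∩ K) := hK.inter_left (isClosed_tsupport _)
  have hCs : tsupport (ρ m) ∩ K ⊆ (𝒜.chart m).source := inter_subset_left.trans (𝒜.subordinate m)
  rw [integral_eq_chart hK (halt m) m hC hCs inter_subset_right ?_ (hcont m m),
    setIntegral_congr_fun (𝒜.measurableSet_region m hK.isClosed) (hdens m m)]
  · refine integral_curl_eq_zero isOpen_interior (hsm m m) (𝒜.isCompact_image_coord hC m hCs)
      (𝒜.image_coord_subset_region m hCs inter_subset_right) (hreg m)
      (𝒜.measurableSet_region m hK.isClosed) fun y hy hyD => ?_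
    have hyC : (𝒜.coord m).symm y ∉ tsupport (ρ m) ∩ K := fun hc =>
      hyD ⟨_, hc, (𝒜.coord m).right_inv (interior_subset hy)⟩
    by_cases hyK : (𝒜.coord m).symm y ∈ K
    · have : (ρ m ∘ (𝒜.coord m).symm) y = 0 := by
        by_contra h0
        exact hyC ⟨subset_tsupport _ h0, hyK⟩
      ext1 v
      change (ρ m ∘ (𝒜.coord m).symm) y • 𝒜.pull m α y v = 0
      rw [this, zero_smul]
    · have : 𝒜.pull m α y = 0 := by rw [pull, hα0 _ hyK]; rfl
      ext1 v
      simp [this]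
  · intro p hp hpC v w
    have hpt : p ∉ tsupport (ρ m) := fun hc => hpC ⟨hc, hp⟩
    have hev : ρ m =ᶠ[nhds p] fun _ => 0 := notMem_tsupport_iff_eventuallyEq.1 hpt
    have hd : mfderiv I 𝓘(ℝ, ℝ) (ρ m) p = 0 := by
      rw [hev.mfderiv_eq]; exact mfderiv_const
    have h1 : ρ m p = 0 := hev.self_of_nhds
    have h2 (v : TangentSpace I p) : diff I (ρ m) p v = 0 := by rw [diff, hd]; rfl
    simp only [ηρ, h1, h2, Complex.ofReal_zero, zero_mul, sub_zero, add_zero]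

/-- The derivative of a family of two-forms with respect to the parameter. -/
def derivForm (L : ℝ → TwoForm I M) (t : ℝ) : TwoForm I M := fun p v w => deriv (fun s => L s p v w) t

theorem isAlternating_derivForm {L : ℝ → TwoForm I M} (hL : ∀ t, IsAlternating (L t)) (t : ℝ) :
    IsAlternating (derivForm L t) := fun p v w a b c d => by
  simp only [derivForm, hL _ p v w a b c d, deriv_const_mul_field]

/-- Families of two-forms with continuously differentiable coefficients over the interior. -/
def IsC1Family (L : ℝ → TwoForm I M) : Prop :=
  ∀ n, ContDiffOn ℝ 1 (fun q : ℝ × Plane => 𝒜.density n (L q.1) q.2)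
    (univ ×ˢ interior (𝒜.coord n).target)

variable {𝒜}

theorem IsC1Family.hasDerivAt {L : ℝ → TwoForm I M} (hL : 𝒜.IsC1Family L) {n : ℕ} {y : Plane}
    (hy : y ∈ interior (𝒜.coord n).target) (t : ℝ) :
    HasDerivAt (fun s => 𝒜.density n (L s) y)
      (fderiv ℝ (fun q : ℝ × Plane => 𝒜.density n (L q.1) q.2) (t, y) (1, 0)) t := by
  have hd := ((hL n).differentiableOn (by simp)).differentiableAt
    ((isOpen_univ.prod isOpen_interior).mem_nhds (show (t, y) ∈ _ from ⟨trivial, hy⟩))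
  have hc : HasDerivAt (fun s : ℝ => (s, y)) ((1 : ℝ), (0 : Plane)) t :=
    (hasDerivAt_id t).prodMk (hasDerivAt_const t y)
  exact hd.hasFDerivAt.comp_hasDerivAt t hc

theorem IsC1Family.density_derivForm {L : ℝ → TwoForm I M} (hL : 𝒜.IsC1Family L) {n : ℕ} {y : Plane}
    (hy : y ∈ interior (𝒜.coord n).target) (t : ℝ) : 𝒜.density n (derivForm L t) y
      = fderiv ℝ (fun q : ℝ × Plane => 𝒜.density n (L q.1) q.2) (t, y) (1, 0) :=
  (hL.hasDerivAt hy t).deriv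

theorem IsC1Family.continuousOn_fderiv {L : ℝ → TwoForm I M} (hL : 𝒜.IsC1Family L) (n : ℕ) :
    ContinuousOn (fun q : ℝ × Plane =>
      fderiv ℝ (fun q : ℝ × Plane => 𝒜.density n (L q.1) q.2) q (1, 0))
      (univ ×ˢ interior (𝒜.coord n).target) :=
  ((hL n).continuousOn_fderiv_of_isOpen (isOpen_univ.prod isOpen_interior) le_rfl).clm_apply
    continuousOn_const

theorem continuousOn_slice {V : Type*} [TopologicalSpace V] {g : ℝ × Plane → V} {U : Set Plane}
    (hg : ContinuousOn g (univ ×ˢ U)) (t : ℝ) : ContinuousOn (fun y => g (t, y)) U :=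
  hg.comp (continuousOn_const.prodMk continuousOn_id) fun _ hy => ⟨trivial, hy⟩

theorem IsC1Family.isContinuous_derivForm [IsManifold I ∞ M] {L : ℝ → TwoForm I M}
    (hL : 𝒜.IsC1Family L) (hKi : K ⊆ I.interior M) (t : ℝ) :
    𝒜.IsContinuous K (derivForm L t) := fun n =>
  ((continuousOn_slice (hL.continuousOn_fderiv n) t).mono
    (𝒜.region_subset_interior hKi n)).congr fun _ hy =>
      hL.density_derivForm (𝒜.region_subset_interior hKi n hy) t

theorem IsC1Family.isContinuous [IsManifold I ∞ M] {L : ℝ → TwoForm I M}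
    (hL : 𝒜.IsC1Family L) (hKi : K ⊆ I.interior M) (t : ℝ) :
    𝒜.IsContinuous K (L t) := fun n =>
  (continuousOn_slice (hL n).continuousOn t).mono (𝒜.region_subset_interior hKi n)

/-- Differentiation under the integral over a compact subset of the interior. -/
theorem IsC1Family.hasDerivAt_integral [T2Space M] [IsManifold I ∞ M] {L : ℝ → TwoForm I M}
    (hL : 𝒜.IsC1Family L) (hK : IsCompact K) (hKi : K ⊆ I.interior M) (t : ℝ) :
    HasDerivAt (fun s => 𝒜.integral K (L s)) (𝒜.integral K (derivForm L t)) t := by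
  simp only [integral_eq_sum 𝒜 hK]
  refine HasDerivAt.fun_sum fun n _ => ?_
  have hreg := 𝒜.region_subset_interior hKi n
  have hmeas := 𝒜.measurableSet_region n hK.isClosed
  set ρ : Plane → ℂ := fun y => (𝒜.weight n ((𝒜.coord n).symm y) : ℂ) with hρ
  have hρc : ContinuousOn ρ (𝒜.region n K) := (𝒜.continuousOn_weight n n).mono inter_subset_left
  have hC : IsCompact (tsupport (𝒜.weight n : M → ℝ) ∩ K) := hK.inter_left (isClosed_tsupport _)
  have hCs : tsupport (𝒜.weight n : M → ℝ) ∩ K ⊆ (𝒜.chart n).source :=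
    inter_subset_left.trans (𝒜.subordinate n)
  set D := 𝒜.coord n '' (tsupport (𝒜.weight n : M → ℝ) ∩ K)
  have hD : IsCompact D := 𝒜.isCompact_image_coord hC n hCs
  have hDr : D ⊆ 𝒜.region n K := 𝒜.image_coord_subset_region n hCs inter_subset_right
  have hρ0 : ∀ y ∈ 𝒜.region n K, y ∉ D → ρ y = 0 := fun y hy hyD => by
    have : 𝒜.weight n ((𝒜.coord n).symm y) = 0 := by
      by_contra h0
      exact hyD ⟨_, ⟨subset_tsupport _ h0, hy.2⟩, (𝒜.coord n).right_inv hy.1⟩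
    simp only [hρ, this, Complex.ofReal_zero]
  set G' : ℝ × Plane → ℂ := fun q =>
    fderiv ℝ (fun q : ℝ × Plane => 𝒜.density n (L q.1) q.2) q (1, 0)
  have hG' : ContinuousOn (fun q : ℝ × Plane => ρ q.2 * G' q) (univ ×ˢ 𝒜.region n K) :=
    (hρc.comp continuousOn_snd fun q hq => hq.2).mul
      ((hL.continuousOn_fderiv n).mono (prod_mono_right hreg))
  -- The `t`-derivative is continuous on the compact set `[t - 1, t + 1] × D`, and the weight
  -- vanishes off `D`; so `B` on `D` and `0` elsewhere dominates it.
  obtain ⟨B, hB⟩ := ((isCompact_Icc (a := t - 1) (b := t + 1)).prod hD).exists_bound_of_continuousOn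
    (hG'.mono (prod_mono (subset_univ _) hDr))
  have hbound : Integrable (D.indicator fun _ => B) (volume.restrict (𝒜.region n K)) :=
    (((integrableOn_const (hD.measure_lt_top.ne)).integrable_indicator hD.measurableSet)).restrict
  have key := hasDerivAt_integral_of_dominated_loc_of_deriv_le (𝕜 := ℝ)
    (μ := volume.restrict (𝒜.region n K)) (F := fun s y => ρ y * 𝒜.density n (L s) y)
    (F' := fun s y => ρ y * G' (s, y)) (x₀ := t) (s := Icc (t - 1) (t + 1))
    (bound := D.indicator fun _ => B) (Icc_mem_nhds (by linarith) (by linarith))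
    (Filter.Eventually.of_forall fun s =>
      (hρc.mul (hL.isContinuous hKi s n)).aestronglyMeasurable hmeas)
    ((hL.isContinuous hKi t).integrableOn hK n)
    ((hρc.mul ((continuousOn_slice (hL.continuousOn_fderiv n) t).mono hreg)).aestronglyMeasurable
      hmeas)
    (ae_restrict_of_forall_mem hmeas fun y hy s hs => ?_) hbound
    (ae_restrict_of_forall_mem hmeas fun y hy s hs => (hL.hasDerivAt (hreg hy) s).const_mul _)
  · refine key.2.congr_deriv (setIntegral_congr_fun hmeas fun y hy => ?_)
    simp only [G']
    rw [hL.density_derivForm (hreg hy)]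
  · by_cases hyD : y ∈ D
    · rw [indicator_of_mem hyD]
      exact hB (s, y) ⟨hs, hyD⟩
    · rw [indicator_of_notMem hyD, hρ0 y hy hyD, zero_mul, norm_zero]

end OrientedAtlas

/-! ### Differentiation along maps to the dual group -/

section Manifold

variable {E' : Type*} [NormedAddCommGroup E'] [NormedSpace ℝ E'] {H' : Type*} [TopologicalSpace H']
  {J : ModelWithCorners ℝ E' H'} {P : Type*} [TopologicalSpace P] [ChartedSpace H' P]

theorem diff_bilinear {V₁ V₂ V₃ : Type*} [NormedAddCommGroup V₁] [NormedSpace ℝ V₁]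
    [NormedAddCommGroup V₂] [NormedSpace ℝ V₂] [NormedAddCommGroup V₃] [NormedSpace ℝ V₃]
    (B : V₁ →L[ℝ] V₂ →L[ℝ] V₃) {f : P → V₁} {g : P → V₂} {p : P}
    (hf : MDifferentiableAt J 𝓘(ℝ, V₁) f p) (hg : MDifferentiableAt J 𝓘(ℝ, V₂) g p)
    (v : TangentSpace J p) :
    diff J (fun q => B (f q) (g q)) p v = B (f p) (diff J g p v) + B (diff J f p v) (g p) := by
  have h1 := hf.hasMFDerivAt
  have h2 := hg.hasMFDerivAt
  have h3 : HasMFDerivAt J 𝓘(ℝ, V₃) (fun q => B (f q) (g q)) p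
      (B.precompR E' (f p) (mfderiv J 𝓘(ℝ, V₂) g p : E' →L[ℝ] V₂)
        + B.precompL E' (mfderiv J 𝓘(ℝ, V₁) f p : E' →L[ℝ] V₁) (g p)) := by
    refine ⟨(B.continuous.continuousAt.comp h1.1).clm_apply h2.1, ?_⟩
    have key : ∀ {f : E' → V₁} {g : E' → V₂} {f' : E' →L[ℝ] V₁} {g' : E' →L[ℝ] V₂} {s : Set E'}
        {x : E'}, HasFDerivWithinAt f f' s x → HasFDerivWithinAt g g' s x →
        HasFDerivWithinAt (fun y => B (f y) (g y)) (B.precompR E' (f x) g' + B.precompL E' f' (g x))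
          s x := fun h h' => B.hasFDerivWithinAt_of_bilinear h h'
    have := key h1.2 h2.2
    simp only [mfld_simps] at this
    exact this
  rw [diff, h3.mfderiv]
  rfl

theorem diff_clm {V₁ V₂ : Type*} [NormedAddCommGroup V₁] [NormedSpace ℝ V₁]
    [NormedAddCommGroup V₂] [NormedSpace ℝ V₂] (L : V₁ →L[ℝ] V₂) {f : P → V₁} {p : P}
    (hf : MDifferentiableAt J 𝓘(ℝ, V₁) f p) (v : TangentSpace J p) :
    diff J (fun q => L (f q)) p v = L (diff J f p v) := by
  have h3 := L.hasMFDerivAt.comp p hf.hasMFDerivAt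
  have e : diff J (fun q => L (f q)) p v = _ := congrArg (fun T => T v) h3.mfderiv
  exact e

theorem contMDiffAt_group_inv {h : P → linearGroup 𝔤} {n : ℕ∞ω} {p : P}
    (hh : ContMDiffAt J 𝓘(ℝ, 𝓐) n (fun q => ((h q : 𝓐ˣ) : 𝓐)) p) :
    ContMDiffAt J 𝓘(ℝ, 𝓐) n (fun q => (((h q : 𝓐ˣ)⁻¹ : 𝓐ˣ) : 𝓐)) p := by
  have := FiniteDimensional.complete ℂ 𝓐
  have h1 := (contDiffAt_ringInverse (n := n) ℝ (h p : 𝓐ˣ)).contMDiffAt.comp p hh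
  refine h1.congr_of_eventuallyEq (Filter.Eventually.of_forall fun q => ?_)
  simp

theorem Ad_eq_proj (g : linearGroup 𝔤) (x : 𝔤) :
    Ad g x = proj 𝔤 (((g : 𝓐ˣ) : 𝓐) * incl 𝔤 x * ((g : 𝓐ˣ)⁻¹ : 𝓐ˣ)) := by
  rw [← proj_coe (Ad g x), coe_Ad, incl_apply]

theorem contMDiffAt_mul {f g : P → 𝓐} {n : ℕ∞ω} {p : P} (hf : ContMDiffAt J 𝓘(ℝ, 𝓐) n f p)
    (hg : ContMDiffAt J 𝓘(ℝ, 𝓐) n g p) : ContMDiffAt J 𝓘(ℝ, 𝓐) n (fun q => f q * g q) p :=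
  (contDiff_mul (𝕜 := ℝ) (𝔸 := 𝓐)).contMDiff.contMDiffAt.comp p (hf.prodMk_space hg)

theorem contMDiffAt_Ad {h : P → linearGroup 𝔤} {y : P → 𝔤} {n : ℕ∞ω} {p : P}
    (hh : ContMDiffAt J 𝓘(ℝ, 𝓐) n (fun q => ((h q : 𝓐ˣ) : 𝓐)) p)
    (hy : ContMDiffAt J 𝓘(ℝ, 𝔤) n y p) :
    ContMDiffAt J 𝓘(ℝ, 𝔤) n (fun q => Ad (h q) (y q)) p := by
  simp only [Ad_eq_proj]
  exact (proj 𝔤).contMDiff.contMDiffAt.comp p (contMDiffAt_mul (contMDiffAt_mul hh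
    ((incl 𝔤).contMDiff.contMDiffAt.comp p hy)) (contMDiffAt_group_inv hh))

theorem contMDiffAt_Ad_inv {h : P → linearGroup 𝔤} {y : P → 𝔤} {n : ℕ∞ω} {p : P}
    (hh : ContMDiffAt J 𝓘(ℝ, 𝓐) n (fun q => ((h q : 𝓐ˣ) : 𝓐)) p)
    (hy : ContMDiffAt J 𝓘(ℝ, 𝔤) n y p) :
    ContMDiffAt J 𝓘(ℝ, 𝔤) n (fun q => Ad (h q)⁻¹ (y q)) p := by
  have h1 := contMDiffAt_group_inv hh
  exact contMDiffAt_Ad (h := fun q => (h q)⁻¹) h1 hy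

theorem contMDiffAt_twist {r : 𝔤 →ₗ[ℂ] 𝔤} {h : P → linearGroup 𝔤} {y : P → 𝔤} {n : ℕ∞ω} {p : P}
    (hh : ContMDiffAt J 𝓘(ℝ, 𝓐) n (fun q => ((h q : 𝓐ˣ) : 𝓐)) p)
    (hy : ContMDiffAt J 𝓘(ℝ, 𝔤) n y p) :
    ContMDiffAt J 𝓘(ℝ, 𝔤) n (fun q => twist r (h q) (y q)) p :=
  contMDiffAt_Ad hh ((endL r).contMDiff.contMDiffAt.comp p (contMDiffAt_Ad_inv hh hy))

section Derivative

variable {h : P → linearGroup 𝔤} {y : P → 𝔤} {p : P} {v : TangentSpace J p} {η : 𝔤}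

/-- The derivative of `Ad_h⁻¹ y`, where `η = dh h⁻¹`. -/
theorem diff_Ad_inv (hh : ContMDiffAt J 𝓘(ℝ, 𝓐) 1 (fun q => ((h q : 𝓐ˣ) : 𝓐)) p)
    (hy : ContMDiffAt J 𝓘(ℝ, 𝔤) 1 y p)
    (hη : diff J (fun q => ((h q : 𝓐ˣ) : 𝓐)) p v = (η : 𝓐) * ((h p : 𝓐ˣ) : 𝓐)) :
    diff J (fun q => Ad (h q)⁻¹ (y q)) p v = Ad (h p)⁻¹ (diff J y p v - ⁅η, y p⁆) := by
  have hW := (contMDiffAt_Ad_inv hh hy).mdifferentiableAt (by simp)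
  have hh' := hh.mdifferentiableAt (by simp)
  have hy' := hy.mdifferentiableAt (by simp)
  have hiW := (((incl 𝔤).contMDiff (n := 1)).contMDiffAt.comp p
    (contMDiffAt_Ad_inv hh hy)).mdifferentiableAt (by simp)
  have hiy := (((incl 𝔤).contMDiff (n := 1)).contMDiffAt.comp p hy).mdifferentiableAt (by simp)
  have e1 := diff_bilinear (ContinuousLinearMap.mul ℝ 𝓐) hh' hiW v
  have e2 := diff_bilinear (ContinuousLinearMap.mul ℝ 𝓐) hiy hh' v
  -- The identity `h (h⁻¹ y h) = y h` is differentiated on both sides, which avoids differentiating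
  -- the inverse of `h`.
  have e3 : (fun q => ContinuousLinearMap.mul ℝ 𝓐 ((h q : 𝓐ˣ) : 𝓐)
      ((incl 𝔤 ∘ fun q => Ad (h q)⁻¹ (y q)) q))
      = fun q => ContinuousLinearMap.mul ℝ 𝓐 ((incl 𝔤 ∘ y) q) ((h q : 𝓐ˣ) : 𝓐) := by
    ext1 q
    simp [coe_Ad, mul_assoc]
  rw [e3, e2] at e1
  have e4 := diff_clm (incl 𝔤) hW v
  have e5 := diff_clm (incl 𝔤) hy' v
  simp only [Function.comp_def] at e1
  rw [e4, e5, hη] at e1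
  simp only [incl_apply, ContinuousLinearMap.mul_apply', coe_Ad] at e1
  ext1
  rw [coe_Ad]
  simp only [AddSubgroupClass.coe_sub, coe_lie, Subgroup.coe_inv, inv_inv] at e1 ⊢
  simp only [mul_assoc, Units.mul_inv_cancel_left] at e1
  have e6 := congrArg (fun z => (((h p : 𝓐ˣ)⁻¹ : 𝓐ˣ) : 𝓐) * z) e1
  simp only [mul_add, Units.inv_mul_cancel_left] at e6
  rw [← sub_eq_iff_eq_add] at e6
  refine Eq.trans e6.symm ?_
  noncomm_ring

theorem diff_Ad (hh : ContMDiffAt J 𝓘(ℝ, 𝓐) 1 (fun q => ((h q : 𝓐ˣ) : 𝓐)) p)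
    (hy : ContMDiffAt J 𝓘(ℝ, 𝔤) 1 y p)
    (hη : diff J (fun q => ((h q : 𝓐ˣ) : 𝓐)) p v = (η : 𝓐) * ((h p : 𝓐ˣ) : 𝓐)) :
    diff J (fun q => Ad (h q) (y q)) p v = Ad (h p) (diff J y p v) + ⁅η, Ad (h p) (y p)⁆ := by
  have := diff_Ad_inv hh (contMDiffAt_Ad hh hy) hη
  simp only [Ad_inv_Ad] at this
  rw [this, Ad_Ad_inv, sub_add_cancel]

theorem diff_twist {r : 𝔤 →ₗ[ℂ] 𝔤}
    (hh : ContMDiffAt J 𝓘(ℝ, 𝓐) 1 (fun q => ((h q : 𝓐ˣ) : 𝓐)) p)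
    (hy : ContMDiffAt J 𝓘(ℝ, 𝔤) 1 y p)
    (hη : diff J (fun q => ((h q : 𝓐ˣ) : 𝓐)) p v = (η : 𝓐) * ((h p : 𝓐ˣ) : 𝓐)) :
    diff J (fun q => twist r (h q) (y q)) p v
      = twist r (h p) (diff J y p v - ⁅η, y p⁆) + ⁅η, twist r (h p) (y p)⁆ := by
  have h1 := contMDiffAt_Ad_inv hh hy
  have h2 : ContMDiffAt J 𝓘(ℝ, 𝔤) 1 (fun q => endL r (Ad (h q)⁻¹ (y q))) p :=
    (endL r).contMDiff.contMDiffAt.comp p h1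
  have h3 := diff_Ad hh h2 hη
  rw [diff_clm (endL r) (h1.mdifferentiableAt (by simp)), diff_Ad_inv hh hy hη] at h3
  exact h3

end Derivative

namespace IsSmoothDualMap

variable {r : 𝔤 →ₗ[ℂ] 𝔤} {f : P → Double 𝔤}

/-- Left multiplication of the tangency condition by `h` gives its right-translated form `dh h⁻¹ = R
dX`, the `η` required by `diff_Ad_inv` and its consequences. -/
theorem diff_grp (hf : IsSmoothDualMap J r f) (p : P) (v : TangentSpace J p) :
    diff J (fun q => (((f q).grp : 𝓐ˣ) : 𝓐)) p v
      = (twist r (f p).grp (diff J (fun q => (f q).vec) p v) : 𝔤) * (((f p).grp : 𝓐ˣ) : 𝓐) := by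
  have := congrArg (fun z => (((f p).grp : 𝓐ˣ) : 𝓐) * z) (hf.tangent p v)
  simp only [Units.mul_inv_cancel_left] at this
  rw [this, twist_apply, coe_Ad]
  simp [mul_assoc]

theorem contMDiffAt_vec (hf : IsSmoothDualMap J r f) {n : ℕ∞} (p : P) :
    ContMDiffAt J 𝓘(ℝ, 𝔤) n (fun q => (f q).vec) p :=
  (hf.smooth_vec p).of_le (by exact_mod_cast le_top)

theorem contMDiffAt_grp (hf : IsSmoothDualMap J r f) {n : ℕ∞} (p : P) :
    ContMDiffAt J 𝓘(ℝ, 𝓐) n (fun q => (((f q).grp : 𝓐ˣ) : 𝓐)) p :=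
  (hf.smooth_grp p).of_le (by exact_mod_cast le_top)

theorem comp {E₂ : Type*} [NormedAddCommGroup E₂] [NormedSpace ℝ E₂] {H₂ : Type*}
    [TopologicalSpace H₂] {J₂ : ModelWithCorners ℝ E₂ H₂} {P₂ : Type*} [TopologicalSpace P₂]
    [ChartedSpace H₂ P₂] (hf : IsSmoothDualMap J r f) {Φ : P₂ → P} (hΦ : ContMDiff J₂ J ∞ Φ) :
    IsSmoothDualMap J₂ r (fun q => f (Φ q)) where
  smooth_vec := hf.smooth_vec.comp hΦ
  smooth_grp := hf.smooth_grp.comp hΦ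
  mem q := hf.mem (Φ q)
  tangent q v := by
    have e1 : diff J₂ (fun q => (((f (Φ q)).grp : 𝓐ˣ) : 𝓐)) q v
        = diff J (fun q => (((f q).grp : 𝓐ˣ) : 𝓐)) (Φ q) (mfderiv J₂ J Φ q v) :=
      congrArg (fun T => T v) (mfderiv_comp q ((hf.smooth_grp.mdifferentiable (by simp)) (Φ q))
        (hΦ.mdifferentiable (by simp) q))
    have e2 : diff J₂ (fun q => (f (Φ q)).vec) q v
        = diff J (fun q => (f q).vec) (Φ q) (mfderiv J₂ J Φ q v) :=
      congrArg (fun T => T v) (mfderiv_comp q ((hf.smooth_vec.mdifferentiable (by simp)) (Φ q))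
        (hΦ.mdifferentiable (by simp) q))
    rw [e1, e2]
    exact hf.tangent (Φ q) _

/-- The maps to `G_r` for `r = 0`. -/
theorem of_vec {X : P → 𝔤} (hX : ContMDiff J 𝓘(ℝ, 𝔤) ∞ X) :
    IsSmoothDualMap J (0 : 𝔤 →ₗ[ℂ] 𝔤) (fun p => (⟨X p, 1⟩ : Double 𝔤)) where
  smooth_vec := hX
  smooth_grp := contMDiff_const
  mem p := by
    rw [← SetLike.mem_coe, dualGroup_zero]
    rfl
  tangent p v := by
    have : diff J (fun _ : P => (1 : 𝓐)) p v = 0 := by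
      rw [diff, mfderiv_const]; rfl
    simp [this]

end IsSmoothDualMap

end Manifold

/-! ### The two forms of the action -/

section Lagrangian

variable {tr : LinearMap.BilinForm ℂ 𝔤} {r : 𝔤 →ₗ[ℂ] 𝔤}

/-- Differentiating `Ad_h⁻¹ X` gives `Ad_h⁻¹ (dX - [η, X])` with `η = dh h⁻¹ = R dX`. -/
theorem rightForm_eq {f : M → Double 𝔤} (hf : IsSmoothDualMap I r f) (p : M)
    (v : TangentSpace I p) : rightForm f p v = diff I (fun q => (f q).vec) p v
      + ⁅(f p).vec, twist r (f p).grp (diff I (fun q => (f q).vec) p v)⁆ := by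
  have := diff_Ad_inv (hf.contMDiffAt_grp (n := 1) p) (hf.contMDiffAt_vec (n := 1) p)
    (hf.diff_grp p v)
  rw [rightForm, this, Ad_Ad_inv, ← lie_skew, sub_neg_eq_add]

/-- Both `ad x` and the twisted operator are antisymmetric for `tr`, so the adjoint of their
composite is the composite in the opposite order, with no sign. -/
theorem form_lie_twist (htr_inv : ∀ x y z : 𝔤, tr ⁅x, y⁆ z = tr x ⁅y, z⁆)
    (hr : IsTriangularRMatrix tr r) (g : linearGroup 𝔤) (x a b : 𝔤) :
    tr ⁅x, twist r g a⁆ b = tr a (twist r g ⁅x, b⁆) := by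
  rw [← lie_skew, map_neg, LinearMap.neg_apply, htr_inv, form_twist htr_inv hr, neg_neg]

variable (htr_symm : ∀ x y, tr x y = tr y x)
  (htr_inv : ∀ x y z : 𝔤, tr ⁅x, y⁆ z = tr x ⁅y, z⁆) (hr : IsTriangularRMatrix tr r)

/-- The Lagrangian of BF-theory. -/
def bfForm (tr : LinearMap.BilinForm ℂ 𝔤) (X : M → 𝔤) (A : OneForm 𝔤 I M) : TwoForm I M :=
  fun p v w => wedge tr (diff I X) (fun q u => A q u) p v w
    - (1 / 2) * wedge tr (fun q u => ⁅X q, A q u⁆) (fun q u => A q u) p v w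

/-- The two-form `tr (α ∧ R α)`. -/
def twistForm (tr : LinearMap.BilinForm ℂ 𝔤) (r : 𝔤 →ₗ[ℂ] 𝔤) (f : M → Double 𝔤)
    (α : ∀ p : M, TangentSpace I p → 𝔤) : TwoForm I M :=
  wedge tr α fun p v => twist r (f p).grp (α p v)

include htr_inv hr in
theorem psmLagrangian_eq_explicit {f : M → Double 𝔤} (hf : IsSmoothDualMap I r f)
    (A : OneForm 𝔤 I M) (p : M) (v w : TangentSpace I p) :
    psmLagrangian tr (rightForm f) (fun p => dualPoisson tr r (f p)) A p v w
      = wedge tr (diff I fun q => (f q).vec) (fun q u => A q u) p v w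
        + wedge tr (diff I fun q => (f q).vec)
          (fun q u => twist r (f q).grp ⁅(f q).vec, A q u⁆) p v w
        + (1 / 2) * wedge tr (fun q u => A q u) (fun q u => ⁅(f q).vec, A q u⁆) p v w
        - (1 / 2) * wedge tr (fun q u => ⁅(f q).vec, A q u⁆)
          (fun q u => twist r (f q).grp ⁅(f q).vec, A q u⁆) p v w := by
  simp only [psmLagrangian, wedge, dualPoisson, rightForm_eq hf, map_add, LinearMap.add_apply,
    form_lie_twist htr_inv hr]
  ring

-- Completion of the square: with `dX + [A, X] = dX - [X, A]`, antisymmetry of `R` makes the two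
-- mixed terms of `tr (C ∧ R C)` equal, and they account for `tr (dX ∧ R [X, A])`.
include htr_symm htr_inv hr in
theorem psmLagrangian_eq_bf {f : M → Double 𝔤} (hf : IsSmoothDualMap I r f)
    (A : OneForm 𝔤 I M) (p : M) (v w : TangentSpace I p) :
    psmLagrangian tr (rightForm f) (fun p => dualPoisson tr r (f p)) A p v w
      = bfForm tr (fun p => (f p).vec) A p v w
        + (-(1 / 2) * twistForm tr r f (covariantDiff (fun p => (f p).vec) A) p v w
        + (1 / 2) * twistForm tr r f (diff I fun p => (f p).vec) p v w) := by
  rw [psmLagrangian_eq_explicit htr_inv hr hf]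
  simp only [bfForm, twistForm, wedge, covariantDiff, map_add, LinearMap.add_apply]
  have h1 (u : TangentSpace I p) : ⁅A p u, (f p).vec⁆ = -⁅(f p).vec, A p u⁆ := (lie_skew _ _).symm
  simp only [h1, map_neg, LinearMap.neg_apply]
  have h2 (a b : 𝔤) : tr a (twist r (f p).grp b) = -tr b (twist r (f p).grp a) := by
    rw [htr_symm, form_twist htr_inv hr]
  rw [h2 ⁅(f p).vec, A p v⁆ (diff I (fun p => (f p).vec) p w),
    h2 ⁅(f p).vec, A p w⁆ (diff I (fun p => (f p).vec) p v),
    htr_symm (A p v) ⁅(f p).vec, A p w⁆, htr_symm (A p w) ⁅(f p).vec, A p v⁆]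
  ring

include htr_symm in
theorem psmLagrangian_zero (X : M → 𝔤) (A : OneForm 𝔤 I M) (p : M) (v w : TangentSpace I p) :
    psmLagrangian tr (rightForm fun p => (⟨X p, 1⟩ : Double 𝔤))
      (fun p => dualPoisson tr 0 (⟨X p, 1⟩ : Double 𝔤)) A p v w = bfForm tr X A p v w := by
  have e : (fun q => Ad (1 : linearGroup 𝔤)⁻¹ (X q)) = X := by
    ext1 q; rw [inv_one, Ad_one]
  have h0 (x : 𝔤) : twist (0 : 𝔤 →ₗ[ℂ] 𝔤) (1 : linearGroup 𝔤) x = 0 := by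
    rw [twist_apply, LinearMap.zero_apply, map_zero]
  simp only [psmLagrangian, rightForm, dualPoisson, bfForm, wedge, e, Ad_one, h0, map_zero,
    sub_zero]
  rw [htr_symm (A p v) ⁅X p, A p w⁆, htr_symm (A p w) ⁅X p, A p v⁆]
  ring

theorem dualAction_zero (htr_symm : ∀ x y, tr x y = tr y x) (𝒜 : OrientedAtlas I M) (X : M → 𝔤)
    (A : OneForm 𝔤 I M) (K : Set M) :
    dualAction tr 0 𝒜 K (fun p => ⟨X p, 1⟩) A = bfAction tr 𝒜 K X A :=
  congrArg (𝒜.integral K) (by ext p v w; exact psmLagrangian_zero htr_symm X A p v w)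

end Lagrangian

/-! ### Continuity of the Lagrangians -/

theorem continuousOn_group_inv {Y : Type*} [TopologicalSpace Y] {h : Y → linearGroup 𝔤}
    {S : Set Y} (hh : ContinuousOn (fun q => ((h q : 𝓐ˣ) : 𝓐)) S) :
    ContinuousOn (fun q => (((h q)⁻¹ : linearGroup 𝔤) : 𝓐ˣ).val) S := by
  have := FiniteDimensional.complete ℂ 𝓐
  have h1 : ContinuousOn (fun q => Ring.inverse ((h q : 𝓐ˣ) : 𝓐)) S := fun q hq =>
    ContinuousAt.comp_continuousWithinAt (g := Ring.inverse) (f := fun q => ((h q : 𝓐ˣ) : 𝓐))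
      (NormedRing.inverse_continuousAt (h q : 𝓐ˣ)) (hh q hq)
  simpa using h1

theorem continuousOn_Ad {Y : Type*} [TopologicalSpace Y] {h : Y → linearGroup 𝔤} {y : Y → 𝔤}
    {S : Set Y} (hh : ContinuousOn (fun q => ((h q : 𝓐ˣ) : 𝓐)) S) (hy : ContinuousOn y S) :
    ContinuousOn (fun q => Ad (h q) (y q)) S := by
  simp only [Ad_eq_proj]
  exact (proj 𝔤).continuous.comp_continuousOn ((hh.mul ((incl 𝔤).continuous.comp_continuousOn
    hy)).mul (continuousOn_group_inv hh))

theorem continuousOn_twist {Y : Type*} [TopologicalSpace Y] {r : 𝔤 →ₗ[ℂ] 𝔤}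
    {h : Y → linearGroup 𝔤} {y : Y → 𝔤} {S : Set Y}
    (hh : ContinuousOn (fun q => ((h q : 𝓐ˣ) : 𝓐)) S) (hy : ContinuousOn y S) :
    ContinuousOn (fun q => twist r (h q) (y q)) S :=
  continuousOn_Ad hh ((endL r).continuous.comp_continuousOn
    (continuousOn_Ad (continuousOn_group_inv hh) hy))

theorem continuousOn_form {Y : Type*} [TopologicalSpace Y] (tr : LinearMap.BilinForm ℂ 𝔤)
    {a b : Y → 𝔤} {S : Set Y} (ha : ContinuousOn a S) (hb : ContinuousOn b S) :
    ContinuousOn (fun q => tr (a q) (b q)) S :=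
  ((formL tr).continuous.comp_continuousOn ha).clm_apply hb

theorem continuousOn_lie {Y : Type*} [TopologicalSpace Y]
    {a b : Y → 𝔤} {S : Set Y} (ha : ContinuousOn a S) (hb : ContinuousOn b S) :
    ContinuousOn (fun q => ⁅a q, b q⁆) S :=
  ((lieL 𝔤).continuous.comp_continuousOn ha).clm_apply hb

namespace OrientedAtlas

variable (𝒜 : OrientedAtlas I M)

/-- The one-forms with values in `𝔤` whose coefficients in the charts are continuous. -/
def IsContinuousOneForm (α : ∀ p : M, TangentSpace I p → 𝔤) : Prop :=
  ∀ n (v : Plane), ContinuousOn (fun y => α ((𝒜.coord n).symm y) (𝒜.frame n y v))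
    (𝒜.coord n).target

variable {𝒜}

theorem IsContinuousOneForm.wedge {α β : ∀ p : M, TangentSpace I p → 𝔤}
    (tr : LinearMap.BilinForm ℂ 𝔤) (hα : 𝒜.IsContinuousOneForm α)
    (hβ : 𝒜.IsContinuousOneForm β) (K : Set M) : 𝒜.IsContinuous K (wedge tr α β) := fun n =>
  ((continuousOn_form tr (hα n e₁) (hβ n e₂)).sub (continuousOn_form tr (hα n e₂) (hβ n e₁))).mono inter_subset_left

theorem isContinuousOneForm_diff {X : M → 𝔤} (hX : ContMDiff I 𝓘(ℝ, 𝔤) ∞ X) :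
    𝒜.IsContinuousOneForm (diff I X) := fun n v => by
  have h1 := ((𝒜.contDiffOn_comp_coord_symm hX n).continuousOn_fderivWithin
    (𝒜.uniqueDiffOn_target n) (by simp)).clm_apply (continuousOn_const (c := v))
  refine h1.congr fun y hy => 𝒜.diff_frame n hy ?_ v
  exact hX.mdifferentiable (by simp) _

theorem IsSmooth.isContinuousOneForm {A : OneForm 𝔤 I M} (hA : 𝒜.IsSmooth A) :
    𝒜.IsContinuousOneForm (fun p v => A p v) := fun n _ =>
  (hA n).continuousOn.clm_apply continuousOn_const

theorem IsContinuousOneForm.lie_left {α : ∀ p : M, TangentSpace I p → 𝔤} {X : M → 𝔤}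
    (hX : Continuous X) (hα : 𝒜.IsContinuousOneForm α) :
    𝒜.IsContinuousOneForm fun p v => ⁅X p, α p v⁆ := fun n v =>
  continuousOn_lie (hX.comp_continuousOn (𝒜.continuousOn_coord_symm n)) (hα n v)

theorem IsContinuousOneForm.lie_right {α : ∀ p : M, TangentSpace I p → 𝔤} {X : M → 𝔤}
    (hX : Continuous X) (hα : 𝒜.IsContinuousOneForm α) :
    𝒜.IsContinuousOneForm fun p v => ⁅α p v, X p⁆ := fun n v =>
  continuousOn_lie (hα n v) (hX.comp_continuousOn (𝒜.continuousOn_coord_symm n))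

theorem isContinuousOneForm_covariantDiff {X : M → 𝔤} (hX : ContMDiff I 𝓘(ℝ, 𝔤) ∞ X)
    {A : OneForm 𝔤 I M} (hA : 𝒜.IsSmooth A) :
    𝒜.IsContinuousOneForm (covariantDiff X A) := fun n v =>
  (isContinuousOneForm_diff hX n v).add (hA.isContinuousOneForm.lie_right hX.continuous n v)

theorem IsContinuousOneForm.twist {α : ∀ p : M, TangentSpace I p → 𝔤} {r : 𝔤 →ₗ[ℂ] 𝔤}
    {f : M → Double 𝔤} (hf : IsSmoothDualMap I r f) (hα : 𝒜.IsContinuousOneForm α) :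
    𝒜.IsContinuousOneForm fun p v => DualTriangular.twist r (f p).grp (α p v) := fun n v =>
  continuousOn_twist (hf.smooth_grp.continuous.comp_continuousOn (𝒜.continuousOn_coord_symm n))
    (hα n v)

theorem isContinuous_bfForm [T2Space M] (tr : LinearMap.BilinForm ℂ 𝔤) {X : M → 𝔤}
    (hX : ContMDiff I 𝓘(ℝ, 𝔤) ∞ X) {A : OneForm 𝔤 I M} (hA : 𝒜.IsSmooth A) (K : Set M) :
    𝒜.IsContinuous K (bfForm tr X A) := by
  have h1 := (isContinuousOneForm_diff hX).wedge tr hA.isContinuousOneForm K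
  have h2 := ((hA.isContinuousOneForm.lie_left hX.continuous).wedge tr
    hA.isContinuousOneForm K).const_mul (-(1 / 2))
  have h3 := h1.add h2
  have e : bfForm tr X A = fun p v w => DualTriangular.wedge tr (diff I X) (fun q u => A q u) p v w
    + -(1 / 2) * DualTriangular.wedge tr (fun q u => ⁅X q, A q u⁆) (fun q u => A q u) p v w := by
    ext p v w
    rw [bfForm]
    ring
  rwa [e]

theorem IsContinuousOneForm.twistForm (tr : LinearMap.BilinForm ℂ 𝔤)
    {α : ∀ p : M, TangentSpace I p → 𝔤} {r : 𝔤 →ₗ[ℂ] 𝔤}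
    {f : M → Double 𝔤} (hf : IsSmoothDualMap I r f) (hα : 𝒜.IsContinuousOneForm α) (K : Set M) :
    𝒜.IsContinuous K (twistForm tr r f α) := hα.wedge tr (hα.twist hf) K

end OrientedAtlas

open OrientedAtlas in
theorem dualAction_eq [T2Space M] {tr : LinearMap.BilinForm ℂ 𝔤} {r : 𝔤 →ₗ[ℂ] 𝔤}
    (htr_symm : ∀ x y, tr x y = tr y x)
    (htr_inv : ∀ x y z : 𝔤, tr ⁅x, y⁆ z = tr x ⁅y, z⁆) (hr : IsTriangularRMatrix tr r)
    {𝒜 : OrientedAtlas I M} {f : M → Double 𝔤} (hf : IsSmoothDualMap I r f) {A : OneForm 𝔤 I M}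
    (hA : 𝒜.IsSmooth A) {K : Set M} (hK : IsCompact K) :
    dualAction tr r 𝒜 K f A = explicitAction tr r 𝒜 K f A ∧
      dualAction tr r 𝒜 K f A = bfAction tr 𝒜 K (fun p => (f p).vec) A
        - (1 / 2) * quadraticTerm tr r 𝒜 K f A + (1 / 2) * topologicalTerm tr r 𝒜 K f := by
  constructor
  · exact congrArg (𝒜.integral K) (by
      ext p v w; exact psmLagrangian_eq_explicit htr_inv hr hf A p v w)
  · have e : dualAction tr r 𝒜 K f A = 𝒜.integral K (fun p v w =>
        bfForm tr (fun p => (f p).vec) A p v w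
        + (-(1 / 2) * twistForm tr r f (covariantDiff (fun p => (f p).vec) A) p v w
        + (1 / 2) * twistForm tr r f (diff I fun p => (f p).vec) p v w)) :=
      congrArg (𝒜.integral K) (by
        ext p v w; exact psmLagrangian_eq_bf htr_symm htr_inv hr hf A p v w)
    have h1 := isContinuous_bfForm tr hf.smooth_vec hA K
    have h2 := ((isContinuousOneForm_covariantDiff hf.smooth_vec hA).twistForm tr hf K).const_mul
      (-(1 / 2))
    have h3 := ((isContinuousOneForm_diff (𝒜 := 𝒜) hf.smooth_vec).twistForm tr hf K).const_mul
      (1 / 2)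
    rw [e, integral_add hK h1 (h2.add h3), integral_add hK h2 h3,
      OrientedAtlas.integral_const_mul hK, OrientedAtlas.integral_const_mul hK]
    change 𝒜.integral K (bfForm tr _ A) + (_ * 𝒜.integral K _ + _ * 𝒜.integral K _)
      = 𝒜.integral K (bfForm tr _ A) - _ * 𝒜.integral K (twistForm tr r f _)
        + _ * 𝒜.integral K (twistForm tr r f _)
    ring

/-! ### Maps to the dual group on open subsets of a vector space -/

section Local

variable {E : Type*} [NormedAddCommGroup E] [NormedSpace ℝ E] {S : Set E}

/-- Smooth maps to `D`, on an open subset of a vector space, with derivative tangent to `G_r`. -/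
structure IsDualOn (r : 𝔤 →ₗ[ℂ] 𝔤) (S : Set E) (x : E → 𝔤) (h : E → linearGroup 𝔤) : Prop where
  isOpen : IsOpen S
  smooth_vec : ContDiffOn ℝ ∞ x S
  smooth_grp : ContDiffOn ℝ ∞ (fun q => ((h q : 𝓐ˣ) : 𝓐)) S
  tangent : ∀ q ∈ S, ∀ v, fderiv ℝ (fun q => ((h q : 𝓐ˣ) : 𝓐)) q v
    = (twist r (h q) (fderiv ℝ x q v) : 𝔤) * ((h q : 𝓐ˣ) : 𝓐)

theorem contDiffOn_fderiv_apply {V : Type*} [NormedAddCommGroup V] [NormedSpace ℝ V] {x : E → V}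
    (hS : IsOpen S) (hx : ContDiffOn ℝ ∞ x S) (v : E) :
    ContDiffOn ℝ ∞ (fun q => fderiv ℝ x q v) S :=
  (hx.fderiv_of_isOpen hS (by simp)).clm_apply contDiffOn_const

theorem fderiv_fderiv_symm {V : Type*} [NormedAddCommGroup V] [NormedSpace ℝ V] {x : E → V}
    (hS : IsOpen S) (hx : ContDiffOn ℝ ∞ x S) {q : E} (hq : q ∈ S) (v w : E) :
    fderiv ℝ (fun q => fderiv ℝ x q v) q w = fderiv ℝ (fun q => fderiv ℝ x q w) q v := by
  have h1 : DifferentiableAt ℝ (fderiv ℝ x) q :=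
    ((hx.fderiv_of_isOpen (m := 1) hS (by norm_cast)).differentiableOn (by simp)).differentiableAt
      (hS.mem_nhds hq)
  have h2 := ((hx.contDiffAt (hS.mem_nhds hq)).isSymmSndFDerivAt
    (by simpa using (mod_cast (le_top : (2 : ℕ∞) ≤ ⊤) : ((2 : ℕ∞) : ℕ∞ω) ≤ ∞))).eq w v
  rw [fderiv_clm_apply h1 (differentiableAt_const _), fderiv_clm_apply h1 (differentiableAt_const _)]
  simpa using h2

theorem fderiv_form (tr : LinearMap.BilinForm ℂ 𝔤) {a b : E → 𝔤} {q : E}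
    (ha : DifferentiableAt ℝ a q) (hb : DifferentiableAt ℝ b q) (v : E) :
    fderiv ℝ (fun q => tr (a q) (b q)) q v
      = tr (fderiv ℝ a q v) (b q) + tr (a q) (fderiv ℝ b q v) := by
  have := (formL tr).hasFDerivAt_of_bilinear ha.hasFDerivAt hb.hasFDerivAt
  have e : (fun q => tr (a q) (b q)) = fun q => formL tr (a q) (b q) := rfl
  rw [e, this.fderiv, add_comm]
  rfl

theorem fderiv_lie {a b : E → 𝔤} {q : E}
    (ha : DifferentiableAt ℝ a q) (hb : DifferentiableAt ℝ b q) (v : E) :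
    fderiv ℝ (fun q => ⁅a q, b q⁆) q v = ⁅fderiv ℝ a q v, b q⁆ + ⁅a q, fderiv ℝ b q v⁆ := by
  have := (lieL 𝔤).hasFDerivAt_of_bilinear ha.hasFDerivAt hb.hasFDerivAt
  have e : (fun q => ⁅a q, b q⁆) = fun q => lieL 𝔤 (a q) (b q) := rfl
  rw [e, this.fderiv, add_comm]
  rfl

theorem contDiffOn_form (tr : LinearMap.BilinForm ℂ 𝔤) {n : ℕ∞ω} {a b : E → 𝔤}
    (ha : ContDiffOn ℝ n a S) (hb : ContDiffOn ℝ n b S) :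
    ContDiffOn ℝ n (fun q => tr (a q) (b q)) S :=
  ((formL tr).contDiff.comp_contDiffOn ha).clm_apply hb

theorem contDiffOn_lie {n : ℕ∞ω} {a b : E → 𝔤}
    (ha : ContDiffOn ℝ n a S) (hb : ContDiffOn ℝ n b S) :
    ContDiffOn ℝ n (fun q => ⁅a q, b q⁆) S :=
  ((lieL 𝔤).contDiff.comp_contDiffOn ha).clm_apply hb

theorem contDiffOn_twist (r : 𝔤 →ₗ[ℂ] 𝔤) (hS : IsOpen S) {n : ℕ∞ω} {h : E → linearGroup 𝔤}
    {y : E → 𝔤} (hh : ContDiffOn ℝ n (fun q => ((h q : 𝓐ˣ) : 𝓐)) S) (hy : ContDiffOn ℝ n y S) :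
    ContDiffOn ℝ n (fun q => twist r (h q) (y q)) S := fun _ hq =>
  (contMDiffAt_twist (J := 𝓘(ℝ, E)) (hh.contDiffAt (hS.mem_nhds hq)).contMDiffAt
    (hy.contDiffAt (hS.mem_nhds hq)).contMDiffAt).contDiffAt.contDiffWithinAt

theorem IsDualOn.fderiv_twist {r : 𝔤 →ₗ[ℂ] 𝔤} {x : E → 𝔤} {h : E → linearGroup 𝔤}
    (hd : IsDualOn r S x h) {y : E → 𝔤} (hy : ContDiffOn ℝ ∞ y S) {q : E} (hq : q ∈ S) (v : E) :
    fderiv ℝ (fun q => twist r (h q) (y q)) q v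
      = twist r (h q) (fderiv ℝ y q v - ⁅twist r (h q) (fderiv ℝ x q v), y q⁆)
        + ⁅twist r (h q) (fderiv ℝ x q v), twist r (h q) (y q)⁆ := by
  have h1 : ContMDiffAt 𝓘(ℝ, E) 𝓘(ℝ, 𝓐) 1 (fun q => ((h q : 𝓐ˣ) : 𝓐)) q :=
    ((hd.smooth_grp.contDiffAt (hd.isOpen.mem_nhds hq)).of_le (by simp)).contMDiffAt
  have h2 : ContMDiffAt 𝓘(ℝ, E) 𝓘(ℝ, 𝔤) 1 y q :=
    ((hy.contDiffAt (hd.isOpen.mem_nhds hq)).of_le (by simp)).contMDiffAt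
  have h3 : diff 𝓘(ℝ, E) (fun q => ((h q : 𝓐ˣ) : 𝓐)) q v
      = (twist r (h q) (fderiv ℝ x q v) : 𝔤) * ((h q : 𝓐ˣ) : 𝓐) := by
    have := hd.tangent q hq v
    rw [← mfderiv_eq_fderiv, ← mfderiv_eq_fderiv] at this
    rw [← mfderiv_eq_fderiv]
    exact this
  have := diff_twist (r := r) h1 h2 h3
  simp only [diff, mfderiv_eq_fderiv] at this
  exact this

/-- `Ad g` is a Lie algebra automorphism, so conjugating a solution of the Yang–Baxter equation by
it gives a solution. -/
theorem twist_yangBaxter {tr : LinearMap.BilinForm ℂ 𝔤} {r : 𝔤 →ₗ[ℂ] 𝔤}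
    (hr : IsTriangularRMatrix tr r) (g : linearGroup 𝔤) (x y : 𝔤) :
    ⁅twist r g x, twist r g y⁆ = twist r g (⁅twist r g x, y⁆ + ⁅x, twist r g y⁆) := by
  have h := sub_eq_zero.1 (hr.yangBaxter (Ad g⁻¹ x) (Ad g⁻¹ y))
  simp only [twist_apply, map_add, Ad_lie, Ad_inv_Ad]
  rw [← Ad_lie, ← h, map_add]

/-- The two-form `tr (dX ∧ Ad_h r Ad_h⁻¹ dX)` is closed. -/
theorem IsDualOn.closed {tr : LinearMap.BilinForm ℂ 𝔤} {r : 𝔤 →ₗ[ℂ] 𝔤}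
    (htr_symm : ∀ x y, tr x y = tr y x)
    (htr_inv : ∀ x y z : 𝔤, tr ⁅x, y⁆ z = tr x ⁅y, z⁆) (hr : IsTriangularRMatrix tr r)
    {x : E → 𝔤} {h : E → linearGroup 𝔤} (hd : IsDualOn r S x h) {q : E} (hq : q ∈ S) (i j k : E) :
    fderiv ℝ (fun q => tr (fderiv ℝ x q i) (twist r (h q) (fderiv ℝ x q j))) q k
      + fderiv ℝ (fun q => tr (fderiv ℝ x q j) (twist r (h q) (fderiv ℝ x q k))) q i
      + fderiv ℝ (fun q => tr (fderiv ℝ x q k) (twist r (h q) (fderiv ℝ x q i))) q j = 0 := by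
  have hs (v : E) := contDiffOn_fderiv_apply hd.isOpen hd.smooth_vec v
  have hsd (v : E) : DifferentiableAt ℝ (fun q => fderiv ℝ x q v) q :=
    ((hs v).differentiableOn (by simp)).differentiableAt (hd.isOpen.mem_nhds hq)
  have htd (v : E) : DifferentiableAt ℝ (fun q => twist r (h q) (fderiv ℝ x q v)) q :=
    ((contDiffOn_twist r hd.isOpen hd.smooth_grp (hs v)).differentiableOn (by simp)).differentiableAt
      (hd.isOpen.mem_nhds hq)
  rw [fderiv_form tr (hsd _) (htd _), fderiv_form tr (hsd _) (htd _),
    fderiv_form tr (hsd _) (htd _), hd.fderiv_twist (hs _) hq, hd.fderiv_twist (hs _) hq,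
    hd.fderiv_twist (hs _) hq, fderiv_fderiv_symm hd.isOpen hd.smooth_vec hq j i,
    fderiv_fderiv_symm hd.isOpen hd.smooth_vec hq k i,
    fderiv_fderiv_symm hd.isOpen hd.smooth_vec hq k j]
  generalize fderiv ℝ (fun q => fderiv ℝ x q i) q j = xij
  generalize fderiv ℝ (fun q => fderiv ℝ x q i) q k = xik
  generalize fderiv ℝ (fun q => fderiv ℝ x q j) q k = xjk
  generalize fderiv ℝ x q i = xi
  generalize fderiv ℝ x q j = xj
  generalize fderiv ℝ x q k = xk
  have hR (a b : 𝔤) : tr a (twist r (h q) b) = -tr (twist r (h q) a) b := by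
    rw [form_twist htr_inv hr, neg_neg]
  have hcyc (a b c : 𝔤) : tr a ⁅b, c⁆ = tr b ⁅c, a⁆ := by
    rw [← htr_inv, htr_symm, ← htr_inv, htr_symm]
  set Ri := twist r (h q) xi with hi
  set Rj := twist r (h q) xj with hj
  set Rk := twist r (h q) xk with hk
  -- In the cyclic sum the second derivatives of `x` cancel by antisymmetry of `R`, and the
  -- derivatives of `R` leave twice this expression. It vanishes by the Yang–Baxter equation for
  -- `R`, after moving `R` across `tr` and using cyclic invariance.
  have hT : tr xi ⁅Rk, Rj⁆ + tr xj ⁅Ri, Rk⁆ + tr xk ⁅Rj, Ri⁆ = 0 := by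
    have h1 : tr xi ⁅Rk, Rj⁆ = -(tr Ri ⁅Rk, xj⁆ + tr Ri ⁅xk, Rj⁆) := by
      rw [hk, hj, twist_yangBaxter hr, hR, map_add]
    rw [h1, hcyc Ri Rk xj, hcyc Rk xj, hcyc Ri xk]
    ring
  simp only [map_add, map_sub]
  rw [hR xi xjk, hR xi, hR xj xik, hR xj, hR xk xij, hR xk, ← hi, ← hj, ← hk]
  have c1 : tr Ri ⁅Rk, xj⁆ = tr xj ⁅Ri, Rk⁆ := by rw [hcyc Ri, hcyc Rk]
  have c2 : tr Rj ⁅Ri, xk⁆ = tr xk ⁅Rj, Ri⁆ := by rw [hcyc Rj, hcyc Ri]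
  have c3 : tr Rk ⁅Rj, xi⁆ = tr xi ⁅Rk, Rj⁆ := by rw [hcyc Rk, hcyc Rj]
  rw [c1, c2, c3, htr_symm xik, htr_symm xij, htr_symm xjk]
  linear_combination 2 * hT

end Local

/-! ### Families of fields in charts -/

section Slices

variable {V : Type*} [NormedAddCommGroup V] [NormedSpace ℝ V] {G : ℝ × Plane → V} {t : ℝ} {y : Plane}

theorem fderiv_slice (hG : DifferentiableAt ℝ G (t, y)) (v : Plane) :
    fderiv ℝ (fun z => G (t, z)) y v = fderiv ℝ G (t, y) (0, v) := by
  have h : HasFDerivAt (fun z : Plane => (t, z)) (ContinuousLinearMap.inr ℝ ℝ Plane) y :=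
    hasFDerivAt_prodMk_right t y
  have h2 : HasFDerivAt (fun z : Plane => G (t, z)) _ y := hG.hasFDerivAt.comp y h
  rw [h2.fderiv]
  rfl

theorem deriv_slice (hG : DifferentiableAt ℝ G (t, y)) :
    deriv (fun s => G (s, y)) t = fderiv ℝ G (t, y) (1, 0) := by
  have hc : HasDerivAt (fun s : ℝ => (s, y)) ((1 : ℝ), (0 : Plane)) t :=
    (hasDerivAt_id t).prodMk (hasDerivAt_const t y)
  exact (hG.hasFDerivAt.comp_hasDerivAt t hc).deriv

theorem contDiffOn_slice {n : ℕ∞ω} {U : Set Plane} (hG : ContDiffOn ℝ n G (univ ×ˢ U)) (t : ℝ) :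
    ContDiffOn ℝ n (fun z => G (t, z)) U :=
  hG.comp (contDiff_prodMk_right t).contDiffOn fun _ hy => ⟨trivial, hy⟩

end Slices

theorem curl_eq {a : Plane → Plane →L[ℝ] ℂ} {y : Plane} (ha : DifferentiableAt ℝ a y) :
    curl a y = fderiv ℝ (fun z => a z e₂) y e₁ - fderiv ℝ (fun z => a z e₁) y e₂ := by
  rw [curl, fderiv_clm_apply ha (differentiableAt_const _),
    fderiv_clm_apply ha (differentiableAt_const _)]
  simp

namespace OrientedAtlas

variable (𝒜 : OrientedAtlas I M)

/-- The part of `ℝ × Plane` over the interior of the target of a chart. -/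
abbrev cyl (n : ℕ) : Set (ℝ × Plane) := univ ×ˢ interior (𝒜.coord n).target

theorem isOpen_cyl (n : ℕ) : IsOpen (𝒜.cyl n) := isOpen_univ.prod isOpen_interior

/-- A family of functions read in a chart. -/
def famCoord {V : Type*} (n : ℕ) (Y : ℝ → M → V) (q : ℝ × Plane) : V := Y q.1 ((𝒜.coord n).symm q.2)

theorem contMDiffOn_cyl (n : ℕ) :
    ContMDiffOn 𝓘(ℝ, ℝ × Plane) (𝓘(ℝ, ℝ).prod I) ∞
      (fun q : ℝ × Plane => (q.1, (𝒜.coord n).symm q.2)) (𝒜.cyl n) := by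
  have h1 : ContMDiffOn 𝓘(ℝ, ℝ × Plane) 𝓘(ℝ, Plane) ∞ (fun q : ℝ × Plane => q.2) (𝒜.cyl n) :=
    contDiff_snd.contMDiff.contMDiffOn
  have h2 : ContMDiffOn 𝓘(ℝ, ℝ × Plane) 𝓘(ℝ, ℝ) ∞ (fun q : ℝ × Plane => q.1) (𝒜.cyl n) :=
    contDiff_fst.contMDiff.contMDiffOn
  exact h2.prodMk ((𝒜.contMDiffOn_coord_symm n).comp h1 fun q hq => (interior_subset hq.2 : q.2 ∈ _))

variable {V : Type*} [NormedAddCommGroup V] [NormedSpace ℝ V] {𝒜}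

theorem contDiffOn_famCoord {Y : ℝ → M → V}
    (hY : ContMDiff (𝓘(ℝ, ℝ).prod I) 𝓘(ℝ, V) ∞ (fun q : ℝ × M => Y q.1 q.2)) (n : ℕ) :
    ContDiffOn ℝ ∞ (𝒜.famCoord n Y) (𝒜.cyl n) :=
  (hY.comp_contMDiffOn (𝒜.contMDiffOn_cyl n)).contDiffOn

theorem differentiableAt_of_cyl {W : Type*} [NormedAddCommGroup W] [NormedSpace ℝ W] {n : ℕ}
    {G : ℝ × Plane → W} (hG : ContDiffOn ℝ ∞ G (𝒜.cyl n)) {t : ℝ} {y : Plane}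
    (hy : y ∈ interior (𝒜.coord n).target) : DifferentiableAt ℝ G (t, y) :=
  (hG.differentiableOn (by simp)).differentiableAt ((𝒜.isOpen_cyl n).mem_nhds ⟨trivial, hy⟩)

theorem contMDiff_slice {E' : Type*} [NormedAddCommGroup E'] [NormedSpace ℝ E'] {H' : Type*}
    [TopologicalSpace H'] {J : ModelWithCorners ℝ E' H'} {P : Type*} [TopologicalSpace P]
    [ChartedSpace H' P] {Y : ℝ → M → P}
    (hY : ContMDiff (𝓘(ℝ, ℝ).prod I) J ∞ (fun q : ℝ × M => Y q.1 q.2)) (t : ℝ) :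
    ContMDiff I J ∞ (Y t) :=
  hY.comp (contMDiff_const.prodMk contMDiff_id)

theorem diff_frame_family {Y : ℝ → M → V}
    (hY : ContMDiff (𝓘(ℝ, ℝ).prod I) 𝓘(ℝ, V) ∞ (fun q : ℝ × M => Y q.1 q.2)) {n : ℕ} (t : ℝ)
    {y : Plane} (hy : y ∈ interior (𝒜.coord n).target) (v : Plane) :
    diff I (Y t) ((𝒜.coord n).symm y) (𝒜.frame n y v)
      = fderiv ℝ (𝒜.famCoord n Y) (t, y) (0, v) := by
  rw [𝒜.diff_frame_of_mem_interior n hy ((contMDiff_slice hY t).mdifferentiable (by simp) _),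
    ← fderiv_slice (differentiableAt_of_cyl (contDiffOn_famCoord hY n) hy)]
  rfl

theorem deriv_family {Y : ℝ → M → V}
    (hY : ContMDiff (𝓘(ℝ, ℝ).prod I) 𝓘(ℝ, V) ∞ (fun q : ℝ × M => Y q.1 q.2)) {n : ℕ} (t : ℝ)
    {y : Plane} (hy : y ∈ interior (𝒜.coord n).target) :
    deriv (fun s => Y s ((𝒜.coord n).symm y)) t = fderiv ℝ (𝒜.famCoord n Y) (t, y) (1, 0) :=
  deriv_slice (G := 𝒜.famCoord n Y) (differentiableAt_of_cyl (contDiffOn_famCoord hY n) hy)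

theorem isDualOn_of_family {r : 𝔤 →ₗ[ℂ] 𝔤} {F : ℝ → M → Double 𝔤}
    (hF : IsSmoothDualMap (𝓘(ℝ, ℝ).prod I) r (fun q : ℝ × M => F q.1 q.2)) (n : ℕ) :
    IsDualOn r (𝒜.cyl n) (𝒜.famCoord n fun t p => (F t p).vec)
      (𝒜.famCoord n fun t p => (F t p).grp) where
  isOpen := 𝒜.isOpen_cyl n
  smooth_vec := contDiffOn_famCoord hF.smooth_vec n
  smooth_grp := contDiffOn_famCoord (Y := fun t p => (((F t p).grp : 𝓐ˣ) : 𝓐)) hF.smooth_grp n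
  tangent q hq v := by
    have hΦ := ((𝒜.contMDiffOn_cyl n).contMDiffAt ((𝒜.isOpen_cyl n).mem_nhds hq)).mdifferentiableAt
      (by simp)
    have key {W : Type _} [NormedAddCommGroup W] [NormedSpace ℝ W] (g : ℝ × M → W)
        (hg : ContMDiff (𝓘(ℝ, ℝ).prod I) 𝓘(ℝ, W) ∞ g) :
        fderiv ℝ (fun q : ℝ × Plane => g (q.1, (𝒜.coord n).symm q.2)) q v
          = diff (𝓘(ℝ, ℝ).prod I) g (q.1, (𝒜.coord n).symm q.2)
            (mfderiv 𝓘(ℝ, ℝ × Plane) (𝓘(ℝ, ℝ).prod I)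
              (fun q : ℝ × Plane => (q.1, (𝒜.coord n).symm q.2)) q v) := by
      rw [← mfderiv_eq_fderiv]
      exact congrArg (fun T => T v) (mfderiv_comp q (hg.mdifferentiable (by simp) _) hΦ)
    have e1 := key _ hF.smooth_grp
    have e2 := key _ hF.smooth_vec
    have e3 := hF.diff_grp (q.1, (𝒜.coord n).symm q.2) (mfderiv 𝓘(ℝ, ℝ × Plane) (𝓘(ℝ, ℝ).prod I)
              (fun q : ℝ × Plane => (q.1, (𝒜.coord n).symm q.2)) q v)
    rw [← e1, ← e2] at e3
    exact e3

variable (𝒜) in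
/-- Families of one-forms with values in `𝔤` which are smooth over the interior. -/
def IsSmoothFam (α : ℝ → ∀ p : M, TangentSpace I p → 𝔤) : Prop :=
  ∀ n (v : Plane), ContDiffOn ℝ ∞
    (fun q : ℝ × Plane => α q.1 ((𝒜.coord n).symm q.2) (𝒜.frame n q.2 v)) (𝒜.cyl n)

theorem isSmoothFam_diff {Y : ℝ → M → 𝔤}
    (hY : ContMDiff (𝓘(ℝ, ℝ).prod I) 𝓘(ℝ, 𝔤) ∞ (fun q : ℝ × M => Y q.1 q.2)) :
    𝒜.IsSmoothFam fun t => diff I (Y t) := fun n v =>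
  (contDiffOn_fderiv_apply (𝒜.isOpen_cyl n) (contDiffOn_famCoord hY n) (0, v)).congr
    fun q hq => diff_frame_family hY q.1 hq.2 v

theorem IsSmoothFamily.isSmoothFam {B : ℝ → OneForm 𝔤 I M} (hB : 𝒜.IsSmoothFamily B) :
    𝒜.IsSmoothFam fun t p v => B t p v := fun n _ =>
  ((hB n).mono (prod_mono_right interior_subset)).clm_apply contDiffOn_const

theorem IsSmoothFamily.isSmooth {B : ℝ → OneForm 𝔤 I M} (hB : 𝒜.IsSmoothFamily B) (t : ℝ) :
    𝒜.IsSmooth (B t) := fun n => contDiffOn_slice (hB n) t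

theorem IsSmoothFam.lie_left {α : ℝ → ∀ p : M, TangentSpace I p → 𝔤} (hα : 𝒜.IsSmoothFam α)
    {Y : ℝ → M → 𝔤}
    (hY : ContMDiff (𝓘(ℝ, ℝ).prod I) 𝓘(ℝ, 𝔤) ∞ (fun q : ℝ × M => Y q.1 q.2)) :
    𝒜.IsSmoothFam fun t p v => ⁅Y t p, α t p v⁆ := fun n v =>
  contDiffOn_lie (contDiffOn_famCoord hY n) (hα n v)

theorem IsSmoothFam.lie_right {α : ℝ → ∀ p : M, TangentSpace I p → 𝔤} (hα : 𝒜.IsSmoothFam α)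
    {Y : ℝ → M → 𝔤}
    (hY : ContMDiff (𝓘(ℝ, ℝ).prod I) 𝓘(ℝ, 𝔤) ∞ (fun q : ℝ × M => Y q.1 q.2)) :
    𝒜.IsSmoothFam fun t p v => ⁅α t p v, Y t p⁆ := fun n v =>
  contDiffOn_lie (hα n v) (contDiffOn_famCoord hY n)

theorem isSmoothFam_covariantDiff {Y : ℝ → M → 𝔤}
    (hY : ContMDiff (𝓘(ℝ, ℝ).prod I) 𝓘(ℝ, 𝔤) ∞ (fun q : ℝ × M => Y q.1 q.2))
    {B : ℝ → OneForm 𝔤 I M} (hB : 𝒜.IsSmoothFamily B) :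
    𝒜.IsSmoothFam fun t => covariantDiff (Y t) (B t) := fun n v =>
  (isSmoothFam_diff hY n v).add (hB.isSmoothFam.lie_right hY n v)

theorem IsSmoothFam.twist {α : ℝ → ∀ p : M, TangentSpace I p → 𝔤} (hα : 𝒜.IsSmoothFam α)
    {r : 𝔤 →ₗ[ℂ] 𝔤} {F : ℝ → M → Double 𝔤}
    (hF : IsSmoothDualMap (𝓘(ℝ, ℝ).prod I) r (fun q : ℝ × M => F q.1 q.2)) :
    𝒜.IsSmoothFam fun t p v => DualTriangular.twist r (F t p).grp (α t p v) := fun n v =>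
  contDiffOn_twist r (𝒜.isOpen_cyl n) (isDualOn_of_family hF n).smooth_grp (hα n v)

theorem IsSmoothFam.contDiffOn_wedge {α β : ℝ → ∀ p : M, TangentSpace I p → 𝔤}
    (hα : 𝒜.IsSmoothFam α) (hβ : 𝒜.IsSmoothFam β) (tr : LinearMap.BilinForm ℂ 𝔤) (n : ℕ) :
    ContDiffOn ℝ ∞ (fun q : ℝ × Plane => 𝒜.density n (wedge tr (α q.1) (β q.1)) q.2) (𝒜.cyl n) :=
  (contDiffOn_form tr (hα n e₁) (hβ n e₂)).sub (contDiffOn_form tr (hα n e₂) (hβ n e₁))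

theorem isC1Family_bfForm (tr : LinearMap.BilinForm ℂ 𝔤) {Y : ℝ → M → 𝔤}
    (hY : ContMDiff (𝓘(ℝ, ℝ).prod I) 𝓘(ℝ, 𝔤) ∞ (fun q : ℝ × M => Y q.1 q.2))
    {B : ℝ → OneForm 𝔤 I M} (hB : 𝒜.IsSmoothFamily B) :
    𝒜.IsC1Family fun t => bfForm tr (Y t) (B t) := fun n =>
  (((isSmoothFam_diff hY).contDiffOn_wedge hB.isSmoothFam tr n).sub
    (contDiffOn_const.mul ((hB.isSmoothFam.lie_left hY).contDiffOn_wedge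
      hB.isSmoothFam tr n))).of_le (by simp)

theorem IsSmoothFam.isC1Family_twistForm {α : ℝ → ∀ p : M, TangentSpace I p → 𝔤}
    (hα : 𝒜.IsSmoothFam α) (tr : LinearMap.BilinForm ℂ 𝔤) {r : 𝔤 →ₗ[ℂ] 𝔤} {F : ℝ → M → Double 𝔤}
    (hF : IsSmoothDualMap (𝓘(ℝ, ℝ).prod I) r (fun q : ℝ × M => F q.1 q.2)) :
    𝒜.IsC1Family fun t => twistForm tr r (F t) (α t) := fun n =>
  (hα.contDiffOn_wedge (hα.twist hF) tr n).of_le (by simp)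

end OrientedAtlas

/-! ### The forms are alternating -/

theorem IsLinearForm.wedge {α β : ∀ p : M, TangentSpace I p → 𝔤} (tr : LinearMap.BilinForm ℂ 𝔤)
    (hα : IsLinearForm α) (hβ : IsLinearForm β) : IsAlternating (wedge tr α β) := by
  have hs (c : ℝ) (x y : 𝔤) : tr (c • x) y = c * tr x y := by
    rw [← formL_apply, map_smul, smul_apply, Complex.real_smul, formL_apply]
  have hs' (c : ℝ) (x y : 𝔤) : tr x (c • y) = c * tr x y := by
    rw [← formL_apply, map_smul, Complex.real_smul, formL_apply]
  refine isAlternating_of_bilinear (fun p v w => tr (α p v) (β p w)) (fun p u v w a b => ?_)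
    (fun p u v w a b => ?_) fun p v w => rfl
  · rw [hα p, map_add, LinearMap.add_apply, hs, hs]
  · rw [hβ p, map_add, hs', hs']

theorem isLinearForm_oneForm (A : OneForm 𝔤 I M) : IsLinearForm fun p v => A p v :=
  fun p v w a b => by simp only [map_add, map_smul]

theorem IsLinearForm.lie_left {α : ∀ p : M, TangentSpace I p → 𝔤} (hα : IsLinearForm α)
    (X : M → 𝔤) : IsLinearForm fun p v => ⁅X p, α p v⁆ := fun p v w a b => by
  simp only [hα p, lie_add, real_lie_smul]

theorem IsLinearForm.lie_right {α : ∀ p : M, TangentSpace I p → 𝔤} (hα : IsLinearForm α)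
    (X : M → 𝔤) : IsLinearForm fun p v => ⁅α p v, X p⁆ := fun p v w a b => by
  simp only [hα p, add_lie, real_smul_lie]

theorem IsLinearForm.twist {α : ∀ p : M, TangentSpace I p → 𝔤} (hα : IsLinearForm α)
    (r : 𝔤 →ₗ[ℂ] 𝔤) (f : M → Double 𝔤) :
    IsLinearForm fun p v => DualTriangular.twist r (f p).grp (α p v) := fun p v w a b => by
  simp only [hα p, map_add, map_real_smul]

theorem isLinearForm_covariantDiff (X : M → 𝔤) (A : OneForm 𝔤 I M) :
    IsLinearForm (covariantDiff X A) := fun p v w a b => by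
  simp only [covariantDiff, isLinearForm_diff X p, (isLinearForm_oneForm A).lie_right X p, smul_add]
  abel

theorem IsLinearForm.twistForm {α : ∀ p : M, TangentSpace I p → 𝔤} (hα : IsLinearForm α)
    (tr : LinearMap.BilinForm ℂ 𝔤) (r : 𝔤 →ₗ[ℂ] 𝔤) (f : M → Double 𝔤) :
    IsAlternating (twistForm tr r f α) := hα.wedge tr (hα.twist r f)

theorem isAlternating_bfForm (tr : LinearMap.BilinForm ℂ 𝔤) (X : M → 𝔤) (A : OneForm 𝔤 I M) :
    IsAlternating (bfForm tr X A) := by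
  have h1 := (isLinearForm_diff (I := I) X).wedge tr (isLinearForm_oneForm A)
  have h2 := (((isLinearForm_oneForm A).lie_left X).wedge tr (isLinearForm_oneForm A)).mul_left
    fun _ => -(1 / 2)
  intro p v w a b c d
  have h3 := (h1.add h2) p v w a b c d
  have e (v w : TangentSpace I p) : bfForm tr X A p v w
      = wedge tr (diff I X) (fun q u => A q u) p v w
        + -(1 / 2) * wedge tr (fun q u => ⁅X q, A q u⁆) (fun q u => A q u) p v w := by
    rw [bfForm]
    ring
  rw [e, e]
  exact h3

/-! ### The topological term -/

-- Closedness on the product of the time axis with the surface turns the time derivative of `tr (dX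
-- ∧ R dX)` into the exterior derivative, along the surface, of its contraction with `∂ₜ`. That
-- contraction vanishes outside `K`, where the fields are constant in time.
open OrientedAtlas in
theorem integral_derivForm_twistForm_diff [T2Space M] [IsManifold I ∞ M]
    {tr : LinearMap.BilinForm ℂ 𝔤} {r : 𝔤 →ₗ[ℂ] 𝔤} (htr_symm : ∀ x y, tr x y = tr y x)
    (htr_inv : ∀ x y z : 𝔤, tr ⁅x, y⁆ z = tr x ⁅y, z⁆) (hr : IsTriangularRMatrix tr r)
    {𝒜 : OrientedAtlas I M} {K : Set M} (hK : IsCompact K) (hKi : K ⊆ I.interior M)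
    {F : ℝ → M → Double 𝔤}
    (hF : IsSmoothDualMap (𝓘(ℝ, ℝ).prod I) r (fun q : ℝ × M => F q.1 q.2))
    (hF0 : ∀ t, ∀ p ∉ K, F t p = F 0 p) (t : ℝ) :
    𝒜.integral K (derivForm (fun t => twistForm tr r (F t) (diff I fun p => (F t p).vec)) t)
      = 0 := by
  let Y : ℝ → M → 𝔤 := fun t p => (F t p).vec
  have hY : ContMDiff (𝓘(ℝ, ℝ).prod I) 𝓘(ℝ, 𝔤) ∞ (fun q : ℝ × M => Y q.1 q.2) := hF.smooth_vec
  have hL : 𝒜.IsC1Family fun t => twistForm tr r (F t) (diff I (Y t)) :=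
    (isSmoothFam_diff hY).isC1Family_twistForm tr hF
  -- The contraction of `tr (dX ∧ R dX)` with `∂ₜ`. The factor `2` appears because, by antisymmetry
  -- of `R`, the two terms of the wedge product are equal.
  let α : ∀ p : M, TangentSpace I p →L[ℝ] ℂ := fun p =>
    (2 : ℝ) • ((formL tr (deriv (fun s => Y s p) t)).comp ((endL (twist r (F t p).grp)).comp
      (mfderiv I 𝓘(ℝ, 𝔤) (Y t) p : TangentSpace I p →L[ℝ] 𝔤)))
  have hα (p : M) (v : TangentSpace I p) : α p v
      = 2 * tr (deriv (fun s => Y s p) t) (twist r (F t p).grp (diff I (Y t) p v)) := by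
    change (2 : ℝ) • (formL tr (deriv (fun s => Y s p) t)
      (endL (twist r (F t p).grp) (diff I (Y t) p v))) = _
    rw [Complex.real_smul]
    simp
  let x := fun n => 𝒜.famCoord n Y
  let h := fun n => 𝒜.famCoord n fun t p => (F t p).grp
  have hd (n : ℕ) : IsDualOn r (𝒜.cyl n) (x n) (h n) := isDualOn_of_family hF n
  let Ω : ℕ → ℝ × Plane → ℝ × Plane → ℝ × Plane → ℂ := fun n i j q =>
    tr (fderiv ℝ (x n) q i) (twist r (h n q) (fderiv ℝ (x n) q j))
  have hΩ (n : ℕ) (i j) : ContDiffOn ℝ ∞ (Ω n i j) (𝒜.cyl n) := by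
    have hs (v) := contDiffOn_fderiv_apply (𝒜.isOpen_cyl n) (hd n).smooth_vec v
    exact contDiffOn_form tr (hs i) (contDiffOn_twist r (𝒜.isOpen_cyl n) (hd n).smooth_grp (hs j))
  have hΩa (n : ℕ) (i j) : Ω n i j = fun q => -Ω n j i q := by
    ext1 q
    simp only [Ω]
    rw [htr_symm, form_twist htr_inv hr]
  have hpull (n : ℕ) {y : Plane} (hy : y ∈ interior (𝒜.coord n).target) (v : Plane) :
      𝒜.pull n α y v = 2 * Ω n (1, 0) (0, v) (t, y) := by
    rw [pull_apply, hα, deriv_family hY t hy, diff_frame_family hY t hy]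
    rfl
  have hsm (n : ℕ) (v : Plane) : ContDiffOn ℝ ∞ (fun y => 2 * Ω n (1, 0) (0, v) (t, y))
      (interior (𝒜.coord n).target) := contDiffOn_const.mul (contDiffOn_slice (hΩ n _ _) t)
  have hpsm (n : ℕ) : ContDiffOn ℝ 1 (𝒜.pull n α) (interior (𝒜.coord n).target) := by
    refine contDiffOn_clm_apply.2 fun v => ?_
    exact ((hsm n v).of_le (by simp)).congr fun y hy => hpull n hy v
  refine 𝒜.integral_eq_zero_of_curl hK hKi (α := α) hpsm ?_ (isAlternating_derivForm
    (fun t => (isLinearForm_diff (Y t)).twistForm tr r (F t)) t) ?_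
  · intro p hp
    ext v
    rw [hα]
    have : (fun s => Y s p) = fun _ => Y 0 p := by ext1 s; simp only [Y, hF0 s p hp]
    rw [this, deriv_const, map_zero, LinearMap.zero_apply, mul_zero]
    rfl
  · intro n y hy
    have hyi := 𝒜.region_subset_interior hKi n hy
    have hmem : (t, y) ∈ 𝒜.cyl n := ⟨trivial, hyi⟩
    have hΩd (i j) : DifferentiableAt ℝ (Ω n i j) (t, y) := differentiableAt_of_cyl (hΩ n i j) hyi
    have hpf (v : Plane) : (fun z => 𝒜.pull n α z v) =ᶠ[nhds y]
        fun z => 2 * Ω n (1, 0) (0, v) (t, z) := by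
      filter_upwards [isOpen_interior.mem_nhds hyi] with z hz using hpull n hz v
    have hpd (v w : Plane) : fderiv ℝ (fun z => 𝒜.pull n α z v) y w
        = 2 * fderiv ℝ (Ω n (1, 0) (0, v)) (t, y) (0, w) := by
      have hsl : DifferentiableAt ℝ (fun z => Ω n (1, 0) (0, v) (t, z)) y :=
        (hΩd _ _).comp y ((differentiableAt_const t).prodMk differentiableAt_id)
      rw [(hpf v).fderiv_eq, fderiv_const_mul hsl, smul_apply, fderiv_slice (hΩd _ _), smul_eq_mul]
    rw [curl_eq (((hpsm n).differentiableOn (by simp)).differentiableAt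
      (isOpen_interior.mem_nhds hyi)), hpd, hpd, hL.density_derivForm hyi]
    have hdens : (fun q : ℝ × Plane => 𝒜.density n (twistForm tr r (F q.1) (diff I (Y q.1))) q.2)
        =ᶠ[nhds (t, y)] fun q => 2 * Ω n (0, e₁) (0, e₂) q := by
      filter_upwards [(𝒜.isOpen_cyl n).mem_nhds hmem] with q hq
      have h1 : 𝒜.density n (twistForm tr r (F q.1) (diff I (Y q.1))) q.2
          = Ω n (0, e₁) (0, e₂) q - Ω n (0, e₂) (0, e₁) q := by
        simp only [density, twistForm, wedge]
        rw [diff_frame_family hY q.1 hq.2, diff_frame_family hY q.1 hq.2]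
        rfl
      rw [h1, hΩa n (0, e₂)]
      ring
    rw [hdens.fderiv_eq, fderiv_const_mul (hΩd _ _), smul_apply, smul_eq_mul]
    -- Closedness evaluated on the two coordinate directions of the surface and the time direction.
    have hcl := (hd n).closed htr_symm htr_inv hr hmem (0, e₁) (0, e₂) (1, 0)
    have hneg : fderiv ℝ (Ω n (0, e₂) (1, 0)) (t, y) (0, e₁)
        = -fderiv ℝ (Ω n (1, 0) (0, e₂)) (t, y) (0, e₁) := by
      rw [hΩa n (0, e₂), fderiv_fun_neg]
      rfl
    change fderiv ℝ (Ω n (0, e₁) (0, e₂)) (t, y) (1, 0)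
      + fderiv ℝ (Ω n (0, e₂) (1, 0)) (t, y) (0, e₁)
      + fderiv ℝ (Ω n (1, 0) (0, e₁)) (t, y) (0, e₂) = 0 at hcl
    rw [hneg] at hcl
    linear_combination 2 * hcl

open OrientedAtlas in
theorem topologicalTerm_eq [T2Space M] [IsManifold I ∞ M]
    {tr : LinearMap.BilinForm ℂ 𝔤} {r : 𝔤 →ₗ[ℂ] 𝔤} (htr_symm : ∀ x y, tr x y = tr y x)
    (htr_inv : ∀ x y z : 𝔤, tr ⁅x, y⁆ z = tr x ⁅y, z⁆) (hr : IsTriangularRMatrix tr r)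
    {𝒜 : OrientedAtlas I M} {K : Set M} (hK : IsCompact K) (hKi : K ⊆ I.interior M)
    {F : ℝ → M → Double 𝔤}
    (hF : IsSmoothDualMap (𝓘(ℝ, ℝ).prod I) r (fun q : ℝ × M => F q.1 q.2))
    (hF0 : ∀ t, ∀ p ∉ K, F t p = F 0 p) (t : ℝ) :
    topologicalTerm tr r 𝒜 K (F t) = topologicalTerm tr r 𝒜 K (F 0) := by
  have hL : 𝒜.IsC1Family fun t => twistForm tr r (F t) (diff I fun p => (F t p).vec) :=
    (isSmoothFam_diff (Y := fun t p => (F t p).vec) hF.smooth_vec).isC1Family_twistForm tr hF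
  have hd (s : ℝ) := hL.hasDerivAt_integral hK hKi s
  exact is_const_of_deriv_eq_zero (fun s => (hd s).differentiableAt) (fun s => (hd s).deriv.trans
    (integral_derivForm_twistForm_diff htr_symm htr_inv hr hK hKi hF hF0 s)) t 0

/-! ### The first variation of BF-theory -/

/-- Here `a`, `b` play the components of the one-form along the surface directions `i`, `j`, and `k`
is the direction of variation. Exchanging second derivatives of `x` isolates a total derivative;
invariance of `tr` groups the rest into the curvature and covariant derivatives. -/
theorem fderiv_bf {tr : LinearMap.BilinForm ℂ 𝔤}
    (htr_inv : ∀ x y z : 𝔤, tr ⁅x, y⁆ z = tr x ⁅y, z⁆) {E : Type*} [NormedAddCommGroup E]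
    [NormedSpace ℝ E] {S : Set E} (hS : IsOpen S) {x a b : E → 𝔤} (hx : ContDiffOn ℝ ∞ x S)
    (ha : ContDiffOn ℝ ∞ a S) (hb : ContDiffOn ℝ ∞ b S) {q : E} (hq : q ∈ S) (i j k : E) :
    fderiv ℝ (fun q => tr (fderiv ℝ x q i) (b q) - tr (fderiv ℝ x q j) (a q)
        - tr (x q) ⁅a q, b q⁆) q k
      = fderiv ℝ (fun q => tr (fderiv ℝ x q k) (b q)) q i
        - fderiv ℝ (fun q => tr (fderiv ℝ x q k) (a q)) q j
        - tr (fderiv ℝ x q k) (fderiv ℝ b q i - fderiv ℝ a q j + ⁅a q, b q⁆)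
        + (tr (fderiv ℝ x q i + ⁅a q, x q⁆) (fderiv ℝ b q k)
        - tr (fderiv ℝ x q j + ⁅b q, x q⁆) (fderiv ℝ a q k)) := by
  have hd {f : E → ℂ} (hf : ContDiffOn ℝ ∞ f S) : DifferentiableAt ℝ f q :=
    (hf.differentiableOn (by simp)).differentiableAt (hS.mem_nhds hq)
  have hd' {f : E → 𝔤} (hf : ContDiffOn ℝ ∞ f S) : DifferentiableAt ℝ f q :=
    (hf.differentiableOn (by simp)).differentiableAt (hS.mem_nhds hq)
  have hs (v : E) := contDiffOn_fderiv_apply hS hx v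
  rw [fderiv_fun_sub (hd ((contDiffOn_form tr (hs i) hb).sub (contDiffOn_form tr (hs j) ha)))
    (hd (contDiffOn_form tr hx (contDiffOn_lie ha hb))),
    fderiv_fun_sub (hd (contDiffOn_form tr (hs i) hb)) (hd (contDiffOn_form tr (hs j) ha)),
    sub_apply, sub_apply, fderiv_form tr (hd' (hs i)) (hd' hb),
    fderiv_form tr (hd' (hs j)) (hd' ha),
    fderiv_form tr (hd' hx) (hd' (contDiffOn_lie ha hb)), fderiv_form tr (hd' (hs k)) (hd' hb),
    fderiv_form tr (hd' (hs k)) (hd' ha), fderiv_lie (hd' ha) (hd' hb),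
    fderiv_fderiv_symm hS hx hq k i, fderiv_fderiv_symm hS hx hq k j]
  have h1 (u z : 𝔤) : tr ⁅u, x q⁆ z = -tr (x q) ⁅u, z⁆ := by
    rw [← lie_skew, map_neg, LinearMap.neg_apply, htr_inv]
  have h2 : ⁅b q, fderiv ℝ a q k⁆ = -⁅fderiv ℝ a q k, b q⁆ := (lie_skew _ _).symm
  simp only [map_add, map_sub, LinearMap.add_apply, h1, h2, map_neg]
  ring

namespace OrientedAtlas

variable (𝒜 : OrientedAtlas I M)

/-- The coefficient of the curvature `dA + [A, A]` in a chart. -/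
def curv (n : ℕ) (A : OneForm 𝔤 I M) (y : Plane) : 𝔤 :=
  fderivWithin ℝ (𝒜.local1 n A) (𝒜.coord n).target y e₁ e₂
    - fderivWithin ℝ (𝒜.local1 n A) (𝒜.coord n).target y e₂ e₁
    + ⁅𝒜.local1 n A y e₁, 𝒜.local1 n A y e₂⁆

variable {𝒜}

theorem plane_decomp (v : Plane) : v = v 0 • e₁ + v 1 • e₂ := by
  ext i
  fin_cases i <;> simp [e₁, e₂]

/-- The left-hand side of the curvature equation is bilinear and alternating in its two vectors, so
in the plane one coefficient determines it. -/
theorem isFlat_iff_curv {A : OneForm 𝔤 I M} :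
    𝒜.IsFlat A ↔ ∀ n, ∀ y ∈ (𝒜.coord n).target, 𝒜.curv n A y = 0 := by
  refine ⟨fun h n y hy => h n y hy e₁ e₂, fun h n y hy v w => ?_⟩
  have key : ∀ (D : Plane →L[ℝ] Plane →L[ℝ] 𝔤) (a : Plane →L[ℝ] 𝔤),
      D e₁ e₂ - D e₂ e₁ + ⁅a e₁, a e₂⁆ = 0 → D v w - D w v + ⁅a v, a w⁆ = 0 := by
    intro D a h0
    rw [plane_decomp v, plane_decomp w]
    simp only [map_add, map_smul, add_apply, smul_apply, add_lie, lie_add, real_smul_lie,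
      real_lie_smul, lie_self, smul_zero]
    have h1 : ⁅a e₂, a e₁⁆ = -⁅a e₁, a e₂⁆ := (lie_skew _ _).symm
    have h2 : ⁅a e₁, a e₂⁆ = D e₂ e₁ - D e₁ e₂ := by
      rw [← sub_eq_zero, ← h0]; abel
    rw [h1, h2]
    module
  exact key _ _ (h n y hy)

theorem continuousOn_curv {A : OneForm 𝔤 I M} (hA : 𝒜.IsSmooth A) (n : ℕ) :
    ContinuousOn (𝒜.curv n A) (𝒜.coord n).target := by
  have h1 := (hA n).continuousOn_fderivWithin (𝒜.uniqueDiffOn_target n) (by simp)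
  have h2 := (hA n).continuousOn
  exact (((h1.clm_apply continuousOn_const).clm_apply continuousOn_const).sub
    ((h1.clm_apply continuousOn_const).clm_apply continuousOn_const)).add
    (continuousOn_lie (h2.clm_apply continuousOn_const) (h2.clm_apply continuousOn_const))

/-- A family of one-forms read in a chart. -/
def famLocal (𝒜 : OrientedAtlas I M) (n : ℕ) (B : ℝ → OneForm 𝔤 I M) (v : Plane) (q : ℝ × Plane) :
    𝔤 := 𝒜.local1 n (B q.1) q.2 v

theorem IsSmoothFamily.contDiffOn_famLocal {B : ℝ → OneForm 𝔤 I M} (hB : 𝒜.IsSmoothFamily B)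
    (n : ℕ) (v : Plane) : ContDiffOn ℝ ∞ (𝒜.famLocal n B v) (𝒜.cyl n) := hB.isSmoothFam n v

theorem IsSmoothFamily.fderivWithin_local1 {B : ℝ → OneForm 𝔤 I M} (hB : 𝒜.IsSmoothFamily B)
    {n : ℕ} {y : Plane} (hy : y ∈ interior (𝒜.coord n).target) (t : ℝ) (v w : Plane) :
    fderivWithin ℝ (𝒜.local1 n (B t)) (𝒜.coord n).target y v w
      = fderiv ℝ (𝒜.famLocal n B w) (t, y) (0, v) := by
  rw [fderivWithin_of_mem_nhds (mem_interior_iff_mem_nhds.1 hy),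
    ← fderiv_slice (differentiableAt_of_cyl (hB.contDiffOn_famLocal n w) hy)]
  have h1 : DifferentiableAt ℝ (𝒜.local1 n (B t)) y :=
    ((hB.isSmooth t n).differentiableOn (by simp)).differentiableAt
      (mem_interior_iff_mem_nhds.1 hy)
  have e : (fun z => 𝒜.famLocal n B w (t, z)) = fun z => 𝒜.local1 n (B t) z w := rfl
  rw [e, fderiv_clm_apply h1 (differentiableAt_const _)]
  simp

theorem IsSmoothFamily.deriv_apply {B : ℝ → OneForm 𝔤 I M} (hB : 𝒜.IsSmoothFamily B)
    {n : ℕ} {y : Plane} (hy : y ∈ interior (𝒜.coord n).target) (t : ℝ) (v : Plane) :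
    deriv (fun s => B s ((𝒜.coord n).symm y) (𝒜.frame n y v)) t
      = fderiv ℝ (𝒜.famLocal n B v) (t, y) (1, 0) :=
  deriv_slice (G := 𝒜.famLocal n B v)
    (differentiableAt_of_cyl (hB.contDiffOn_famLocal n v) hy)

end OrientedAtlas

/-- The one-form `tr (∂ₜX A)`, whose exterior derivative appears in the first variation. -/
def bfPotential (tr : LinearMap.BilinForm ℂ 𝔤) (Y : ℝ → M → 𝔤) (B : ℝ → OneForm 𝔤 I M) (t : ℝ)
    (p : M) : TangentSpace I p →L[ℝ] ℂ :=
  (formL tr (deriv (fun s => Y s p) t)).comp (B t p)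

namespace OrientedAtlas

variable {𝒜 : OrientedAtlas I M} {Y : ℝ → M → 𝔤} {B : ℝ → OneForm 𝔤 I M} {n : ℕ}
  {tr : LinearMap.BilinForm ℂ 𝔤}

theorem pull_bfPotential
    (hY : ContMDiff (𝓘(ℝ, ℝ).prod I) 𝓘(ℝ, 𝔤) ∞ (fun q : ℝ × M => Y q.1 q.2)) {y : Plane}
    (hy : y ∈ interior (𝒜.coord n).target) (t : ℝ) (v : Plane) :
    𝒜.pull n (bfPotential tr Y B t) y v
      = tr (fderiv ℝ (𝒜.famCoord n Y) (t, y) (1, 0)) (𝒜.famLocal n B v (t, y)) := by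
  rw [pull_apply, ← deriv_family hY t hy]
  rfl

theorem contDiffOn_potential
    (hY : ContMDiff (𝓘(ℝ, ℝ).prod I) 𝓘(ℝ, 𝔤) ∞ (fun q : ℝ × M => Y q.1 q.2))
    (hB : 𝒜.IsSmoothFamily B) (v : Plane) :
    ContDiffOn ℝ ∞ (fun q => tr (fderiv ℝ (𝒜.famCoord n Y) q (1, 0)) (𝒜.famLocal n B v q))
      (𝒜.cyl n) :=
  contDiffOn_form tr (contDiffOn_fderiv_apply (𝒜.isOpen_cyl n) (contDiffOn_famCoord hY n) _)
    (hB.contDiffOn_famLocal n v)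

theorem contDiffOn_pull_bfPotential
    (hY : ContMDiff (𝓘(ℝ, ℝ).prod I) 𝓘(ℝ, 𝔤) ∞ (fun q : ℝ × M => Y q.1 q.2))
    (hB : 𝒜.IsSmoothFamily B) (n : ℕ) (t : ℝ) :
    ContDiffOn ℝ 1 (𝒜.pull n (bfPotential tr Y B t)) (interior (𝒜.coord n).target) :=
  contDiffOn_clm_apply.2 fun v => ((contDiffOn_slice (contDiffOn_potential hY hB v) t).of_le
    (by simp)).congr fun _ hy => pull_bfPotential hY hy t v

theorem density_bfForm (htr_inv : ∀ x y z : 𝔤, tr ⁅x, y⁆ z = tr x ⁅y, z⁆)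
    (hY : ContMDiff (𝓘(ℝ, ℝ).prod I) 𝓘(ℝ, 𝔤) ∞ (fun q : ℝ × M => Y q.1 q.2))
    {q : ℝ × Plane} (hq : q ∈ 𝒜.cyl n) :
    𝒜.density n (bfForm tr (Y q.1) (B q.1)) q.2
      = tr (fderiv ℝ (𝒜.famCoord n Y) q (0, e₁)) (𝒜.famLocal n B e₂ q)
        - tr (fderiv ℝ (𝒜.famCoord n Y) q (0, e₂)) (𝒜.famLocal n B e₁ q)
        - tr (𝒜.famCoord n Y q) ⁅𝒜.famLocal n B e₁ q, 𝒜.famLocal n B e₂ q⁆ := by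
  have e (v : Plane) := diff_frame_family hY q.1 hq.2 v
  have h (x a b : 𝔤) : tr ⁅x, a⁆ b - tr ⁅x, b⁆ a = 2 * tr x ⁅a, b⁆ := by
    rw [htr_inv, htr_inv, ← lie_skew b a, map_neg]
    ring
  change tr (diff I (Y q.1) _ (𝒜.frame n q.2 e₁)) (𝒜.famLocal n B e₂ q)
    - tr (diff I (Y q.1) _ (𝒜.frame n q.2 e₂)) (𝒜.famLocal n B e₁ q)
    - 1 / 2 * (tr ⁅𝒜.famCoord n Y q, 𝒜.famLocal n B e₁ q⁆ (𝒜.famLocal n B e₂ q)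
      - tr ⁅𝒜.famCoord n Y q, 𝒜.famLocal n B e₂ q⁆ (𝒜.famLocal n B e₁ q)) = _
  rw [e, e, h]
  ring

/-- The first variation formula: an exact term, removed by Stokes, and one term for each equation of
motion, paired with the variation of the other field. -/
theorem density_derivForm_bfForm (htr_inv : ∀ x y z : 𝔤, tr ⁅x, y⁆ z = tr x ⁅y, z⁆)
    (hY : ContMDiff (𝓘(ℝ, ℝ).prod I) 𝓘(ℝ, 𝔤) ∞ (fun q : ℝ × M => Y q.1 q.2))
    (hB : 𝒜.IsSmoothFamily B) {y : Plane} (hy : y ∈ interior (𝒜.coord n).target) (t : ℝ) :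
    𝒜.density n (derivForm (fun s => bfForm tr (Y s) (B s)) t) y
      = curl (𝒜.pull n (bfPotential tr Y B t)) y
        - tr (deriv (fun s => Y s ((𝒜.coord n).symm y)) t) (𝒜.curv n (B t) y)
        + (tr (covariantDiff (Y t) (B t) ((𝒜.coord n).symm y) (𝒜.frame n y e₁))
            (deriv (fun s => B s ((𝒜.coord n).symm y) (𝒜.frame n y e₂)) t)
          - tr (covariantDiff (Y t) (B t) ((𝒜.coord n).symm y) (𝒜.frame n y e₂))
            (deriv (fun s => B s ((𝒜.coord n).symm y) (𝒜.frame n y e₁)) t)) := by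
  have hq : (t, y) ∈ 𝒜.cyl n := ⟨trivial, hy⟩
  rw [(isC1Family_bfForm tr hY hB).density_derivForm hy]
  have hev : (fun q : ℝ × Plane => 𝒜.density n (bfForm tr (Y q.1) (B q.1)) q.2)
      =ᶠ[nhds (t, y)] fun q => tr (fderiv ℝ (𝒜.famCoord n Y) q (0, e₁)) (𝒜.famLocal n B e₂ q)
        - tr (fderiv ℝ (𝒜.famCoord n Y) q (0, e₂)) (𝒜.famLocal n B e₁ q)
        - tr (𝒜.famCoord n Y q) ⁅𝒜.famLocal n B e₁ q, 𝒜.famLocal n B e₂ q⁆ := by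
    filter_upwards [(𝒜.isOpen_cyl n).mem_nhds hq] with q hq using density_bfForm htr_inv hY hq
  rw [hev.fderiv_eq, fderiv_bf htr_inv (𝒜.isOpen_cyl n) (contDiffOn_famCoord hY n)
    (hB.contDiffOn_famLocal n e₁) (hB.contDiffOn_famLocal n e₂) hq]
  have hp (v w : Plane) : fderiv ℝ (fun z => 𝒜.pull n (bfPotential tr Y B t) z v) y w
      = fderiv ℝ (fun q => tr (fderiv ℝ (𝒜.famCoord n Y) q (1, 0)) (𝒜.famLocal n B v q)) (t, y)
        (0, w) := by
    have h1 : (fun z => 𝒜.pull n (bfPotential tr Y B t) z v) =ᶠ[nhds y]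
        fun z => tr (fderiv ℝ (𝒜.famCoord n Y) (t, z) (1, 0)) (𝒜.famLocal n B v (t, z)) := by
      filter_upwards [isOpen_interior.mem_nhds hy] with z hz using pull_bfPotential hY hz t v
    rw [h1.fderiv_eq, ← fderiv_slice (differentiableAt_of_cyl (contDiffOn_potential hY hB v) hy)]
  rw [curl_eq (((contDiffOn_pull_bfPotential hY hB n t).differentiableOn
    (by simp)).differentiableAt (isOpen_interior.mem_nhds hy)), hp, hp, deriv_family hY t hy,
    hB.deriv_apply hy, hB.deriv_apply hy, curv, hB.fderivWithin_local1 hy,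
    hB.fderivWithin_local1 hy, covariantDiff, covariantDiff, diff_frame_family hY t hy,
    diff_frame_family hY t hy]
  rfl

end OrientedAtlas

/-! ### The equations of motion imply stationarity -/

namespace OrientedAtlas

theorem integral_eq_zero {𝒜 : OrientedAtlas I M} {K : Set M} {η : TwoForm I M}
    (h : ∀ n, ∀ y ∈ 𝒜.region n K, 𝒜.density n η y = 0) : 𝒜.integral K η = 0 := by
  have h0 (n : ℕ) : ∫ y in 𝒜.region n K,
      (𝒜.weight n ((𝒜.coord n).symm y) : ℂ) * 𝒜.density n η y = 0 :=
    setIntegral_eq_zero_of_forall_eq_zero fun y hy => by rw [h n y hy, mul_zero]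
  exact (tsum_congr h0).trans tsum_zero

end OrientedAtlas

section

open OrientedAtlas

variable [T2Space M] [IsManifold I ∞ M] {tr : LinearMap.BilinForm ℂ 𝔤} {r : 𝔤 →ₗ[ℂ] 𝔤}
  {𝒜 : OrientedAtlas I M} {K : Set M} {F : ℝ → M → Double 𝔤} {B : ℝ → OneForm 𝔤 I M}

/-- The integrand is a product of two factors which both vanish at time `0`, so the product rule
gives zero. -/
theorem hasDerivAt_quadraticTerm (hK : IsCompact K)
    (hKi : K ⊆ I.interior M)
    (hF : IsSmoothDualMap (𝓘(ℝ, ℝ).prod I) r (fun q : ℝ × M => F q.1 q.2))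
    (hB : 𝒜.IsSmoothFamily B)
    (hc : ∀ p (v : TangentSpace I p), covariantDiff (fun p => (F 0 p).vec) (B 0) p v = 0) :
    HasDerivAt (fun t => quadraticTerm tr r 𝒜 K (F t) (B t)) 0 0 := by
  let Y : ℝ → M → 𝔤 := fun t p => (F t p).vec
  have hY : ContMDiff (𝓘(ℝ, ℝ).prod I) 𝓘(ℝ, 𝔤) ∞ (fun q : ℝ × M => Y q.1 q.2) := hF.smooth_vec
  have hcov := isSmoothFam_covariantDiff hY hB
  have hL : 𝒜.IsC1Family fun t => twistForm tr r (F t) (covariantDiff (Y t) (B t)) :=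
    hcov.isC1Family_twistForm tr hF
  refine (hL.hasDerivAt_integral hK hKi 0).congr_deriv (integral_eq_zero fun n y hy => ?_)
  have hyi := 𝒜.region_subset_interior hKi n hy
  rw [hL.density_derivForm hyi]
  have hd (v : Plane) := differentiableAt_of_cyl (hcov n v) (t := 0) hyi
  have hd' (v : Plane) := differentiableAt_of_cyl (hcov.twist hF n v) (t := 0) hyi
  have key (v w : Plane) : fderiv ℝ (fun q : ℝ × Plane =>
      tr (covariantDiff (Y q.1) (B q.1) ((𝒜.coord n).symm q.2) (𝒜.frame n q.2 v))
        (twist r (F q.1 ((𝒜.coord n).symm q.2)).grp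
          (covariantDiff (Y q.1) (B q.1) ((𝒜.coord n).symm q.2) (𝒜.frame n q.2 w)))) (0, y)
      (1, 0) = 0 := by
    rw [fderiv_form tr (hd v) (hd' w)]
    simp only [Y, hc, map_zero, LinearMap.zero_apply, add_zero]
  have hf (v w : Plane) : DifferentiableAt ℝ (fun q : ℝ × Plane =>
      tr (covariantDiff (Y q.1) (B q.1) ((𝒜.coord n).symm q.2) (𝒜.frame n q.2 v))
        (twist r (F q.1 ((𝒜.coord n).symm q.2)).grp
          (covariantDiff (Y q.1) (B q.1) ((𝒜.coord n).symm q.2) (𝒜.frame n q.2 w)))) (0, y) :=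
    differentiableAt_of_cyl (contDiffOn_form tr (hcov n v) (hcov.twist hF n w)) hyi
  have hs := fderiv_fun_sub (hf e₁ e₂) (hf e₂ e₁)
  have hs' := (congrArg (fun T => T ((1 : ℝ), (0 : Plane))) hs).trans
    (congrArg₂ (· - ·) (key e₁ e₂) (key e₂ e₁))
  exact hs'.trans (sub_zero _)

/-- Where `dX + [A, X] = 0`, the first variation is that of BF-theory. -/
theorem hasDerivAt_dualAction (htr_symm : ∀ x y, tr x y = tr y x)
    (htr_inv : ∀ x y z : 𝔤, tr ⁅x, y⁆ z = tr x ⁅y, z⁆) (hr : IsTriangularRMatrix tr r)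
    (hK : IsCompact K) (hKi : K ⊆ I.interior M)
    (hF : IsSmoothDualMap (𝓘(ℝ, ℝ).prod I) r (fun q : ℝ × M => F q.1 q.2))
    (hF0 : ∀ t, ∀ p ∉ K, F t p = F 0 p) (hB : 𝒜.IsSmoothFamily B)
    (hc : ∀ p (v : TangentSpace I p), covariantDiff (fun p => (F 0 p).vec) (B 0) p v = 0) :
    HasDerivAt (fun t => dualAction tr r 𝒜 K (F t) (B t))
      (𝒜.integral K (derivForm (fun t => bfForm tr (fun p => (F t p).vec) (B t)) 0)) 0 := by
  have hFt (t : ℝ) : IsSmoothDualMap I r (F t) :=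
    hF.comp (Φ := fun p => (t, p)) (contMDiff_const.prodMk contMDiff_id)
  have h1 := (isC1Family_bfForm tr (Y := fun t p => (F t p).vec) hF.smooth_vec
    hB).hasDerivAt_integral hK hKi 0
  have h2 := hasDerivAt_quadraticTerm (tr := tr) hK hKi hF hB hc
  have h3 : HasDerivAt (fun t => topologicalTerm tr r 𝒜 K (F t)) 0 0 :=
    (hasDerivAt_const (0 : ℝ) (topologicalTerm tr r 𝒜 K (F 0))).congr_of_eventuallyEq
      (Filter.Eventually.of_forall
        (topologicalTerm_eq htr_symm htr_inv hr hK hKi hF hF0))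
  have h4 := (h1.sub (h2.const_mul (1 / 2))).add (h3.const_mul (1 / 2))
  rw [mul_zero, sub_zero, add_zero] at h4
  refine h4.congr_of_eventuallyEq (Filter.Eventually.of_forall fun t => ?_)
  exact (dualAction_eq htr_symm htr_inv hr (hFt t) (hB.isSmooth t) hK).2

/-- With both equations satisfied, only the exact term of the first variation is left. Its potential
`tr (∂ₜX A)` vanishes outside `K`, since `X` does not vary there. -/
theorem isStationaryDual_of_equationsOfMotion (htr_symm : ∀ x y, tr x y = tr y x)
    (htr_inv : ∀ x y z : 𝔤, tr ⁅x, y⁆ z = tr x ⁅y, z⁆) (hr : IsTriangularRMatrix tr r)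
    {f : M → Double 𝔤} {A : OneForm 𝔤 I M}
    (h : EquationsOfMotion 𝒜 (fun p => (f p).vec) A) : IsStationaryDual tr r 𝒜 f A := by
  rintro K hK hKi F B rfl rfl hF hB hFB
  refine (hasDerivAt_dualAction htr_symm htr_inv hr hK hKi hF (fun t p hp => (hFB t p hp).1) hB
    h.1).congr_deriv ?_
  let Y : ℝ → M → 𝔤 := fun t p => (F t p).vec
  have hY : ContMDiff (𝓘(ℝ, ℝ).prod I) 𝓘(ℝ, 𝔤) ∞ (fun q : ℝ × M => Y q.1 q.2) := hF.smooth_vec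
  have hcov : ∀ p (v : TangentSpace I p), covariantDiff (Y 0) (B 0) p v = 0 := h.1
  refine 𝒜.integral_eq_zero_of_curl hK hKi (α := bfPotential tr Y B 0)
    (fun n => contDiffOn_pull_bfPotential hY hB n 0) ?_
    (isAlternating_derivForm (fun t => isAlternating_bfForm tr (Y t) (B t)) 0) ?_
  · intro p hp
    have : (fun s => Y s p) = fun _ => Y 0 p := by ext1 s; simp only [Y, (hFB s p hp).1]
    ext v
    change tr (deriv (fun s => Y s p) 0) (B 0 p v) = 0
    rw [this, deriv_const, map_zero, LinearMap.zero_apply]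
  · intro n y hy
    have hyi := 𝒜.region_subset_interior hKi n hy
    refine (density_derivForm_bfForm htr_inv hY hB hyi 0).trans ?_
    rw [isFlat_iff_curv.1 h.2 n y hy.1, hcov, hcov]
    simp

end

/-! ### Functions supported in a chart -/

namespace OrientedAtlas

variable (𝒜 : OrientedAtlas I M)

/-- Smooth functions on the plane with compact support in the interior of the target of a chart. -/
structure IsBump (m : ℕ) (b : Plane → ℝ) : Prop where
  contDiff : ContDiff ℝ ∞ b
  hasCompactSupport : HasCompactSupport b
  tsupport_subset : tsupport b ⊆ interior (𝒜.coord m).target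

open Classical in
/-- The function on the surface given in the `m`-th chart by `b`, zero outside this chart. -/
def lift (m : ℕ) (b : Plane → ℝ) (p : M) : ℝ :=
  if p ∈ (𝒜.chart m).source then b (𝒜.coord m p) else 0

/-- The support of `lift m b`. -/
def liftSupport (m : ℕ) (b : Plane → ℝ) : Set M := (𝒜.coord m).symm '' tsupport b

variable {𝒜} {m : ℕ} {b : Plane → ℝ}

theorem lift_symm {y : Plane} (hy : y ∈ (𝒜.coord m).target) :
    𝒜.lift m b ((𝒜.coord m).symm y) = b y := by
  rw [lift, if_pos (𝒜.coord_symm_mem hy), (𝒜.coord m).right_inv hy]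

theorem lift_of_notMem {p : M} (hp : p ∉ 𝒜.liftSupport m b) : 𝒜.lift m b p = 0 := by
  by_cases hs : p ∈ (𝒜.chart m).source
  · rw [lift, if_pos hs]
    by_contra h
    exact hp ⟨_, subset_tsupport _ h, 𝒜.coord_left_inv hs⟩
  · rw [lift, if_neg hs]

namespace IsBump

variable (hb : 𝒜.IsBump m b)
include hb

theorem subset_target : tsupport b ⊆ (𝒜.coord m).target :=
  hb.tsupport_subset.trans interior_subset

theorem isCompact_liftSupport : IsCompact (𝒜.liftSupport m b) :=
  hb.hasCompactSupport.isCompact.image_of_continuousOn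
    ((𝒜.continuousOn_coord_symm m).mono hb.subset_target)

theorem liftSupport_subset_source : 𝒜.liftSupport m b ⊆ (𝒜.chart m).source := by
  rintro _ ⟨y, hy, rfl⟩
  exact 𝒜.coord_symm_mem (hb.subset_target hy)

theorem liftSupport_subset_interior [IsManifold I ∞ M] :
    𝒜.liftSupport m b ⊆ I.interior M := by
  rintro _ ⟨y, hy, rfl⟩
  have ht := hb.subset_target hy
  rw [← extend_mem_interior_target (𝒜.mem_maximalAtlas m) (𝒜.coord_symm_mem ht)]
  have := hb.tsupport_subset hy
  rwa [← (𝒜.coord m).right_inv ht] at this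

theorem region_liftSupport : 𝒜.region m (𝒜.liftSupport m b) = tsupport b := by
  ext y
  constructor
  · rintro ⟨hy, z, hz, hzy⟩
    rwa [← (𝒜.coord m).symm.injOn (hb.subset_target hz) hy hzy]
  · exact fun hy => ⟨hb.subset_target hy, y, hy, rfl⟩

theorem contMDiff_lift [T2Space M] [IsManifold I ∞ M] :
    ContMDiff I 𝓘(ℝ, ℝ) ∞ (𝒜.lift m b) := by
  refine contMDiff_of_tsupport fun p hp => ?_
  have hs : p ∈ (𝒜.chart m).source := by
    refine hb.liftSupport_subset_source (closure_minimal (fun q hq => ?_)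
      hb.isCompact_liftSupport.isClosed hp)
    by_contra h
    exact hq (lift_of_notMem h)
  refine (hb.contDiff.contMDiff.contMDiffAt.comp p (𝒜.contMDiffAt_coord m hs)).congr_of_eventuallyEq ?_
  filter_upwards [(𝒜.chart m).open_source.mem_nhds hs] with q hq
  rw [lift, if_pos hq]
  rfl

end IsBump

/-- The fundamental lemma of the calculus of variations in a chart. -/
theorem eq_zero_of_integral_bump {g : Plane → ℂ}
    (hg : ContinuousOn g (interior (𝒜.coord m).target))
    (h : ∀ b, 𝒜.IsBump m b → ∫ y in tsupport b, (b y : ℂ) * g y = 0) :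
    ∀ y ∈ interior (𝒜.coord m).target, g y = 0 := by
  have h1 := isOpen_interior.ae_eq_zero_of_integral_contDiff_smul_eq_zero (μ := volume)
    (hg.locallyIntegrableOn isOpen_interior.measurableSet) fun b h1 h2 h3 => by
      rw [← h b ⟨h1, h2, h3⟩, ← setIntegral_eq_integral_of_forall_compl_eq_zero (s := tsupport b)]
      · simp only [Complex.real_smul]
      · intro y hy
        rw [image_eq_zero_of_notMem_tsupport hy, zero_smul]
  have h2 : g =ᵐ[volume.restrict (interior (𝒜.coord m).target)] fun _ => 0 :=
    (ae_restrict_iff' isOpen_interior.measurableSet).2 h1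
  exact Measure.eqOn_open_of_ae_eq h2 isOpen_interior hg continuousOn_const

theorem isBump_of_mem {y : Plane} (hy : y ∈ interior (𝒜.coord m).target) :
    ∃ b, 𝒜.IsBump m b ∧ b y = 1 := by
  obtain ⟨b, h1, h2, h3, -, h4⟩ :=
    exists_contDiff_tsupport_subset (n := ⊤) (isOpen_interior.mem_nhds hy)
  exact ⟨b, ⟨h3, h2, h1⟩, h4⟩

/-- There are bump functions with prescribed derivative at a point. -/
theorem exists_bump_fderiv {y : Plane} (hy : y ∈ interior (𝒜.coord m).target)
    (l : Plane →L[ℝ] ℝ) : ∃ c, 𝒜.IsBump m c ∧ fderiv ℝ c y = l := by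
  obtain ⟨b, hb, hby⟩ := isBump_of_mem hy
  have h1 : ContDiff ℝ ∞ fun z => l (z - y) := l.contDiff.comp (contDiff_id.sub contDiff_const)
  -- Since `b y = 1` and `l (y - y) = 0`, the product rule at `y` leaves `l` alone.
  refine ⟨fun z => b z * l (z - y), ⟨hb.contDiff.mul h1, hb.hasCompactSupport.mul_right,
    (tsupport_mul_subset_left).trans hb.tsupport_subset⟩, ?_⟩
  have h2 : HasFDerivAt (fun z => l (z - y)) l y :=
    l.hasFDerivAt.comp y ((hasFDerivAt_id y).sub_const y)
  have h3 := ((hb.contDiff.differentiable (by simp)) y).hasFDerivAt.mul h2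
  rw [HasFDerivAt.fderiv (f := fun z => b z * l (z - y)) h3]
  simp [hby]

/-- A continuous one-form which vanishes on the frames over the interiors of the charts. -/
theorem IsContinuousOneForm.eq_zero [IsManifold I ∞ M] {α : ∀ p : M, TangentSpace I p → 𝔤}
    (hα : 𝒜.IsContinuousOneForm α) (hl : IsLinearForm α)
    (h : ∀ n, ∀ y ∈ interior (𝒜.coord n).target,
      α ((𝒜.coord n).symm y) (𝒜.frame n y e₁) = 0 ∧ α ((𝒜.coord n).symm y) (𝒜.frame n y e₂) = 0) :
    ∀ p v, α p v = 0 := by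
  intro p v
  obtain ⟨n, y, hy, rfl⟩ := 𝒜.exists_coord p
  obtain ⟨v, rfl⟩ := 𝒜.frame_surjective n hy v
  have key (w : Plane) (hw : ∀ y ∈ interior (𝒜.coord n).target,
      α ((𝒜.coord n).symm y) (𝒜.frame n y w) = 0) : α ((𝒜.coord n).symm y) (𝒜.frame n y w) = 0 :=
    EqOn.of_subset_closure (g := fun _ => 0) hw (hα n w) continuousOn_const interior_subset
      (𝒜.target_subset_closure_interior n) hy
  have h1 := key e₁ fun y hy => (h n y hy).1
  have h2 := key e₂ fun y hy => (h n y hy).2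
  rw [plane_decomp v, map_add, map_smul, map_smul, hl, h1, h2, smul_zero, smul_zero, add_zero]

end OrientedAtlas

/-! ### The variation of the one-form -/

theorem form_real_smul_left (tr : LinearMap.BilinForm ℂ 𝔤) (c : ℝ) (x y : 𝔤) :
    tr (c • x) y = c * tr x y := by
  rw [← formL_apply, map_smul, smul_apply, Complex.real_smul, formL_apply]

theorem form_real_smul_right (tr : LinearMap.BilinForm ℂ 𝔤) (c : ℝ) (x y : 𝔤) :
    tr x (c • y) = c * tr x y := by
  rw [← formL_apply, map_smul, Complex.real_smul, formL_apply]

/-- The left-hand side of the equation of motion obtained by varying `A`. -/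
def momentForm (r : 𝔤 →ₗ[ℂ] 𝔤) (f : M → Double 𝔤) (A : OneForm 𝔤 I M) (p : M)
    (v : TangentSpace I p) : 𝔤 :=
  covariantDiff (fun p => (f p).vec) A p v
    + ⁅(f p).vec, twist r (f p).grp (covariantDiff (fun p => (f p).vec) A p v)⁆

section Expansion

variable {tr : LinearMap.BilinForm ℂ 𝔤} {r : 𝔤 →ₗ[ℂ] 𝔤} (htr_symm : ∀ x y, tr x y = tr y x)
  (htr_inv : ∀ x y z : 𝔤, tr ⁅x, y⁆ z = tr x ⁅y, z⁆) (hr : IsTriangularRMatrix tr r)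
include htr_symm htr_inv hr

/-- All operators are moved onto `y`, which exhibits `π^♯ y = -([X, y] + [X, R [X, y]])`. -/
theorem dualPoisson_swap (a : Double 𝔤) (y z : 𝔤) :
    dualPoisson tr r a y z = -tr (⁅a.vec, y⁆ + ⁅a.vec, twist r a.grp ⁅a.vec, y⁆⁆) z := by
  have h : tr y ⁅a.vec, z⁆ = -tr ⁅a.vec, y⁆ z := by
    rw [← lie_skew a.vec y, map_neg, LinearMap.neg_apply, neg_neg, htr_inv]
  rw [dualPoisson, h, map_add, LinearMap.add_apply, form_lie_twist htr_inv hr]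
  ring

theorem dualPoisson_antisymm (a : Double 𝔤) (y z : 𝔤) :
    dualPoisson tr r a y z = -dualPoisson tr r a z y := by
  have h (x y z : 𝔤) : tr y ⁅x, z⁆ = -tr z ⁅x, y⁆ := by
    rw [← htr_inv, htr_symm, ← lie_skew y x, map_neg]
  have h' (y z : 𝔤) : tr y (twist r a.grp z) = -tr z (twist r a.grp y) := by
    rw [htr_symm, form_twist htr_inv hr]
  rw [dualPoisson, dualPoisson, h, h']
  ring

/-- The Lagrangian is quadratic in the one-form. The coefficient of `t` pairs `β` with `θ + π^♯ A`,
and this is `C + [X, R C]`, which is `momentForm`. -/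
theorem psmLagrangian_add_smul {f : M → Double 𝔤} (hf : IsSmoothDualMap I r f)
    (A β : OneForm 𝔤 I M) (t : ℝ) (p : M) (v w : TangentSpace I p) :
    psmLagrangian tr (rightForm f) (fun p => dualPoisson tr r (f p)) (fun p => A p + t • β p) p v w
      = psmLagrangian tr (rightForm f) (fun p => dualPoisson tr r (f p)) A p v w
        + (t * wedge tr (momentForm r f A) (fun p v => β p v) p v w
        + t ^ 2 * psmLagrangian tr (fun _ _ => 0) (fun p => dualPoisson tr r (f p)) β p v w) := by
  have h1 (a b c : 𝔤) : dualPoisson tr r (f p) (a + t • b) c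
      = dualPoisson tr r (f p) a c + t * dualPoisson tr r (f p) b c := by
    simp only [dualPoisson, map_add, LinearMap.add_apply, form_real_smul_left, lie_add,
      real_lie_smul]
    ring
  have h2 (a b c : 𝔤) : dualPoisson tr r (f p) c (a + t • b)
      = dualPoisson tr r (f p) c a + t * dualPoisson tr r (f p) c b := by
    simp only [dualPoisson, map_add, form_real_smul_right, lie_add, real_lie_smul, map_real_smul]
    ring
  have hv (u : TangentSpace I p) : (A p + t • β p) u = A p u + t • β p u := rfl
  have h3 : ∀ u, ⁅A p u, (f p).vec⁆ = -⁅(f p).vec, A p u⁆ := fun u => (lie_skew _ _).symm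
  simp only [psmLagrangian, wedge, momentForm, covariantDiff, rightForm_eq hf, hv, h1, h2,
    map_zero, LinearMap.zero_apply]
  rw [dualPoisson_antisymm htr_symm htr_inv hr (f p) (β p v) (A p w),
    dualPoisson_antisymm htr_symm htr_inv hr (f p) (β p w) (A p v),
    dualPoisson_swap htr_symm htr_inv hr (f p) (A p v) (β p w),
    dualPoisson_swap htr_symm htr_inv hr (f p) (A p w) (β p v)]
  simp only [map_add, LinearMap.add_apply, form_real_smul_right, h3, map_neg, lie_add, lie_neg,
    LinearMap.neg_apply]
  ring

end Expansion

namespace OrientedAtlas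

variable {𝒜 : OrientedAtlas I M}

/-- The one-form `b dc Z` for functions `b`, `c` supported in a chart. -/
def bumpForm (𝒜 : OrientedAtlas I M) (m : ℕ) (b c : Plane → ℝ) (Z : 𝔤) : OneForm 𝔤 I M := fun p =>
  𝒜.lift m b p • (ContinuousLinearMap.toSpanSingleton ℝ Z).comp
    (show TangentSpace I p →L[ℝ] ℝ from mfderiv I 𝓘(ℝ, ℝ) (𝒜.lift m c) p)

theorem bumpForm_apply (m : ℕ) (b c : Plane → ℝ) (Z : 𝔤) (p : M) (v : TangentSpace I p) :
    𝒜.bumpForm m b c Z p v = (𝒜.lift m b p * diff I (𝒜.lift m c) p v) • Z := by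
  change 𝒜.lift m b p • (diff I (𝒜.lift m c) p v • Z) = _
  rw [smul_smul]

/-- The test form is assembled from functions which are smooth on the whole surface and from a
differential, so its smoothness in every chart follows without relating the frames of different
charts. -/
theorem isSmooth_bumpForm [T2Space M] [IsManifold I ∞ M] {m : ℕ} {b c : Plane → ℝ}
    (hb : 𝒜.IsBump m b) (hc : 𝒜.IsBump m c) (Z : 𝔤) : 𝒜.IsSmooth (𝒜.bumpForm m b c Z) := by
  intro n
  refine contDiffOn_clm_apply.2 fun v => ?_
  have h1 := 𝒜.contDiffOn_comp_coord_symm hb.contMDiff_lift n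
  have h2 := 𝒜.contDiffOn_comp_coord_symm hc.contMDiff_lift n
  have h3 := (h2.fderivWithin (𝒜.uniqueDiffOn_target n) (m := ∞) (by simp)).clm_apply
    (contDiffOn_const (c := v))
  refine ((h1.mul h3).smul (contDiffOn_const (c := Z))).congr fun y hy => ?_
  change 𝒜.bumpForm m b c Z ((𝒜.coord n).symm y) (𝒜.frame n y v) = _
  rw [bumpForm_apply, 𝒜.diff_frame n hy (hc.contMDiff_lift.mdifferentiable (by simp) _)]
  rfl

theorem IsSmooth.add_smul {A β : OneForm 𝔤 I M} (hA : 𝒜.IsSmooth A) (hβ : 𝒜.IsSmooth β) :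
    𝒜.IsSmoothFamily fun t p => A p + t • β p := fun n =>
  ((hA n).comp contDiffOn_snd fun _ hq => hq.2).add
    (contDiffOn_fst.smul ((hβ n).comp contDiffOn_snd fun _ hq => hq.2))

theorem IsSmooth.isSmoothFamily {A : OneForm 𝔤 I M} (hA : 𝒜.IsSmooth A) :
    𝒜.IsSmoothFamily fun _ => A := fun n => (hA n).comp contDiffOn_snd fun _ hq => hq.2

theorem isContinuousOneForm_momentForm {r : 𝔤 →ₗ[ℂ] 𝔤} {f : M → Double 𝔤}
    (hf : IsSmoothDualMap I r f) {A : OneForm 𝔤 I M} (hA : 𝒜.IsSmooth A) :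
    𝒜.IsContinuousOneForm (momentForm r f A) := fun n v =>
  have h := isContinuousOneForm_covariantDiff hf.smooth_vec hA
  (h n v).add ((h.twist hf).lie_left hf.smooth_vec.continuous n v)

end OrientedAtlas

theorem isLinearForm_momentForm (r : 𝔤 →ₗ[ℂ] 𝔤) (f : M → Double 𝔤) (A : OneForm 𝔤 I M) :
    IsLinearForm (momentForm r f A) := fun p v w a b => by
  have h := isLinearForm_covariantDiff (fun p => (f p).vec) A
  simp only [momentForm, h p, map_add, map_real_smul, lie_add, real_lie_smul, smul_add]
  abel

section

open OrientedAtlas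

variable [T2Space M] {tr : LinearMap.BilinForm ℂ 𝔤} {r : 𝔤 →ₗ[ℂ] 𝔤} {𝒜 : OrientedAtlas I M}
  (htr_symm : ∀ x y, tr x y = tr y x) (htr_inv : ∀ x y z : 𝔤, tr ⁅x, y⁆ z = tr x ⁅y, z⁆)
  (hr : IsTriangularRMatrix tr r) {f : M → Double 𝔤} (hf : IsSmoothDualMap I r f)
  {A : OneForm 𝔤 I M} (hA : 𝒜.IsSmooth A)
include htr_symm htr_inv hr hf hA

theorem isContinuous_psmLagrangian (K : Set M) : 𝒜.IsContinuous K
    (psmLagrangian tr (rightForm f) (fun p => dualPoisson tr r (f p)) A) := by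
  have h1 := isContinuous_bfForm tr hf.smooth_vec hA K
  have h2 := ((isContinuousOneForm_covariantDiff hf.smooth_vec hA).twistForm tr hf K).const_mul
    (-(1 / 2))
  have h3 := ((isContinuousOneForm_diff (𝒜 := 𝒜) hf.smooth_vec).twistForm tr hf K).const_mul
    (1 / 2)
  have e : psmLagrangian tr (rightForm f) (fun p => dualPoisson tr r (f p)) A
      = fun p v w => bfForm tr (fun p => (f p).vec) A p v w
        + (-(1 / 2) * twistForm tr r f (covariantDiff (fun p => (f p).vec) A) p v w
        + (1 / 2) * twistForm tr r f (diff I fun p => (f p).vec) p v w) := by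
    ext p v w; exact psmLagrangian_eq_bf htr_symm htr_inv hr hf A p v w
  rw [e]
  exact h1.add (h2.add h3)

theorem isContinuous_psmLagrangian_zero (K : Set M) : 𝒜.IsContinuous K
    (psmLagrangian tr (fun _ _ => 0) (fun p => dualPoisson tr r (f p)) A) := by
  have h1 : 𝒜.IsContinuousOneForm (rightForm f) := fun n v =>
    ((isContinuousOneForm_diff hf.smooth_vec n v).add
      (((isContinuousOneForm_diff hf.smooth_vec).twist hf).lie_left
        hf.smooth_vec.continuous n v)).congr fun y _ => rightForm_eq hf _ _
  have h2 := (isContinuous_psmLagrangian htr_symm htr_inv hr hf hA K).add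
    ((h1.wedge tr hA.isContinuousOneForm K).const_mul (-1))
  have e : psmLagrangian tr (fun _ _ => 0) (fun p => dualPoisson tr r (f p)) A
      = fun p v w => psmLagrangian tr (rightForm f) (fun p => dualPoisson tr r (f p)) A p v w
        + -1 * wedge tr (rightForm f) (fun q u => A q u) p v w := by
    ext p v w
    simp only [psmLagrangian, wedge, map_zero, LinearMap.zero_apply]
    ring
  rwa [e]

/-- Vary `A` along `A + t β` with `X̄` fixed: the action over `K` is a polynomial in `t`, and
stationarity says that its linear coefficient vanishes. -/
theorem integral_momentForm_eq_zero (h : IsStationaryDual tr r 𝒜 f A) {K : Set M}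
    (hK : IsCompact K) (hKi : K ⊆ I.interior M) {β : OneForm 𝔤 I M} (hβ : 𝒜.IsSmooth β)
    (hβ0 : ∀ p ∉ K, β p = 0) :
    𝒜.integral K (wedge tr (momentForm r f A) fun p v => β p v) = 0 := by
  have h1 := h K hK hKi (fun _ => f) (fun t p => A p + t • β p) rfl
    (by ext p v; change ((A p v + (0 : ℝ) • β p v : 𝔤) : 𝓐) = A p v; rw [zero_smul, add_zero])
    (hf.comp (Φ := Prod.snd) contMDiff_snd) (hA.add_smul hβ)
    fun t p hp => ⟨rfl, by
      ext1 v; change A p v + t • β p v = A p v; rw [hβ0 p hp]; simp⟩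
  have c1 := isContinuous_psmLagrangian htr_symm htr_inv hr hf hA K
  have c2 := (isContinuousOneForm_momentForm hf hA).wedge tr hβ.isContinuousOneForm K
  have c3 := isContinuous_psmLagrangian_zero htr_symm htr_inv hr hf hβ K
  have e (t : ℝ) : dualAction tr r 𝒜 K f (fun p => A p + t • β p)
      = dualAction tr r 𝒜 K f A
        + (t * 𝒜.integral K (wedge tr (momentForm r f A) fun p v => β p v)
        + t ^ 2 * 𝒜.integral K
          (psmLagrangian tr (fun _ _ => 0) (fun p => dualPoisson tr r (f p)) β)) := by
    rw [dualAction, dualAction, ← OrientedAtlas.integral_const_mul hK,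
      ← OrientedAtlas.integral_const_mul hK,
      ← OrientedAtlas.integral_add hK (c2.const_mul _) (c3.const_mul _),
      ← OrientedAtlas.integral_add hK c1 ((c2.const_mul _).add (c3.const_mul _))]
    congr 1
    ext p v w
    exact psmLagrangian_add_smul htr_symm htr_inv hr hf A β t p v w
  simp only [e] at h1
  have d : HasDerivAt (fun t : ℝ => (t : ℂ)) 1 0 := (hasDerivAt_id (0 : ℝ)).ofReal_comp
  have h2 := ((d.mul_const (𝒜.integral K (wedge tr (momentForm r f A) fun p v => β p v))).add
    ((d.pow 2).mul_const (𝒜.integral K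
      (psmLagrangian tr (fun _ _ => 0) (fun p => dualPoisson tr r (f p)) β)))).const_add
      (dualAction tr r 𝒜 K f A)
  have h3 := h2.unique h1
  simpa using h3

/-- Testing with the one-forms `b dc Z` and letting `b` vary localizes `tr (γ Z) ∧ dc = 0`, where
`γ` is `momentForm`. A suitable differential of `c` at a point isolates each component,
non-degeneracy gives `γ = 0`, and membership in `G_r` then gives `C = 0` by
`eq_zero_of_add_lie_twist`. -/
theorem covariantDiff_eq_zero [IsManifold I ∞ M] (htr_nondeg : tr.Nondegenerate)
    (h : IsStationaryDual tr r 𝒜 f A) (p : M) (v : TangentSpace I p) :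
    covariantDiff (fun p => (f p).vec) A p v = 0 := by
  refine (isContinuousOneForm_covariantDiff hf.smooth_vec hA).eq_zero
    (isLinearForm_covariantDiff _ A) (fun m y₀ hy₀ => ?_) p v
  have hγ := isContinuousOneForm_momentForm hf hA
  let γ : Plane → Plane → 𝔤 := fun v y =>
    momentForm r f A ((𝒜.coord m).symm y) (𝒜.frame m y v)
  have key (c : Plane → ℝ) (hc : 𝒜.IsBump m c) (Z : 𝔤) :
      ∀ y ∈ interior (𝒜.coord m).target,
        tr (γ e₁ y) Z * (fderiv ℝ c y e₂ : ℝ) - tr (γ e₂ y) Z * (fderiv ℝ c y e₁ : ℝ) = 0 := by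
    have hcc (v : Plane) : Continuous fun y => ((fderiv ℝ c y v : ℝ) : ℂ) :=
      Complex.continuous_ofReal.comp
        ((hc.contDiff.continuous_fderiv (by simp)).clm_apply continuous_const)
    have hγc (v : Plane) : ContinuousOn (fun y => tr (γ v y) Z) (interior (𝒜.coord m).target) :=
      continuousOn_form tr ((hγ m v).mono interior_subset) continuousOn_const
    refine eq_zero_of_integral_bump (((hγc e₁).mul (hcc e₂).continuousOn).sub
      ((hγc e₂).mul (hcc e₁).continuousOn)) fun b hb => ?_
    have hK := hb.isCompact_liftSupport
    have hβ := isSmooth_bumpForm hb hc Z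
    have h1 := integral_momentForm_eq_zero htr_symm htr_inv hr hf hA h hK
      hb.liftSupport_subset_interior hβ fun p hp => by
        ext1 v; rw [bumpForm_apply, lift_of_notMem hp, zero_mul, zero_smul]; rfl
    have hcont := hγ.wedge tr hβ.isContinuousOneForm (𝒜.liftSupport m b)
    rw [integral_eq_chart hK ((isLinearForm_momentForm r f A).wedge tr (isLinearForm_oneForm _)) m
      hK hb.liftSupport_subset_source subset_rfl (fun p hp hp' => absurd hp hp') (hcont m),
      hb.region_liftSupport] at h1
    rw [← h1]
    refine setIntegral_congr_fun (isClosed_tsupport b).measurableSet fun y hy => ?_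
    have hyi := hb.tsupport_subset hy
    have hβ (v : Plane) : 𝒜.bumpForm m b c Z ((𝒜.coord m).symm y) (𝒜.frame m y v)
        = (b y * fderiv ℝ c y v) • Z := by
      rw [bumpForm_apply, lift_symm (interior_subset hyi),
        𝒜.diff_frame_of_mem_interior m hyi (hc.contMDiff_lift.mdifferentiable (by simp) _)]
      have : 𝒜.lift m c ∘ (𝒜.coord m).symm =ᶠ[nhds y] c := by
        filter_upwards [isOpen_interior.mem_nhds hyi] with z hz
          using lift_symm (interior_subset hz)
      rw [this.fderiv_eq]
    simp only [density, wedge]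
    rw [hβ, hβ, form_real_smul_right, form_real_smul_right]
    push_cast
    ring
  have hzero (i : Plane) (hi : γ i y₀ = 0) :
      covariantDiff (fun p => (f p).vec) A ((𝒜.coord m).symm y₀) (𝒜.frame m y₀ i) = 0 :=
    eq_zero_of_add_lie_twist hr (hf.mem _) hi
  constructor
  · refine hzero e₁ (htr_nondeg.1 _ fun Z => ?_)
    -- With `dc = dx²` at the point, the `e₁` component survives; below, `dc = dx¹` isolates the
    -- `e₂` component.
    obtain ⟨c, hc, hcl⟩ := exists_bump_fderiv hy₀ (EuclideanSpace.proj (1 : Fin 2) : Plane →L[ℝ] ℝ)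
    have := key c hc Z y₀ hy₀
    simpa [hcl, e₁, e₂] using this
  · refine hzero e₂ (htr_nondeg.1 _ fun Z => ?_)
    obtain ⟨c, hc, hcl⟩ := exists_bump_fderiv hy₀ (EuclideanSpace.proj (0 : Fin 2) : Plane →L[ℝ] ℝ)
    have := key c hc Z y₀ hy₀
    simpa [hcl, e₁, e₂] using this

end

/-! ### Translation by one-parameter subgroups of the dual group -/

section Translation

theorem contDiff_exp_smul (x : 𝓐) : ContDiff ℝ ∞ fun t : ℝ => NormedSpace.exp (t • x) := by
  have := FiniteDimensional.complete ℂ 𝓐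
  have h : ContDiff ℝ ∞ (NormedSpace.exp : 𝓐 → 𝓐) := contDiff_iff_contDiffAt.2 fun x =>
    (NormedSpace.exp_analytic (𝕂 := ℝ) x).contDiffAt
  exact h.comp (contDiff_id.smul contDiff_const)

theorem contDiff_dualExp_vec (r : 𝔤 →ₗ[ℂ] 𝔤) (x : 𝔤) :
    ContDiff ℝ ∞ fun t => (dualExp r x t).vec := by
  refine contDiff_infty_iff_deriv.2
    ⟨fun t => (hasDerivAt_dualExp_vec x t).differentiableAt, ?_⟩
  have e : deriv (fun t => (dualExp r x t).vec) = fun t => Ad (expG (t • r x)) x := by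
    ext1 t
    exact (hasDerivAt_dualExp_vec x t).deriv
  rw [e, ← contMDiff_iff_contDiff]
  exact fun t => contMDiffAt_Ad (contDiff_exp_smul (r x : 𝓐)).contMDiff.contMDiffAt
    contMDiffAt_const

variable {E' : Type*} [NormedAddCommGroup E'] [NormedSpace ℝ E'] {H' : Type*} [TopologicalSpace H']
  {J : ModelWithCorners ℝ E' H'} {P : Type*} [TopologicalSpace P] [ChartedSpace H' P]

theorem diff_comp_deriv {V : Type*} [NormedAddCommGroup V] [NormedSpace ℝ V] {γ : ℝ → V} {γ' : V}
    {s : P → ℝ} {p : P} (hγ : HasDerivAt γ γ' (s p)) (hs : MDifferentiableAt J 𝓘(ℝ, ℝ) s p)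
    (v : TangentSpace J p) : diff J (fun q => γ (s q)) p v = diff J s p v • γ' := by
  have h := hγ.hasFDerivAt.hasMFDerivAt.comp p hs.hasMFDerivAt
  have e : diff J (fun q => γ (s q)) p v = _ := congrArg (fun T => T v) h.mfderiv
  exact e

/-- Invariance of the graph of `r` applied to the inverse group element, in the form needed to
transport the tangency of `f` past the factor on its right. -/
theorem Ad_inv_map_dualExp {tr : LinearMap.BilinForm ℂ 𝔤} {r : 𝔤 →ₗ[ℂ] 𝔤}
    (hr : IsTriangularRMatrix tr r) (x u : 𝔤) (t : ℝ) :
    Ad (dualExp r x t).grp⁻¹ (r u)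
      = r (Ad (dualExp r x t).grp⁻¹ (u + ⁅r u, (dualExp r x t).vec⁆)) := by
  have h := Ad_map_of_mem hr (inv_mem (dualExp_mem (r := r) x t)) u
  refine h.trans (congrArg r ?_)
  change Ad (dualExp r x t).grp⁻¹ u + ⁅-(Ad (dualExp r x t).grp⁻¹ (dualExp r x t).vec),
    Ad (dualExp r x t).grp⁻¹ (r u)⁆ = _
  rw [neg_lie, lie_skew, map_add, Ad_lie]

/-- For `e = exp (s (r x + x ε))`, the left logarithmic derivative of `f e` is `Ad_{e⁻¹} (f⁻¹ df) +
ds (r x + x ε)`. The first summand stays in the graph of `r` because `e` belongs to `G_r`; the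
second lies in it by construction. -/
theorem IsSmoothDualMap.mul_dualExp {tr : LinearMap.BilinForm ℂ 𝔤} {r : 𝔤 →ₗ[ℂ] 𝔤}
    (hr : IsTriangularRMatrix tr r) {f : P → Double 𝔤} (hf : IsSmoothDualMap J r f) {s : P → ℝ}
    (hs : ContMDiff J 𝓘(ℝ, ℝ) ∞ s) (x : 𝔤) :
    IsSmoothDualMap J r fun p => f p * dualExp r x (s p) := by
  have hY : ContMDiff J 𝓘(ℝ, 𝔤) ∞ fun p => (dualExp r x (s p)).vec :=
    (contDiff_dualExp_vec r x).contMDiff.comp hs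
  have he : ContMDiff J 𝓘(ℝ, 𝓐) ∞ fun p => ((((dualExp r x (s p)).grp : linearGroup 𝔤) : 𝓐ˣ) : 𝓐) :=
    (contDiff_exp_smul (r x : 𝓐)).contMDiff.comp hs
  refine ⟨fun p => (hf.smooth_vec p).add (contMDiffAt_Ad (hf.smooth_grp p) (hY p)),
    fun p => contMDiffAt_mul (hf.smooth_grp p) (he p),
    fun p => mul_mem (hf.mem p) (dualExp_mem x (s p)), fun p v => ?_⟩
  have hsd := hs.mdifferentiable (by simp) p
  have hXd := hf.smooth_vec.mdifferentiable (by simp) p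
  have hAY : ContMDiffAt J 𝓘(ℝ, 𝔤) 1 (fun q => Ad (f q).grp (dualExp r x (s q)).vec) p :=
    contMDiffAt_Ad (hf.contMDiffAt_grp (n := 1) p) ((hY p).of_le (by simp))
  set dX := diff J (fun q => (f q).vec) p v with hdX
  set e := (dualExp r x (s p)).grp with hedef
  set u := Ad (f p).grp⁻¹ dX with hu
  have h1 : diff J (fun q => (dualExp r x (s q)).vec) p v = diff J s p v • Ad e x :=
    diff_comp_deriv (hasDerivAt_dualExp_vec x (s p)) hsd v
  have h2 : diff J (fun q => Ad (f q).grp (dualExp r x (s q)).vec) p v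
      = Ad (f p).grp (diff J s p v • Ad e x)
        + ⁅twist r (f p).grp dX, Ad (f p).grp (dualExp r x (s p)).vec⁆ := by
    rw [← h1]
    exact diff_Ad (hf.contMDiffAt_grp (n := 1) p) ((hY p).of_le (by simp)) (hf.diff_grp p v)
  have h3 : diff J (fun q => (f q * dualExp r x (s q)).vec) p v
      = dX + (Ad (f p).grp (diff J s p v • Ad e x)
        + ⁅twist r (f p).grp dX, Ad (f p).grp (dualExp r x (s p)).vec⁆) := by
    rw [← h2]
    have := hXd.hasMFDerivAt.add (hAY.mdifferentiableAt (by simp)).hasMFDerivAt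
    exact congrArg (fun T => T v) this.mfderiv
  have h4 : diff J (fun q => ((((dualExp r x (s q)).grp : linearGroup 𝔤) : 𝓐ˣ) : 𝓐)) p v
      = diff J s p v • (((e : 𝓐ˣ) : 𝓐) * (r x : 𝓐)) := by
    have := FiniteDimensional.complete ℂ 𝓐
    exact diff_comp_deriv (hasDerivAt_exp_smul_const (𝕂 := ℝ) (r x : 𝓐) (s p)) hsd v
  have h5 : diff J (fun q => ((((f q * dualExp r x (s q)).grp : linearGroup 𝔤) : 𝓐ˣ) : 𝓐)) p v
      = ((f p).grp : 𝓐ˣ) * (diff J s p v • (((e : 𝓐ˣ) : 𝓐) * (r x : 𝓐)))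
        + diff J (fun q => (((f q).grp : 𝓐ˣ) : 𝓐)) p v * ((e : 𝓐ˣ) : 𝓐) := by
    rw [← h4]
    exact diff_bilinear (ContinuousLinearMap.mul ℝ 𝓐)
      (hf.smooth_grp.mdifferentiable (by simp) p) (he.mdifferentiable (by simp) p) v
  -- The vector part of the logarithmic derivative of the product; by `Ad_inv_map_dualExp`, applying
  -- `r` to it gives the group part.
  have h6 : Ad ((f p).grp * e)⁻¹ (dX + (Ad (f p).grp (diff J s p v • Ad e x)
        + ⁅twist r (f p).grp dX, Ad (f p).grp (dualExp r x (s p)).vec⁆))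
      = Ad e⁻¹ (u + ⁅r u, (dualExp r x (s p)).vec⁆) + diff J s p v • x := by
    rw [mul_inv_rev, Ad_mul, twist_apply, ← Ad_lie, ← map_add (Ad (f p).grp),
      map_add (Ad (f p).grp⁻¹), Ad_inv_Ad, ← hu]
    simp only [map_add, map_real_smul, Ad_inv_Ad]
    abel
  rw [h3]
  change (((((f p).grp * e : linearGroup 𝔤) : 𝓐ˣ)⁻¹ : 𝓐ˣ) : 𝓐) * _
    = (r (Ad ((f p).grp * e)⁻¹ _) : 𝔤)
  rw [h6, map_add, ← Ad_inv_map_dualExp hr, map_real_smul, h5]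
  have h7 := hf.tangent p v
  rw [← hdX, ← hu] at h7
  have h8 : ((Ad e⁻¹ (r u) + diff J s p v • r x : 𝔤) : 𝓐)
      = (Ad e⁻¹ (r u) : 𝔤) + diff J s p v • ((r x : 𝔤) : 𝓐) := rfl
  refine Eq.trans ?_ h8.symm
  rw [coe_Ad, ← h7]
  simp [mul_add, mul_assoc, add_comm]

end Translation

/-! ### The variation of the map to the dual group -/

section

open OrientedAtlas

variable [T2Space M] [IsManifold I ∞ M] {tr : LinearMap.BilinForm ℂ 𝔤} {r : 𝔤 →ₗ[ℂ] 𝔤}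
  {𝒜 : OrientedAtlas I M} (htr_symm : ∀ x y, tr x y = tr y x)
  (htr_inv : ∀ x y z : 𝔤, tr ⁅x, y⁆ z = tr x ⁅y, z⁆) (hr : IsTriangularRMatrix tr r)

/-- The family of maps `f · exp (t b (r z + z ε))`, for a function `b` supported in a chart. -/
def bumpFamily (𝒜 : OrientedAtlas I M) (r : 𝔤 →ₗ[ℂ] 𝔤) (f : M → Double 𝔤) (m : ℕ) (b : Plane → ℝ)
    (z : 𝔤) (t : ℝ) (p : M) : Double 𝔤 :=
  f p * dualExp r z (t * 𝒜.lift m b p)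

theorem bumpFamily_zero (f : M → Double 𝔤) (m : ℕ) (b : Plane → ℝ) (z : 𝔤) :
    bumpFamily 𝒜 r f m b z 0 = f := by
  ext1 p
  rw [bumpFamily, zero_mul, dualExp_zero, mul_one]

theorem bumpFamily_of_lift_eq_zero {f : M → Double 𝔤} {m : ℕ} {b : Plane → ℝ} {p : M}
    (hp : 𝒜.lift m b p = 0) (z : 𝔤) (t : ℝ) : bumpFamily 𝒜 r f m b z t p = f p := by
  rw [bumpFamily, hp, mul_zero, dualExp_zero, mul_one]

/-- As `Ad_h` is invertible, these variations reach every direction of `𝔤` at each point although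
the field stays in `G_r`. -/
theorem deriv_bumpFamily_vec (f : M → Double 𝔤) (m : ℕ) (b : Plane → ℝ) (z : 𝔤) (p : M) :
    deriv (fun t => (bumpFamily 𝒜 r f m b z t p).vec) 0 = 𝒜.lift m b p • Ad (f p).grp z := by
  have h1 : HasDerivAt (fun t : ℝ => t * 𝒜.lift m b p) (1 * 𝒜.lift m b p) 0 :=
    (hasDerivAt_id (0 : ℝ)).mul_const _
  have h2 := (hasDerivAt_dualExp_vec (r := r) z (0 * 𝒜.lift m b p)).scomp (0 : ℝ) h1
  rw [zero_mul, zero_smul, expG_zero, Ad_one, one_mul] at h2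
  have h3 := ((endL (Ad (f p).grp)).hasFDerivAt.comp_hasDerivAt (0 : ℝ) h2).const_add (f p).vec
  refine HasDerivAt.deriv (h3.congr_deriv ?_)
  rw [map_smul, endL_apply]

include hr in
theorem isSmoothDualMap_bumpFamily {f : M → Double 𝔤} (hf : IsSmoothDualMap I r f) {m : ℕ}
    {b : Plane → ℝ} (hb : 𝒜.IsBump m b) (z : 𝔤) :
    IsSmoothDualMap (𝓘(ℝ, ℝ).prod I) r
      (fun q : ℝ × M => bumpFamily 𝒜 r f m b z q.1 q.2) :=
  (hf.comp (Φ := Prod.snd) contMDiff_snd).mul_dualExp hr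
    (contMDiff_fst.smul (hb.contMDiff_lift.comp contMDiff_snd)) z

-- Since `dX + [A, X] = 0`, the first variation is that of BF-theory. In it the covariant term
-- vanishes and the exact term integrates to zero, which leaves the curvature tested against `∂ₜX =
-- b Ad_h z`.
include htr_symm htr_inv hr in
theorem integral_curv_eq_zero {f : M → Double 𝔤} (hf : IsSmoothDualMap I r f)
    {A : OneForm 𝔤 I M} (hA : 𝒜.IsSmooth A) (h : IsStationaryDual tr r 𝒜 f A)
    (hc : ∀ p (v : TangentSpace I p), covariantDiff (fun p => (f p).vec) A p v = 0) {m : ℕ}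
    {b : Plane → ℝ} (hb : 𝒜.IsBump m b) (z : 𝔤) :
    ∫ y in tsupport b, (b y : ℂ)
      * tr (Ad (f ((𝒜.coord m).symm y)).grp z) (𝒜.curv m A y) = 0 := by
  have hK := hb.isCompact_liftSupport
  have hKi := hb.liftSupport_subset_interior
  have hF := isSmoothDualMap_bumpFamily hr hf hb z
  have hB : 𝒜.IsSmoothFamily fun _ => A := hA.isSmoothFamily
  let Y : ℝ → M → 𝔤 := fun t p => (bumpFamily 𝒜 r f m b z t p).vec
  have hY : ContMDiff (𝓘(ℝ, ℝ).prod I) 𝓘(ℝ, 𝔤) ∞ (fun q : ℝ × M => Y q.1 q.2) := hF.smooth_vec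
  have hF0 := bumpFamily_zero (𝒜 := 𝒜) (r := r) f m b z
  have hFp (t : ℝ) (p : M) (hp : p ∉ 𝒜.liftSupport m b) : bumpFamily 𝒜 r f m b z t p = f p :=
    bumpFamily_of_lift_eq_zero (lift_of_notMem hp) z t
  have h1 := h _ hK hKi (bumpFamily 𝒜 r f m b z) (fun _ => A) hF0 rfl hF hB
    fun t p hp => ⟨hFp t p hp, rfl⟩
  have h2 := hasDerivAt_dualAction htr_symm htr_inv hr hK hKi hF
    (fun t p hp => by rw [hFp t p hp, hF0]) hB (by rw [hF0]; exact hc)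
  have hL := isC1Family_bfForm tr hY hB
  have h3 : 𝒜.integral (𝒜.liftSupport m b) (derivForm (fun t => bfForm tr (Y t) A) 0) = 0 :=
    h2.unique h1
  rw [integral_eq_chart hK (isAlternating_derivForm (fun t => isAlternating_bfForm tr (Y t) A) 0) m
    hK hb.liftSupport_subset_source subset_rfl (fun p hp hp' => absurd hp hp')
    (hL.isContinuous_derivForm hKi 0 m), hb.region_liftSupport] at h3
  have hmeas := (isClosed_tsupport b).measurableSet
  have hY0 : Y 0 = fun p => (f p).vec := by ext1 p; simp only [Y, hF0]
  rw [setIntegral_congr_fun hmeas (g := fun y => curl (𝒜.pull m (bfPotential tr Y (fun _ => A) 0)) y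
    - (b y : ℂ) * tr (Ad (f ((𝒜.coord m).symm y)).grp z) (𝒜.curv m A y))] at h3
  · have hpull := contDiffOn_pull_bfPotential (tr := tr) hY hB m 0
    have i1 := ((continuousOn_curl isOpen_interior hpull).mono
      hb.tsupport_subset).integrableOn_compact (μ := volume) hb.hasCompactSupport.isCompact
    have hg : ContinuousOn (fun y => (b y : ℂ) * tr (Ad (f ((𝒜.coord m).symm y)).grp z)
        (𝒜.curv m A y)) (𝒜.coord m).target :=
      (Complex.continuous_ofReal.comp hb.contDiff.continuous).continuousOn.mul
        (continuousOn_form tr (continuousOn_Ad (hf.smooth_grp.continuous.comp_continuousOn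
          (𝒜.continuousOn_coord_symm m)) continuousOn_const) (continuousOn_curv hA m))
    have i2 := (hg.mono hb.subset_target).integrableOn_compact (μ := volume)
      hb.hasCompactSupport.isCompact
    rw [MeasureTheory.integral_sub i1 i2, integral_curl_eq_zero isOpen_interior hpull
      hb.hasCompactSupport.isCompact subset_rfl hb.tsupport_subset hmeas, zero_sub,
      neg_eq_zero] at h3
    · exact h3
    · intro y hy hyb
      have hl : 𝒜.lift m b ((𝒜.coord m).symm y) = 0 := by
        rw [lift_symm (interior_subset hy), image_eq_zero_of_notMem_tsupport hyb]
      ext v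
      rw [pull_apply]
      change tr (deriv (fun t => Y t ((𝒜.coord m).symm y)) 0) _ = 0
      rw [deriv_bumpFamily_vec, hl, zero_smul, map_zero, LinearMap.zero_apply]
  · intro y hy
    have hyi := hb.tsupport_subset hy
    refine (density_derivForm_bfForm htr_inv hY hB hyi 0).trans ?_
    rw [hY0, hc, hc, deriv_bumpFamily_vec, lift_symm (interior_subset hyi), form_real_smul_left]
    simp

include htr_symm htr_inv hr in
theorem isFlat_of_isStationaryDual (htr_nondeg : tr.Nondegenerate) {f : M → Double 𝔤}
    (hf : IsSmoothDualMap I r f) {A : OneForm 𝔤 I M} (hA : 𝒜.IsSmooth A)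
    (h : IsStationaryDual tr r 𝒜 f A) : 𝒜.IsFlat A := by
  have hc := covariantDiff_eq_zero htr_symm htr_inv hr hf hA htr_nondeg h
  refine isFlat_iff_curv.2 fun m y hy => ?_
  refine EqOn.of_subset_closure (g := fun _ => 0) (fun y hy => ?_) (continuousOn_curv hA m)
    continuousOn_const interior_subset (𝒜.target_subset_closure_interior m) hy
  refine htr_nondeg.2 _ fun Z => ?_
  have hcont (z : 𝔤) : ContinuousOn (fun y => tr (Ad (f ((𝒜.coord m).symm y)).grp z)
      (𝒜.curv m A y)) (interior (𝒜.coord m).target) :=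
    (continuousOn_form tr (continuousOn_Ad (hf.smooth_grp.continuous.comp_continuousOn
      (𝒜.continuousOn_coord_symm m)) continuousOn_const) (continuousOn_curv hA m)).mono
      interior_subset
  -- The constant vector `z` is adapted to the point `y` under consideration, so that `Ad_h z`
  -- equals the prescribed `Z` there.
  have := eq_zero_of_integral_bump (hcont (Ad (f ((𝒜.coord m).symm y)).grp⁻¹ Z))
    (fun b hb => integral_curv_eq_zero htr_symm htr_inv hr hf hA h hc hb _) y hy
  rwa [Ad_Ad_inv] at this

/-! ### Classical equivalence -/

include htr_symm htr_inv hr in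
theorem isStationaryDual_iff (htr_nondeg : tr.Nondegenerate) {f : M → Double 𝔤}
    (hf : IsSmoothDualMap I r f) {A : OneForm 𝔤 I M} (hA : 𝒜.IsSmooth A) :
    IsStationaryDual tr r 𝒜 f A ↔ EquationsOfMotion 𝒜 (fun p => (f p).vec) A :=
  ⟨fun h => ⟨covariantDiff_eq_zero htr_symm htr_inv hr hf hA htr_nondeg h,
    isFlat_of_isStationaryDual htr_symm htr_inv hr htr_nondeg hf hA h⟩,
    isStationaryDual_of_equationsOfMotion htr_symm htr_inv hr⟩

theorem isTriangularRMatrix_zero (tr : LinearMap.BilinForm ℂ 𝔤) :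
    IsTriangularRMatrix tr (0 : 𝔤 →ₗ[ℂ] 𝔤) :=
  ⟨fun x y => by simp, fun x y => by simp⟩

include htr_symm in
/-- BF-theory is the model with `r = 0`. -/
theorem isStationaryBF_iff_dual_zero (X : M → 𝔤) (A : OneForm 𝔤 I M) :
    IsStationaryBF tr 𝒜 X A ↔ IsStationaryDual tr 0 𝒜 (fun p => (⟨X p, 1⟩ : Double 𝔤)) A := by
  constructor
  · intro h K hK hKi F B hF0 hB0 hF hB hFB
    -- For `r = 0` every admissible variation has trivial group part, so varying `X̄` is the same as
    -- varying `X`.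
    have e (t : ℝ) (p : M) : F t p = ⟨(F t p).vec, 1⟩ := by
      have : (F t p) ∈ (dualGroup (0 : 𝔤 →ₗ[ℂ] 𝔤) : Set (Double 𝔤)) := hF.mem (t, p)
      rw [dualGroup_zero] at this
      exact Double.ext rfl this
    have h1 := h K hK hKi (fun t p => (F t p).vec) B (by rw [hF0]) hB0 hF.smooth_vec hB
      fun t p hp => ⟨by rw [(hFB t p hp).1], (hFB t p hp).2⟩
    refine h1.congr_of_eventuallyEq (Filter.Eventually.of_forall fun t => ?_)
    refine Eq.trans ?_ (dualAction_zero htr_symm 𝒜 (fun p => (F t p).vec) (B t) K)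
    exact congrArg (fun g => dualAction tr 0 𝒜 K g (B t)) (funext (e t))
  · intro h K hK hKi Y B hY0 hB0 hY hB hYB
    have h1 := h K hK hKi (fun t p => ⟨Y t p, 1⟩) B (by rw [hY0]) hB0
      (IsSmoothDualMap.of_vec hY) hB fun t p hp => ⟨by rw [(hYB t p hp).1], (hYB t p hp).2⟩
    refine h1.congr_of_eventuallyEq (Filter.Eventually.of_forall fun t => ?_)
    exact (dualAction_zero htr_symm 𝒜 (Y t) (B t) K).symm

-- The zero operator is a triangular `r`-matrix, so the equations of motion of BF-theory are an
-- instance of those of the dual model.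
include htr_symm htr_inv in
theorem isStationaryBF_iff (htr_nondeg : tr.Nondegenerate) {X : M → 𝔤}
    (hX : ContMDiff I 𝓘(ℝ, 𝔤) ∞ X) {A : OneForm 𝔤 I M} (hA : 𝒜.IsSmooth A) :
    IsStationaryBF tr 𝒜 X A ↔ EquationsOfMotion 𝒜 X A :=
  (isStationaryBF_iff_dual_zero htr_symm X A).trans
    (isStationaryDual_iff htr_symm htr_inv (isTriangularRMatrix_zero tr) htr_nondeg
      (IsSmoothDualMap.of_vec hX) hA)

end

end DualTriangular

end

/-! ### The theorem, assembled. -/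

open DualTriangular in
theorem mainTheorem11 {𝓐 : Type*} [NormedRing 𝓐] [NormedAlgebra ℂ 𝓐] [FiniteDimensional ℂ 𝓐]
    (𝔤 : LieSubalgebra ℂ 𝓐) [LieAlgebra.IsSimple ℂ 𝔤]
    (tr : LinearMap.BilinForm ℂ 𝔤) (htr_symm : ∀ x y, tr x y = tr y x)
    (htr_nondeg : tr.Nondegenerate) (htr_inv : ∀ x y z : 𝔤, tr ⁅x, y⁆ z = tr x ⁅y, z⁆)
    (r : 𝔤 →ₗ[ℂ] 𝔤) (hr : IsTriangularRMatrix tr r)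
    {H : Type*} [TopologicalSpace H] (I : ModelWithCorners ℝ Plane H)
    {M : Type*} [TopologicalSpace M] [T2Space M] [ChartedSpace H M] [IsManifold I ∞ M]
    (𝒜 : OrientedAtlas I M) :
    (∀ (f : M → Double 𝔤) (A : OneForm 𝔤 I M), IsSmoothDualMap I r f → 𝒜.IsSmooth A →
      (∀ K : Set M, IsCompact K →
        dualAction tr r 𝒜 K f A = explicitAction tr r 𝒜 K f A ∧
        dualAction tr r 𝒜 K f A = bfAction tr 𝒜 K (fun p => (f p).vec) A
          - (1 / 2) * quadraticTerm tr r 𝒜 K f A + (1 / 2) * topologicalTerm tr r 𝒜 K f) ∧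
      (IsStationaryDual tr r 𝒜 f A ↔ IsStationaryBF tr 𝒜 (fun p => (f p).vec) A) ∧
      (IsStationaryDual tr r 𝒜 f A ↔ EquationsOfMotion 𝒜 (fun p => (f p).vec) A)) ∧
    (∀ K : Set M, IsCompact K → K ⊆ I.interior M → ∀ F : ℝ → M → Double 𝔤,
      IsSmoothDualMap (𝓘(ℝ, ℝ).prod I) r (fun q : ℝ × M => F q.1 q.2) →
      (∀ t, ∀ p ∉ K, F t p = F 0 p) →
      ∀ t, topologicalTerm tr r 𝒜 K (F t) = topologicalTerm tr r 𝒜 K (F 0)) ∧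
    (dualGroup (0 : 𝔤 →ₗ[ℂ] 𝔤) = {a : Double 𝔤 | a.grp = 1} ∧
      (∀ X : M → 𝔤, ContMDiff I 𝓘(ℝ, 𝔤) ∞ X →
        IsSmoothDualMap I (0 : 𝔤 →ₗ[ℂ] 𝔤) (fun p => (⟨X p, 1⟩ : Double 𝔤)) ∧
        ∀ (A : OneForm 𝔤 I M) (K : Set M),
          dualAction tr 0 𝒜 K (fun p => ⟨X p, 1⟩) A = bfAction tr 𝒜 K X A)) := by
  refine ⟨fun f A hf hA => ⟨fun K hK => dualAction_eq htr_symm htr_inv hr hf hA hK, ?_, ?_⟩,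
    fun K hK hKi F hF hF0 t => topologicalTerm_eq htr_symm htr_inv hr hK hKi hF hF0 t,
    dualGroup_zero, fun X hX => ⟨IsSmoothDualMap.of_vec hX, fun A K =>
      dualAction_zero htr_symm 𝒜 X A K⟩⟩
  · exact (isStationaryDual_iff htr_symm htr_inv hr htr_nondeg hf hA).trans
      (isStationaryBF_iff htr_symm htr_inv htr_nondeg hf.smooth_vec hA).symm
  · exact isStationaryDual_iff htr_symm htr_inv hr htr_nondeg hf hA
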